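/- Setting. Let $(N,g)$ be a smooth Riemannian three-manifold with a Killing vector field $X$, let $\varphi$ be the local flow of $X$ and $\omega=\|X\|_g$. Let $J,T$ denote nonempty open intervals, let $U:J\to(0,\infty)$ be smooth, and put $d\sigma^2=ds^2+U(s)^2dt^2$. A $G_X$-invariant surface in natural parameters with metric $d\sigma^2$ is a smooth map $\psi:J\times T\to N$ of the form $\psi(s,t)=\varphi_{v(s,t)}(\gamma(s))$, with $\gamma$ and $v$ smooth, whose induced metric is $d\sigma^2$. For $m\ne0$, the surfaces $\psi_m$ of the Bour family with parameter $m$ are those for which $\gamma$ and $v$ can be chosen with $\partial v/\partial t=1/m$. $X$-adapted coordinates are smooth coordinates $(x_1,x_2,x_3)$ on an open set $V\subset N$ in which $X=\partial/\partial x_3$, with image $B\times I$, $B\subset\mathbb R^2$ open and $I$ an open interval; then $B$ is the local orbit space $V/G_X$, and $\pi=(x_1,x_2)$ the quotient map. The quotient metric $\tilde g$ on $B$ is defined by $\tilde g(w,w)=g(W,W)$, where $W$ is the lift of $w$ orthogonal to $X$. Write $g_{ij}$ for the coefficients of $g$ and $(g^{ij})$ for the inverse matrix. Theorem B. The surfaces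 $\psi_m$ are determined explicitly by $m$ and $d\sigma^2$ through the following integration procedure. 1. (Adapted coordinates.) Around every point where $X\neq0$ there are $X$-adapted coordinates. In any such coordinates the $g_{ij}$ and $\omega=\sqrt{g_{33}}$ do not depend on $x_3$, the local flow of $X$ in $V$ is the translation of $x_3$, and $\pi:V\to(B,\tilde g)$ is a Riemannian submersion. 2. (Orthogonal coordinates on the orbit space.) Around the projection to $B$ of every point of $V$ where $d\omega\neq0$ there are an open set $D\subset B$ and a smooth function $\theta$ on $D$ such that $d\omega$ and $d\theta$ do not vanish on $D$, $\theta$ solves the linear first-order equation $$\Big(g^{11}\tfrac{\partial\omega}{\partial x_1}+g^{12}\tfrac{\partial\omega}{\partial x_2}\Big)\tfrac{\partial\theta}{\partial x_1}+\Big(g^{12}\tfrac{\partial\omega}{\partial x_1}+g^{22}\tfrac{\partial\omega}{\partial x_2}\Big)\tfrac{\partial\theta}{\partial x_2}=0,$$ and $\Psi=(\omega,\theta)$ is injective on $D$. For any such $(D,\theta)$, $\Psi$ is a diffeomorphism of $D$ onto an open subset of $\mathbb R^2$, $g(\nabla\omega,\nabla\theta)=0$, the nonzero functions $\|\nabla\omega\|$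 and $\|\nabla\theta\|$ do not depend on $x_3$, and $\tilde g=\|\nabla\omega\|^{-2}d\omega^2+\|\nabla\theta\|^{-2}d\theta^2$. 3. (Explicit form.) Every $G_X$-invariant surface in natural parameters with metric $d\sigma^2$ belongs to the Bour family for exactly one $m\ne0$. Fix $m\neq0$, $X$-adapted coordinates and $s_0\in J$. A map $\psi$ on $J\times T$ is a surface $\psi_m$ with image in $V$ if and only if, in these coordinates, $$\psi(s,t)=\Big(x_1(s),\,x_2(s),\;c+\frac tm-\sum_{i=1}^2\int_{s_0}^s\frac{x_i'\,g_{i3}(x_1,x_2)}{m^2U^2}\,ds\Big)$$ with values in $B\times I$, for some constant $c$ and some smooth profile curve $\tilde\gamma=(x_1,x_2):J\to B$ that satisfies $\omega(\tilde\gamma(s))=|m|U(s)$ and has unit speed for $\tilde g$. (This includes the case of constant $\omega$, where the first condition says that $U$ is the constant $\omega/|m|$.) 4. (Independence of the lift.) Let $\tilde\gamma$ be such a profile curve, $\gamma:J\to V$ any smooth lift of it, with third coordinate $x_3(s)$, and $v(s,t)=a+\frac tm-\int_{s_0}^s\frac{g(X,\gamma')}{m^2U^2}ds$ with $a\in\mathbb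 R$. Then $x_3(s)+v(s,t)$ is the third coordinate displayed in 3 with $c=a+x_3(s_0)$, and wherever it lies in $I$ the point $\varphi_{v(s,t)}(\gamma(s))$ (flow in $V$) is the point $\psi(s,t)$ of 3; so up to the constant of integration the surface does not depend on the lift. 5. (Profile curve.) Let $(D,\theta)$ be as in 2. A curve $\tilde\gamma$ on $J$ is a profile curve as in 3 with values in $D$ if and only if $\tilde\gamma(s)=\Psi^{-1}(|m|U(s),\theta(s))$ for a smooth function $\theta(s)$ with $(|m|U(s),\theta(s))\in\Psi(D)$ such that, at every $s\in J$, $m^2U'(s)^2\le\|\nabla\omega\|^2$ and, for a sign $\varepsilon=\pm1$, $$\|\nabla\theta\|\sqrt{\|\nabla\omega\|^2-m^2U'(s)^2}+\varepsilon\,\|\nabla\omega\|\,\theta'(s)=0,$$ where $\|\nabla\omega\|,\|\nabla\theta\|$ are evaluated at $(\omega,\theta)=(|m|U(s),\theta(s))$. If $m^2U'^2<\|\nabla\omega\|^2$ along the curve, then $\varepsilon$ can be taken constant. For either sign, if $s_0\in J$, $y_0\in D$, $\omega(y_0)=|m|U(s_0)$ and $m^2U'(s_0)^2<\|\nabla\omega\|^2(y_0)$,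 then the initial value problem $\theta(s_0)=\theta(y_0)$ has a smooth solution satisfying this strict inequality on an open interval around $s_0$, and any two such solutions on the same open interval agree. -/

import Mathlib

open Set Manifold
open scoped ContDiff

noncomputable section

/-- The model space of a three-manifold. -/
abbrev E3 : Type := EuclideanSpace ℝ (Fin 3)

/-- A smooth Riemannian metric on a three-manifold. -/
abbrev Metric3 (N : Type*) [TopologicalSpace N] [ChartedSpace E3 N]
    [IsManifold (𝓡 3) ∞ N] : Type _ :=
  Bundle.ContMDiffRiemannianMetric (𝓡 3) ∞ E3 (fun x : N => TangentSpace (𝓡 3) x)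

/-- A nonempty open interval of the real line, possibly unbounded. -/
def IsOpenInterval (J : Set ℝ) : Prop := IsOpen J ∧ J.OrdConnected ∧ J.Nonempty

section Geometry

variable {N : Type*} [TopologicalSpace N] [ChartedSpace E3 N] [IsManifold (𝓡 3) ∞ N]

/-- Smoothness of a vector field at a point. -/
def SmoothFieldAt (Y : (x : N) → TangentSpace (𝓡 3) x) (x : N) : Prop :=
  ContMDiffAt (𝓡 3) (𝓡 3).tangent ∞ (fun y => (⟨y, Y y⟩ : TangentBundle (𝓡 3) N)) x

/-- `X` is a smooth Killing vector field: the Lie derivative of `g` along `X` vanishes, that is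
`X (g(Y,Z)) = g([X,Y],Z) + g(Y,[X,Z])` for all smooth (local) vector fields `Y`, `Z`. -/
structure IsKilling (g : Metric3 N) (X : (x : N) → TangentSpace (𝓡 3) x) : Prop where
  smooth : ∀ x, SmoothFieldAt X x
  lie_eq_zero : ∀ (x : N) (Y Z : (x : N) → TangentSpace (𝓡 3) x),
    SmoothFieldAt Y x → SmoothFieldAt Z x →
      mfderiv (𝓡 3) 𝓘(ℝ, ℝ) (fun y => g.inner y (Y y) (Z y)) x (X x)
        = g.inner x (VectorField.mlieBracket (𝓡 3) X Y x) (Z x)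
          + g.inner x (Y x) (VectorField.mlieBracket (𝓡 3) X Z x)

/-- `q = φ_r(p)`, where `φ` is the local flow of `X` restricted to `V`: an integral curve of `X`
inside `V`, defined on an open interval containing `0` and `r`, goes from `p` to `q`. -/
def FlowsTo (X : (x : N) → TangentSpace (𝓡 3) x) (V : Set N) (p : N) (r : ℝ) (q : N) : Prop :=
  ∃ (c : ℝ → N) (a b : ℝ), 0 ∈ Ioo a b ∧ r ∈ Ioo a b ∧
    IsMIntegralCurveOn c X (Ioo a b) ∧ MapsTo c (Ioo a b) V ∧ c 0 = p ∧ c r = q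

/-- The volume function `ω = ‖X‖` of the orbits. -/
def volumeFn (g : Metric3 N) (X : (x : N) → TangentSpace (𝓡 3) x) (q : N) : ℝ :=
  Real.sqrt (g.inner q (X q) (X q))

/-- Velocity of a curve in `N`. -/
def velocity (γ : ℝ → N) (s : ℝ) : TangentSpace (𝓡 3) (γ s) :=
  mfderiv 𝓘(ℝ, ℝ) (𝓡 3) γ s (1 : ℝ)

/-- First partial derivative `ψ_s` of a parametrized surface. -/
def partialS (ψ : ℝ × ℝ → N) (p : ℝ × ℝ) : TangentSpace (𝓡 3) (ψ p) :=
  mfderiv 𝓘(ℝ, ℝ × ℝ) (𝓡 3) ψ p ((1, 0) : ℝ × ℝ)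

/-- Second partial derivative `ψ_t` of a parametrized surface. -/
def partialT (ψ : ℝ × ℝ → N) (p : ℝ × ℝ) : TangentSpace (𝓡 3) (ψ p) :=
  mfderiv 𝓘(ℝ, ℝ × ℝ) (𝓡 3) ψ p ((0, 1) : ℝ × ℝ)

/-- The metric induced by `ψ` on `J × T` is `dσ² = ds² + U(s)² dt²`. -/
def HasInducedMetric (g : Metric3 N) (U : ℝ → ℝ) (J T : Set ℝ) (ψ : ℝ × ℝ → N) : Prop :=
  ∀ s ∈ J, ∀ t ∈ T,
    g.inner (ψ (s, t)) (partialS ψ (s, t)) (partialS ψ (s, t)) = 1 ∧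
    g.inner (ψ (s, t)) (partialS ψ (s, t)) (partialT ψ (s, t)) = 0 ∧
    g.inner (ψ (s, t)) (partialT ψ (s, t)) (partialT ψ (s, t)) = U s ^ 2

/-- `ψ(s,t) = φ_{v(s,t)}(γ(s))` on `J × T`, with `γ` and `v` smooth and `φ` the local flow of `X`. -/
def IsFlowOut (X : (x : N) → TangentSpace (𝓡 3) x) (J T : Set ℝ) (γ : ℝ → N) (v : ℝ × ℝ → ℝ)
    (ψ : ℝ × ℝ → N) : Prop :=
  ContMDiffOn 𝓘(ℝ, ℝ) (𝓡 3) ∞ γ J ∧ ContDiffOn ℝ ∞ v (J ×ˢ T) ∧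
    ∀ s ∈ J, ∀ t ∈ T, FlowsTo X univ (γ s) (v (s, t)) (ψ (s, t))

/-- `ψ : J × T → N` is a `G_X`-invariant surface in natural parameters with induced metric
`ds² + U(s)² dt²`. -/
def IsNaturalSurface (g : Metric3 N) (X : (x : N) → TangentSpace (𝓡 3) x) (U : ℝ → ℝ)
    (J T : Set ℝ) (ψ : ℝ × ℝ → N) : Prop :=
  ContMDiffOn 𝓘(ℝ, ℝ × ℝ) (𝓡 3) ∞ ψ (J ×ˢ T) ∧ HasInducedMetric g U J T ψ ∧
    ∃ γ v, IsFlowOut X J T γ v ψ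

/-- `ψ` is the surface of parameter `m` in the Bour family of `ds² + U(s)² dt²`: a `G_X`-invariant
surface `ψ(s,t) = φ_{v(s,t)}(γ(s))` in natural parameters with that metric and `∂v/∂t = 1/m`. -/
def IsBourSurface (g : Metric3 N) (X : (x : N) → TangentSpace (𝓡 3) x) (U : ℝ → ℝ) (m : ℝ)
    (J T : Set ℝ) (ψ : ℝ × ℝ → N) : Prop :=
  ContMDiffOn 𝓘(ℝ, ℝ × ℝ) (𝓡 3) ∞ ψ (J ×ˢ T) ∧ HasInducedMetric g U J T ψ ∧
    ∃ γ v, IsFlowOut X J T γ v ψ ∧ ∀ p ∈ J ×ˢ T, fderiv ℝ v p (0, 1) = 1 / m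

/-- Every linear form on a tangent space is represented by a vector. -/
theorem exists_grad (g : Metric3 N) (f : N → ℝ) (q : N) :
    ∃ w : TangentSpace (𝓡 3) q, ∀ u : TangentSpace (𝓡 3) q,
      g.inner q w u = mfderiv (𝓡 3) 𝓘(ℝ, ℝ) f q u := by
  let L : E3 →ₗ[ℝ] Module.Dual ℝ E3 :=
    { toFun := fun w => (g.inner q w).toLinearMap
      map_add' := fun a b => by
        ext u; exact congrArg (fun h => h u) (map_add (g.inner q) a b)
      map_smul' := fun r a => by
        ext u; exact congrArg (fun h => h u) (map_smul (g.inner q) r a) }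
  have hinj : Function.Injective L := by
    rw [injective_iff_map_eq_zero]
    intro w hw
    by_contra hne
    have h1 : 0 < g.inner q w w := g.pos q w hne
    have h2 : g.inner q w w = 0 := congrArg (fun h : Module.Dual ℝ E3 => h w) hw
    exact h1.ne' h2
  have hsurj : Function.Surjective L :=
    (LinearMap.injective_iff_surjective_of_finrank_eq_finrank
      (Subspace.dual_finrank_eq (K := ℝ) (V := E3)).symm).1 hinj
  obtain ⟨w, hw⟩ := hsurj (mfderiv (𝓡 3) 𝓘(ℝ, ℝ) f q : E3 →L[ℝ] ℝ).toLinearMap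
  exact ⟨w, fun u => congrArg (fun h : Module.Dual ℝ E3 => h u) hw⟩

/-- The gradient of a function with respect to `g`. -/
def grad (g : Metric3 N) (f : N → ℝ) (q : N) : TangentSpace (𝓡 3) q :=
  (exists_grad g f q).choose

/-- The length `‖∇f‖` of the gradient. -/
def gradNorm (g : Metric3 N) (f : N → ℝ) (q : N) : ℝ :=
  Real.sqrt (g.inner q (grad g f q) (grad g f q))

/-- `X`-adapted coordinates `(x₁,x₂,x₃)`: a smooth chart of `N` in which `X = ∂/∂x₃`. Its image
is a product `base × fib` of an open set of the plane and an open interval, so that `base` is the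
local orbit space `V/G_X` with quotient map `π = (x₁,x₂)`. The number `level ∈ fib` only serves to
regard a function that does not depend on `x₃` as a function on `base`. -/
structure AdaptedChart (X : (x : N) → TangentSpace (𝓡 3) x) where
  chart : OpenPartialHomeomorph N E3
  mem_atlas : chart ∈ IsManifold.maximalAtlas (𝓡 3) ∞ N
  base : Set (ℝ × ℝ)
  isOpen_base : IsOpen base
  fib : Set ℝ
  isOpenInterval_fib : IsOpenInterval fib
  target_eq : chart.target = {y : E3 | (y 0, y 1) ∈ base ∧ y 2 ∈ fib}
  field_eq : ∀ q ∈ chart.source,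
    mfderiv (𝓡 3) 𝓘(ℝ, E3) chart q (X q) = (EuclideanSpace.single 2 1 : E3)
  level : ℝ
  level_mem : level ∈ fib

namespace AdaptedChart

variable {X : (x : N) → TangentSpace (𝓡 3) x} (A : AdaptedChart X)

/-- The point with coordinates `(y.1, y.2, z)`. -/
def pt (y : ℝ × ℝ) (z : ℝ) : N := A.chart.symm !₂[y.1, y.2, z]

/-- The projection `π = (x₁,x₂)` to the orbit space. -/
def proj (q : N) : ℝ × ℝ := (A.chart q 0, A.chart q 1)

/-- The coordinate `x₃`. -/
def height (q : N) : ℝ := A.chart q 2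

/-- The coordinate field `∂/∂x_{i+1}`. -/
def coordField (i : Fin 3) (q : N) : TangentSpace (𝓡 3) q :=
  mfderiv 𝓘(ℝ, E3) (𝓡 3) A.chart.symm (A.chart q) (EuclideanSpace.single i 1 : E3)

/-- The coefficients of the metric in the chart (indices start from `0`). -/
def coeff (g : Metric3 N) (i j : Fin 3) (q : N) : ℝ :=
  g.inner q (A.coordField i q) (A.coordField j q)

/-- The coefficients of the metric as functions of `(x₁,x₂)`. -/
def coeffB (g : Metric3 N) (i j : Fin 3) (y : ℝ × ℝ) : ℝ := A.coeff g i j (A.pt y A.level)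

/-- The entries `g^{ij}` of the inverse matrix as functions of `(x₁,x₂)`. -/
def coeffInv (g : Metric3 N) (i j : Fin 3) (y : ℝ × ℝ) : ℝ :=
  (Matrix.of fun k l => A.coeffB g k l y)⁻¹ i j

/-- The volume function as a function of `(x₁,x₂)`. -/
def volumeB (g : Metric3 N) (y : ℝ × ℝ) : ℝ := volumeFn g X (A.pt y A.level)

/-- The horizontal lift of a tangent vector `w` of the orbit space at `y`: the vector projecting
to `w` which is orthogonal to `X = ∂/∂x₃`. -/
def horLift (g : Metric3 N) (y w : ℝ × ℝ) : TangentSpace (𝓡 3) (A.pt y A.level) :=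
  w.1 • A.coordField 0 (A.pt y A.level) + w.2 • A.coordField 1 (A.pt y A.level)
    - ((w.1 * A.coeffB g 0 2 y + w.2 * A.coeffB g 1 2 y) / A.coeffB g 2 2 y) •
      A.coordField 2 (A.pt y A.level)

/-- The squared length `g̃(w,w)` of `w` at `y` for the quotient metric of the orbit space. -/
def quotSq (g : Metric3 N) (y w : ℝ × ℝ) : ℝ :=
  g.inner (A.pt y A.level) (A.horLift g y w) (A.horLift g y w)

/-- `σ` is the profile curve of a surface of parameter `m`: `ω(s) = |m| U(s)` along `σ` and `σ` has
unit speed for the quotient metric. -/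
def IsProfile (g : Metric3 N) (U : ℝ → ℝ) (m : ℝ) (J : Set ℝ) (σ : ℝ → ℝ × ℝ) : Prop :=
  ContDiffOn ℝ ∞ σ J ∧ ∀ s ∈ J, σ s ∈ A.base ∧ A.volumeB g (σ s) = |m| * U s ∧
    A.quotSq g (σ s) (deriv σ s) = 1

/-- The function
`c + t/m - ∑_{i=1,2} ∫_{s₀}^s x_i' g_{i3}(x₁,x₂) / (m² U²)`, where `σ = (x₁,x₂)`. -/
def thirdCoord (g : Metric3 N) (U : ℝ → ℝ) (m : ℝ) (σ : ℝ → ℝ × ℝ) (s₀ c s t : ℝ) : ℝ :=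
  c + t / m - ∫ r in s₀..s,
    ((deriv σ r).1 * A.coeffB g 0 2 (σ r) + (deriv σ r).2 * A.coeffB g 1 2 (σ r))
      / (m ^ 2 * U r ^ 2)

/-- `(ω,θ)` are orthogonal coordinates on the open set `D` of the orbit space: `∇ω` and `∇θ` do not
vanish, `θ` solves the linear first order equation
`(g¹¹ ω₁ + g¹² ω₂) θ₁ + (g¹² ω₁ + g²² ω₂) θ₂ = 0`, and `(ω,θ)` is injective on `D`. -/
structure IsOrbitCoord (g : Metric3 N) (D : Set (ℝ × ℝ)) (θ : ℝ × ℝ → ℝ) : Prop where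
  isOpen : IsOpen D
  subset : D ⊆ A.base
  smooth : ContDiffOn ℝ ∞ θ D
  volume_ne : ∀ y ∈ D, fderiv ℝ (A.volumeB g) y ≠ 0
  theta_ne : ∀ y ∈ D, fderiv ℝ θ y ≠ 0
  pde : ∀ y ∈ D,
    (A.coeffInv g 0 0 y * fderiv ℝ (A.volumeB g) y (1, 0)
        + A.coeffInv g 0 1 y * fderiv ℝ (A.volumeB g) y (0, 1)) * fderiv ℝ θ y (1, 0)
      + (A.coeffInv g 0 1 y * fderiv ℝ (A.volumeB g) y (1, 0)
        + A.coeffInv g 1 1 y * fderiv ℝ (A.volumeB g) y (0, 1)) * fderiv ℝ θ y (0, 1) = 0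
  injOn : InjOn (fun y => (A.volumeB g y, θ y)) D

/-- The coordinate map `Ψ = (ω,θ)` on the orbit space. -/
def orbitMap (g : Metric3 N) (θ : ℝ × ℝ → ℝ) (y : ℝ × ℝ) : ℝ × ℝ := (A.volumeB g y, θ y)

/-- The inverse `(ω,θ) ↦ (x₁,x₂)` of the coordinate map on `D`. -/
def orbitInv (g : Metric3 N) (D : Set (ℝ × ℝ)) (θ : ℝ × ℝ → ℝ) : ℝ × ℝ → ℝ × ℝ :=
  Function.invFunOn (A.orbitMap g θ) D

/-- `‖∇ω‖` at a point of the orbit space. -/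
def normGradVolume (g : Metric3 N) (y : ℝ × ℝ) : ℝ := gradNorm g (volumeFn g X) (A.pt y A.level)

/-- `‖∇θ‖` at a point of the orbit space; `θ` is regarded as the `X`-invariant function `θ ∘ π`. -/
def normGradTheta (g : Metric3 N) (θ : ℝ × ℝ → ℝ) (y : ℝ × ℝ) : ℝ :=
  gradNorm g (fun q => θ (A.proj q)) (A.pt y A.level)

/-- The ordinary differential equation `M(s,ϑ) + N(s,ϑ) ϑ' = 0` at the parameter `s`, with
`M = ‖∇θ‖ √(‖∇ω‖² - m² U'²)` and `N = ε ‖∇ω‖`, where `‖∇ω‖` and `‖∇θ‖` are evaluated at the point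
of `D` with coordinates `(ω,θ) = (|m| U(s), ϑ(s))`. It includes the requirements that this point
exists and that the radicand is nonnegative. -/
def ProfileODE (g : Metric3 N) (U : ℝ → ℝ) (m : ℝ) (D : Set (ℝ × ℝ)) (θ : ℝ × ℝ → ℝ) (ε : ℝ)
    (ϑ : ℝ → ℝ) (s : ℝ) : Prop :=
  (|m| * U s, ϑ s) ∈ A.orbitMap g θ '' D ∧
  m ^ 2 * deriv U s ^ 2 ≤ A.normGradVolume g (A.orbitInv g D θ (|m| * U s, ϑ s)) ^ 2 ∧
  A.normGradTheta g θ (A.orbitInv g D θ (|m| * U s, ϑ s))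
      * Real.sqrt (A.normGradVolume g (A.orbitInv g D θ (|m| * U s, ϑ s)) ^ 2
          - m ^ 2 * deriv U s ^ 2)
    + ε * A.normGradVolume g (A.orbitInv g D θ (|m| * U s, ϑ s)) * deriv ϑ s = 0

/-- The strict inequality `m² U'² < ‖∇ω‖²` at the point with `(ω,θ) = (|m| U(s), ϑ(s))`. -/
def Nondegenerate (g : Metric3 N) (U : ℝ → ℝ) (m : ℝ) (D : Set (ℝ × ℝ)) (θ : ℝ × ℝ → ℝ)
    (ϑ : ℝ → ℝ) (s : ℝ) : Prop :=
  m ^ 2 * deriv U s ^ 2 < A.normGradVolume g (A.orbitInv g D θ (|m| * U s, ϑ s)) ^ 2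

end AdaptedChart

end Geometry

end

/-! Everything is pushed down to the orbit space. Once `X` is straightened to `∂/∂x₃` by a flow box,
the coordinate fields commute with `X`, so the Killing equation reduces to `X(g_{ij}) = 0`
(`mfderiv_coeff_field`). The metric then splits as `g(w,w) = g̃(πw,πw) + g(w,X)²/ω²`
(`inner_self_eq`), with `g̃` defined on the base.

For `ψ(s,t) = φ_{v(s,t)}(γ(s))` one has `ψ_t = v_t X`. Comparison with `ds² + U² dt²` gives three
equations: `v_t² ω² = U²`, `ψ_s ⟂ X`, and unit speed of the projection of `ψ` in `g̃`
(`surfaceEqs`). The projection does not depend on `t`. Hence neither does `v_t² = U²/ω²`, nor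
`∂x₃/∂s`, which `ψ_s ⟂ X` expresses through the projection. Symmetry of second derivatives then
gives `∂_s v_t = ∂_t ∂_s x₃ = 0`, so `v_t` is locally constant (`fderiv_factor_eq_zero`).
Connectedness of `J × T` makes it a single nonzero number `1/m`.

With `v_t = 1/m` the equations read `ω = |m| U`, `g̃`-speed one, and `x₁' g₁₃ + x₂' g₂₃ + x₃' m² U²
= 0`. The last one is a quadrature for `x₃`, which produces the explicit third coordinate. The
argument is reversible: `IsBourSurface.exists_profile` and `IsProfile.isBourSurface` are the two
directions.

The profile curve is found in coordinates `(ω,θ)` on the base, where `θ` is a first integral of the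
gradient of `ω`; it comes from a flow box in the plane. As `dω` and `dθ` are orthogonal, `g̃` is
diagonal (`quotSq_eq_add`). Along a curve with `ω = |m| U`, unit speed means `m² U'²/‖∇ω‖² +
θ'²/‖∇θ‖² = 1`, and the profile equation is the square root of this identity (`unit_speed_iff`).
Where the radicand is positive it is a smooth scalar equation `θ' = F(s,θ)`, so that initial value
problems are locally solvable and have unique solutions.

The analytic input is the smoothness of the local flow of a smooth field in all variables, obtained
from the inverse function theorem in the Banach space of continuous curves
(`exists_flow_of_lipschitz`). -/

set_option linter.unusedSectionVars false

/-! ### Smooth dependence of flows on time and initial point. -/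

section Flow

open Filter Topology Metric

/-- The inverse function theorem with smoothness on the whole domain. -/
theorem exists_openPartialHomeomorph_of_contDiffOn {E F : Type*} [NormedAddCommGroup E]
    [NormedSpace ℝ E] [CompleteSpace E] [NormedAddCommGroup F] [NormedSpace ℝ F] {f : E → F}
    {U : Set E} (hU : IsOpen U) (hf : ContDiffOn ℝ ∞ f U) {a : E} (ha : a ∈ U) {L : E ≃L[ℝ] F}
    (hL : HasFDerivAt f (L : E →L[ℝ] F) a) :
    ∃ e : OpenPartialHomeomorph E F, a ∈ e.source ∧ e.source ⊆ U ∧ (∀ x, e x = f x) ∧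
      ContDiffOn ℝ ∞ e.symm e.target := by
  have hfa : ∀ x ∈ U, ContDiffAt ℝ ∞ f x := fun x hx => hf.contDiffAt (hU.mem_nhds hx)
  let e₀ := (hfa a ha).toOpenPartialHomeomorph f hL (by simp)
  have he₀ : ∀ x, e₀ x = f x := fun x => rfl
  -- The inverse is smooth at images of points where the derivative is invertible; these points form
  -- an open set, to which the local homeomorphism is restricted.
  let S : Set E := U ∩ fderiv ℝ f ⁻¹' range ((↑) : (E ≃L[ℝ] F) → E →L[ℝ] F)
  have hS : IsOpen S :=
    (hf.continuousOn_fderiv_of_isOpen hU (by simp)).isOpen_inter_preimage hU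
      ContinuousLinearEquiv.isOpen
  refine ⟨e₀.restrOpen S hS, ⟨(hfa a ha).mem_toOpenPartialHomeomorph_source hL (by simp), ha,
    L, hL.fderiv.symm⟩, fun x hx => hx.2.1, he₀, ?_⟩
  intro y hy
  have hx := (e₀.restrOpen S hS).map_target hy
  obtain ⟨hxU, L', hL'⟩ := hx.2
  refine ContDiffAt.contDiffWithinAt ?_
  refine (e₀.restrOpen S hS).contDiffAt_symm hy (f₀' := L') ?_ (hfa _ hxU)
  rw [hL']
  exact ((hfa _ hxU).differentiableAt (by simp)).hasFDerivAt

/-- Pointwise application of a continuous family of operators to a continuous function. -/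
noncomputable def pointwiseCLM (K : Type*) [TopologicalSpace K] [CompactSpace K] (E F : Type*)
    [NormedAddCommGroup E] [NormedSpace ℝ E] [NormedAddCommGroup F] [NormedSpace ℝ F] :
    C(K, E →L[ℝ] F) →L[ℝ] C(K, E) →L[ℝ] C(K, F) :=
  LinearMap.mkContinuous₂
    (LinearMap.mk₂ ℝ
      (fun (A : C(K, E →L[ℝ] F)) (h : C(K, E)) => (⟨fun t => A t (h t), A.continuous.clm_apply h.continuous⟩ : C(K, F)))
      (fun _ _ _ => by ext; simp) (fun _ _ _ => by ext; simp) (fun _ _ _ => by ext; simp)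
      (fun _ _ _ => by ext; simp)) 1 (by
    intro A h
    rw [one_mul]
    refine (ContinuousMap.norm_le _ (by positivity)).2 fun t => ?_
    exact ((A t).le_opNorm _).trans
      (mul_le_mul (A.norm_coe_le_norm t) (h.norm_coe_le_norm t) (norm_nonneg _)
        (norm_nonneg A)))

variable {K : Type*} [TopologicalSpace K] [CompactSpace K]

/-- The remainder is bounded uniformly on `K` by the mean value inequality on the segment from `α t`
to `α t + k t`. There `f'` differs from `f' (α t)` by at most `c`, because postcomposition with `f'`
is continuous for the sup norm. -/
theorem hasFDerivAt_postcomp {E F : Type*} [NormedAddCommGroup E] [NormedSpace ℝ E]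
    [NormedAddCommGroup F] [NormedSpace ℝ F] {f : E → F} {f' : E → E →L[ℝ] F}
    (hf : Continuous f) (hf' : Continuous f') (h : ∀ x, HasFDerivAt f (f' x) x) (α : C(K, E)) :
    HasFDerivAt (fun β : C(K, E) => (ContinuousMap.mk f hf).comp β)
      (pointwiseCLM K E F ((ContinuousMap.mk f' hf').comp α)) α := by
  rw [hasFDerivAt_iff_isLittleO_nhds_zero, Asymptotics.isLittleO_iff]
  intro c hc
  have hcont : Continuous fun β : C(K, E) => (ContinuousMap.mk f' hf').comp β :=
    ContinuousMap.continuous_postcomp _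
  have hcα : ContinuousAt (fun β : C(K, E) => (ContinuousMap.mk f' hf').comp β) α :=
    hcont.continuousAt
  obtain ⟨δ, hδ, hb⟩ := (Metric.continuousAt_iff (α := C(K, E)) (β := C(K, E →L[ℝ] F))).1 hcα c hc
  filter_upwards [Metric.ball_mem_nhds (0 : C(K, E)) hδ] with k hk
  rw [mem_ball_zero_iff] at hk
  refine (ContinuousMap.norm_le _ (by positivity)).2 fun t => ?_
  have key := (convex_segment (α t) (α t + k t)).norm_image_sub_le_of_norm_hasFDerivWithin_le'
    (f := f) (f' := f') (φ := f' (α t)) (C := c) (fun x _ => (h x).hasFDerivWithinAt) ?_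
    (left_mem_segment ℝ _ _) (right_mem_segment ℝ _ _)
  · simp only [add_sub_cancel_left] at key
    refine key.trans (mul_le_mul_of_nonneg_left (k.norm_coe_le_norm t) hc.le)
  · intro x hx
    rw [segment_eq_image'] at hx
    obtain ⟨θ, hθ, rfl⟩ := hx
    have : dist (α + θ • k) α < δ := by
      rw [dist_eq_norm, add_sub_cancel_left, norm_smul, Real.norm_eq_abs, abs_of_nonneg hθ.1]
      nlinarith [norm_nonneg k, hθ.2]
    have h2 := hb this
    have h3 := (ContinuousMap.dist_apply_le_dist t).trans h2.le
    rw [dist_eq_norm] at h3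
    simpa using h3

/-- The derivative is again a postcomposition, with `fderiv ℝ f`, followed by a continuous linear
map. The induction changes the target space to `E →L[ℝ] F`, so the spaces are quantified inside it.
-/
theorem contDiff_postcomp (n : ℕ) : ∀ {E F : Type} [NormedAddCommGroup E] [NormedSpace ℝ E]
    [NormedAddCommGroup F] [NormedSpace ℝ F] {f : E → F} (hf : ContDiff ℝ ∞ f),
    ContDiff ℝ n (fun β : C(K, E) => (ContinuousMap.mk f hf.continuous).comp β) := by
  induction n with
  | zero =>
    intro E F _ _ _ _ f hf
    exact contDiff_zero.2 (ContinuousMap.continuous_postcomp _)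
  | succ n ih =>
    intro E F _ _ _ _ f hf
    have hf' : ContDiff ℝ ∞ (fderiv ℝ f) := hf.fderiv_right (by simp)
    refine contDiff_succ_iff_hasFDerivAt.2 ⟨_, ?_, fun α => hasFDerivAt_postcomp hf.continuous
      hf'.continuous (fun x => (hf.differentiable (by simp) x).hasFDerivAt) α⟩
    exact (pointwiseCLM K E F).contDiff.comp (ih hf')

theorem contDiff_infty_postcomp {E F : Type} [NormedAddCommGroup E] [NormedSpace ℝ E]
    [NormedAddCommGroup F] [NormedSpace ℝ F] {f : E → F} (hf : ContDiff ℝ ∞ f) :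
    ContDiff ℝ ∞ (fun β : C(K, E) => (ContinuousMap.mk f hf.continuous).comp β) :=
  contDiff_infty.2 fun n => contDiff_postcomp n hf

/-- Integration from `0` as an operator on continuous functions on `[-1,1]`. -/
noncomputable def primitiveCLM (E : Type*) [NormedAddCommGroup E] [NormedSpace ℝ E] :
    C(Icc (-1 : ℝ) 1, E) →L[ℝ] C(Icc (-1 : ℝ) 1, E) :=
  LinearMap.mkContinuous
    -- `projIcc` extends `α` by constants to the whole line and changes nothing on `[-1,1]`. The
    -- operator norm is at most `1` because `|t| ≤ 1`.
    { toFun := fun α => ⟨fun t => ∫ τ in (0 : ℝ)..t, α (projIcc (-1) 1 (by norm_num) τ),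
        (intervalIntegral.continuous_primitive (fun _ _ =>
          (α.continuous.comp continuous_projIcc).intervalIntegrable _ _) 0).comp
            continuous_subtype_val⟩
      map_add' := fun α β => by
        ext t
        exact intervalIntegral.integral_add
          ((α.continuous.comp continuous_projIcc).intervalIntegrable _ _)
          ((β.continuous.comp continuous_projIcc).intervalIntegrable _ _)
      map_smul' := fun r α => by
        ext t
        exact intervalIntegral.integral_smul _ _ } 1 (by
    intro α
    rw [one_mul]
    refine (ContinuousMap.norm_le _ (by positivity)).2 fun t => ?_
    refine (intervalIntegral.norm_integral_le_of_norm_le_const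
      (fun x _ => α.norm_coe_le_norm _)).trans ?_
    rw [sub_zero]
    exact mul_le_of_le_one_right (norm_nonneg _) (abs_le.2 t.2))

theorem primitiveCLM_apply {E : Type*} [NormedAddCommGroup E] [NormedSpace ℝ E]
    (α : C(Icc (-1 : ℝ) 1, E)) (t : Icc (-1 : ℝ) 1) :
    primitiveCLM E α t = ∫ τ in (0 : ℝ)..t, α (projIcc (-1) 1 (by norm_num) τ) := rfl

/-- The extension by constants makes the derivative two-sided also at `±1`. -/
theorem hasDerivAt_primitive {E : Type*} [NormedAddCommGroup E] [NormedSpace ℝ E]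
    [CompleteSpace E] (α : C(Icc (-1 : ℝ) 1, E)) (t : ℝ) :
    HasDerivAt (fun t => ∫ τ in (0 : ℝ)..t, α (projIcc (-1) 1 (by norm_num) τ))
      (α (projIcc (-1) 1 (by norm_num) t)) t := by
  have hc : Continuous fun τ : ℝ => α (projIcc (-1) 1 (by norm_num) τ) :=
    α.continuous.comp continuous_projIcc
  exact intervalIntegral.integral_hasDerivAt_right (hc.intervalIntegrable _ _)
    (hc.stronglyMeasurableAtFilter _ _) hc.continuousAt

/-- Solutions of `u' = r f(u)`, `u(0) = x` on `[-1,1]`, as a zero of the integral equation, are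
unique up to rescaling of time. -/
theorem integral_solution_rescale {E : Type} [NormedAddCommGroup E] [NormedSpace ℝ E]
    [CompleteSpace E] {f : E → E} (hf : ContDiff ℝ ∞ f) {K : NNReal} (hK : LipschitzWith K f)
    {x : E} {r r₁ : ℝ} {α β : C(Icc (-1 : ℝ) 1, E)} (hr : |r| < r₁)
    (hα : α - r • primitiveCLM E ((ContinuousMap.mk f hf.continuous).comp α)
      = ContinuousMap.const _ x)
    (hβ : β - r₁ • primitiveCLM E ((ContinuousMap.mk f hf.continuous).comp β)
      = ContinuousMap.const _ x) :
    α ⟨1, by norm_num⟩ = x + r₁ • ∫ τ in (0 : ℝ)..(r / r₁),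
      ((ContinuousMap.mk f hf.continuous).comp β) (projIcc (-1) 1 (by norm_num) τ) := by
  have hr₁ : 0 < r₁ := (abs_nonneg r).trans_lt hr
  set F : ℝ → C(Icc (-1 : ℝ) 1, E) → ℝ → E := fun ρ γ t => x + ρ • ∫ τ in (0 : ℝ)..t,
      ((ContinuousMap.mk f hf.continuous).comp γ) (projIcc (-1) 1 (by norm_num) τ) with hF
  have hFd : ∀ ρ γ t, HasDerivAt (F ρ γ) (ρ • f (γ (projIcc (-1) 1 (by norm_num) t))) t :=
    fun ρ γ t => ((hasDerivAt_primitive ((ContinuousMap.mk f hf.continuous).comp γ) t).const_smul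
      ρ).const_add x
  have hFe : ∀ ρ (γ : C(Icc (-1 : ℝ) 1, E)),
      γ - ρ • primitiveCLM E ((ContinuousMap.mk f hf.continuous).comp γ)
        = ContinuousMap.const _ x → ∀ t : Icc (-1 : ℝ) 1, γ t = F ρ γ t := by
    intro ρ γ h t
    have := DFunLike.congr_fun h t
    simp only [ContinuousMap.coe_sub, Pi.sub_apply, ContinuousMap.coe_smul, Pi.smul_apply,
      ContinuousMap.const_apply, primitiveCLM_apply] at this
    simp only [hF]
    rw [← this, sub_add_cancel]
  have hFd' : ∀ ρ (γ : C(Icc (-1 : ℝ) 1, E)),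
      γ - ρ • primitiveCLM E ((ContinuousMap.mk f hf.continuous).comp γ)
        = ContinuousMap.const _ x → ∀ t ∈ Icc (-1 : ℝ) 1,
          HasDerivAt (F ρ γ) (ρ • f (F ρ γ t)) t := by
    intro ρ γ h t ht
    have h1 := hFd ρ γ t
    rwa [projIcc_of_mem _ ht, hFe ρ γ h ⟨t, ht⟩] at h1
  have hdiv : ∀ t ∈ Icc (0 : ℝ) 1, r / r₁ * t ∈ Icc (-1 : ℝ) 1 := by
    intro t ht
    have h1 : |r / r₁| ≤ 1 := by
      rw [abs_div, abs_of_pos hr₁]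
      exact (div_le_one hr₁).2 hr.le
    rw [mem_Icc, ← abs_le, abs_mul, abs_of_nonneg ht.1]
    exact mul_le_one₀ h1 ht.1 ht.2
  have hsub : Icc (0 : ℝ) 1 ⊆ Icc (-1) 1 := Icc_subset_Icc (by norm_num) le_rfl
  -- The solution with factor `r₁`, followed up to time `(r / r₁) t`, solves the equation with
  -- factor `r`. Uniqueness for the Lipschitz field `r • f` then identifies it with `α` on `[0,1]`.
  have hG : ∀ t ∈ Icc (0 : ℝ) 1, HasDerivAt (fun t => F r₁ β (r / r₁ * t))
      (r • f (F r₁ β (r / r₁ * t))) t := by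
    intro t ht
    have h1 := (hFd' r₁ β hβ _ (hdiv t ht)).scomp t ((hasDerivAt_id t).const_mul (r / r₁))
    simp only [mul_one, smul_smul, div_mul_cancel₀ _ hr₁.ne'] at h1
    exact h1
  have key : EqOn (F r α) (fun t => F r₁ β (r / r₁ * t)) (Icc 0 1) := by
    refine ODE_solution_unique (v := fun _ u => r • f u) (K := ‖r‖₊ * K) ?_ ?_ ?_ ?_ ?_ ?_
    · intro _
      exact (lipschitzWith_smul r).comp hK
    · exact fun t _ => (hFd r α t).continuousAt.continuousWithinAt
    · exact fun t ht => (hFd' r α hα t (hsub (Ico_subset_Icc_self ht))).hasDerivWithinAt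
    · exact fun t ht => (hG t ht).continuousAt.continuousWithinAt
    · exact fun t ht => (hG t (Ico_subset_Icc_self ht)).hasDerivWithinAt
    · simp [hF]
  have h1 := key (right_mem_Icc.2 zero_le_one)
  simp only [mul_one] at h1
  rw [hFe r α hα ⟨1, by norm_num⟩, h1]

/-- The flow of a smooth complete vector field is smooth near a given point at small times. -/
theorem exists_flow_of_lipschitz {E : Type} [NormedAddCommGroup E] [NormedSpace ℝ E]
    [CompleteSpace E] {f : E → E} (hf : ContDiff ℝ ∞ f) {K : NNReal} (hK : LipschitzWith K f)
    (x₀ : E) : ∃ δ > 0, ∃ φ : E × ℝ → E, ContDiffOn ℝ ∞ φ (ball x₀ δ ×ˢ Ioo (-δ) δ) ∧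
      (∀ x ∈ ball x₀ δ, φ (x, 0) = x) ∧ ∀ x ∈ ball x₀ δ, ∀ r ∈ Ioo (-δ) δ,
        HasDerivAt (fun r => φ (x, r)) (f (φ (x, r))) r := by
  let C := C(Icc (-1 : ℝ) 1, E)
  let N : C → C := fun β => (ContinuousMap.mk f hf.continuous).comp β
  have hN : ContDiff ℝ ∞ N := contDiff_infty_postcomp hf
  -- Time is turned into a parameter: the curves on `[-1,1]` with `u' = r f(u)` and `u(0) = x` are
  -- those with `Φ (r, u) = (r, const x)`. Carrying `r` along lets the inverse function theorem act
  -- as an implicit function theorem.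
  let Φ : ℝ × C → ℝ × C := fun p => (p.1, p.2 - p.1 • primitiveCLM E (N p.2))
  have hΦ : ContDiff ℝ ∞ Φ := contDiff_fst.prodMk (contDiff_snd.sub
    (contDiff_fst.smul ((primitiveCLM E).contDiff.comp (hN.comp contDiff_snd))))
  let c : E →L[ℝ] C := LinearMap.mkContinuous
    { toFun := fun x => ContinuousMap.const _ x
      map_add' := fun _ _ => rfl
      map_smul' := fun _ _ => rfl } 1 (fun x => by
        rw [one_mul]
        exact (ContinuousMap.norm_le _ (norm_nonneg x)).2 fun _ => le_rfl)
  have hc : ∀ x, c x = ContinuousMap.const _ x := fun x => rfl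
  let w : C := primitiveCLM E (N (c x₀))
  -- At `r = 0` the nonlinear term contributes only `ρ • w`, so the derivative is the shear `(ρ, k)
  -- ↦ (ρ, k - ρ • w)`, inverted by changing the sign.
  let L : (ℝ × C) ≃L[ℝ] (ℝ × C) := ContinuousLinearEquiv.equivOfInverse
    ((ContinuousLinearMap.fst ℝ ℝ C).prod (ContinuousLinearMap.snd ℝ ℝ C
      - (ContinuousLinearMap.fst ℝ ℝ C).smulRight w))
    ((ContinuousLinearMap.fst ℝ ℝ C).prod (ContinuousLinearMap.snd ℝ ℝ C
      + (ContinuousLinearMap.fst ℝ ℝ C).smulRight w))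
    (fun p => by simp) (fun p => by simp)
  have hL : HasFDerivAt Φ (L : (ℝ × C) →L[ℝ] (ℝ × C)) (0, c x₀) := by
    have hNd : DifferentiableAt ℝ (fun p : ℝ × C => primitiveCLM E (N p.2)) (0, c x₀) :=
      (((primitiveCLM E).contDiff.comp (hN.comp contDiff_snd)).differentiable (by simp)) _
    have h1 := (hasFDerivAt_fst (𝕜 := ℝ) (E := ℝ) (F := C) (p := (0, c x₀))).smul
      hNd.hasFDerivAt
    have h2 := (hasFDerivAt_fst (𝕜 := ℝ) (E := ℝ) (F := C) (p := (0, c x₀))).prodMk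
      ((hasFDerivAt_snd (𝕜 := ℝ) (E := ℝ) (F := C) (p := (0, c x₀))).sub h1)
    refine h2.congr_fderiv ?_
    ext p <;> simp [L, w]
  obtain ⟨e, hesrc, -, he, hesymm⟩ :=
    exists_openPartialHomeomorph_of_contDiffOn isOpen_univ hΦ.contDiffOn (mem_univ (0, c x₀)) hL
  let j : E × ℝ → ℝ × C := fun p => (p.2, c p.1)
  have hj : ContDiff ℝ ∞ j := contDiff_snd.prodMk (c.contDiff.comp contDiff_fst)
  have hj0 : j (x₀, 0) = e (0, c x₀) := by
    rw [he]
    simp [j, Φ]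
  have hopen : j ⁻¹' e.target ∈ 𝓝 (x₀, (0 : ℝ)) := by
    refine (e.open_target.preimage hj.continuous).mem_nhds ?_
    rw [mem_preimage, hj0]
    exact e.map_source hesrc
  obtain ⟨δ, hδ, hball⟩ := Metric.mem_nhds_iff.1 hopen
  have hball' : ∀ x ∈ ball x₀ δ, ∀ r ∈ Ioo (-δ) δ, j (x, r) ∈ e.target := by
    intro x hx r hr
    refine hball ?_
    rw [← ball_prod_same, Real.ball_eq_Ioo]
    exact ⟨hx, by simpa using hr⟩
  let α : E × ℝ → C := fun p => (e.symm (j p)).2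
  have hα : ∀ x ∈ ball x₀ δ, ∀ r ∈ Ioo (-δ) δ,
      α (x, r) - r • primitiveCLM E (N (α (x, r))) = ContinuousMap.const _ x := by
    intro x hx r hr
    have h1 := e.right_inv (hball' x hx r hr)
    rw [he] at h1
    have h2 : (e.symm (j (x, r))).1 = r := congrArg Prod.fst h1
    have h3 := congrArg Prod.snd h1
    simp only [Φ, h2] at h3
    exact h3
  let ev : C →L[ℝ] E := ContinuousMap.evalCLM ℝ ⟨1, by norm_num⟩
  refine ⟨δ, hδ, fun p => ev (α p), ?_, ?_, ?_⟩
  · refine ev.contDiff.comp_contDiffOn (contDiff_snd.comp_contDiffOn (hesymm.comp hj.contDiffOn ?_))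
    rintro ⟨x, r⟩ ⟨hx, hr⟩
    exact hball' x hx r hr
  · intro x hx
    have h1 := hα x hx 0 ⟨by linarith, hδ⟩
    rw [zero_smul, sub_zero] at h1
    change α (x, 0) ⟨1, _⟩ = x
    rw [h1]
    rfl
  · intro x hx r hr
    have hr' : |r| < δ := abs_lt.2 hr
    -- All values `α (x, ρ) 1` with `|ρ| < r₁` are read off the single curve `β = α (x, r₁)` by
    -- rescaling, so differentiation in `r` becomes the fundamental theorem of calculus.
    obtain ⟨r₁, h1, h2⟩ := exists_between hr'
    have h0 : 0 < r₁ := (abs_nonneg r).trans_lt h1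
    have hr₁ := hα x hx r₁ ⟨by linarith, h2⟩
    set β := α (x, r₁)
    have hval : ∀ ρ, |ρ| < r₁ → ev (α (x, ρ)) = x + r₁ • ∫ τ in (0 : ℝ)..(ρ / r₁),
        N β (projIcc (-1) 1 (by norm_num) τ) := fun ρ hρ =>
      integral_solution_rescale hf hK hρ (hα x hx ρ (abs_lt.1 (hρ.trans h2))) hr₁
    have hpt : ev (α (x, r)) = β (projIcc (-1) 1 (by norm_num) (r / r₁)) := by
      have hm : r / r₁ ∈ Icc (-1 : ℝ) 1 := by
        rw [mem_Icc, ← abs_le, abs_div, abs_of_pos h0]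
        exact (div_le_one h0).2 h1.le
      have h3 : β ⟨r / r₁, hm⟩ - r₁ • ∫ τ in (0 : ℝ)..(r / r₁),
          N β (projIcc (-1) 1 (by norm_num) τ) = x := DFunLike.congr_fun hr₁ ⟨r / r₁, hm⟩
      rw [hval r h1, projIcc_of_mem _ hm, ← h3, sub_add_cancel]
    have hd := (((hasDerivAt_primitive (N β) (r / r₁)).scomp r
      ((hasDerivAt_id r).div_const r₁)).const_smul r₁).const_add x
    rw [smul_smul, mul_one_div_cancel h0.ne', one_smul] at hd
    change HasDerivAt (fun r => ev (α (x, r))) (f (ev (α (x, r)))) r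
    rw [hpt]
    refine hd.congr_of_eventuallyEq ?_
    filter_upwards [(continuous_abs.continuousAt (x := r)).eventually (gt_mem_nhds h1)] with ρ hρ
    exact hval ρ hρ

end Flow

/-! ### Local flows on open sets and the straightening of a vector field. -/

section FlowBox

open Filter Topology Metric

/-- A smooth vector field has a smooth local flow. -/
theorem exists_local_flow {E : Type} [NormedAddCommGroup E] [NormedSpace ℝ E]
    [FiniteDimensional ℝ E] {v : E → E} {U : Set E} (hU : IsOpen U) (hv : ContDiffOn ℝ ∞ v U)
    {x₀ : E} (hx₀ : x₀ ∈ U) :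
    ∃ δ > 0, ∃ φ : E × ℝ → E, ContDiffOn ℝ ∞ φ (ball x₀ δ ×ˢ Ioo (-δ) δ) ∧
      (∀ x ∈ ball x₀ δ, φ (x, 0) = x) ∧ ∀ x ∈ ball x₀ δ, ∀ r ∈ Ioo (-δ) δ,
        φ (x, r) ∈ U ∧ HasDerivAt (fun r => φ (x, r)) (v (φ (x, r))) r := by
  have : CompleteSpace E := FiniteDimensional.complete ℝ E
  obtain ⟨ρ, hρ, hρU⟩ := Metric.isOpen_iff.1 hU x₀ hx₀
  -- Cutting off makes the field globally smooth with compact support, hence Lipschitz. Points and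
  -- times are later restricted so that the flow stays in the ball of radius `ρ / 3`, where the bump
  -- equals `1`.
  let b : ContDiffBump x₀ := ⟨ρ / 3, ρ / 2, by positivity, by linarith⟩
  have hbt : tsupport b ⊆ U := by
    rw [b.tsupport_eq]
    exact (closedBall_subset_ball (by change ρ / 2 < ρ; linarith)).trans hρU
  let f : E → E := fun x => b x • v x
  have hf : ContDiff ℝ ∞ f := by
    rw [contDiff_iff_contDiffAt]
    intro x
    by_cases hx : x ∈ tsupport b
    · exact b.contDiffAt.smul (hv.contDiffAt (hU.mem_nhds (hbt hx)))
    · refine (contDiffAt_const (c := (0 : E))).congr_of_eventuallyEq ?_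
      filter_upwards [notMem_tsupport_iff_eventuallyEq.1 hx] with y hy
      simp [f, hy]
  have hfc : HasCompactSupport f := b.hasCompactSupport.smul_right
  obtain ⟨K, hK⟩ := hf.lipschitzWith_of_hasCompactSupport hfc (by simp)
  obtain ⟨δ, hδ, φ, hφ, hφ0, hφd⟩ := exists_flow_of_lipschitz hf hK x₀
  have hmem : φ ⁻¹' ball x₀ (ρ / 3) ∈ 𝓝 (x₀, (0 : ℝ)) := by
    have hc : ContinuousAt φ (x₀, 0) := by
      refine hφ.continuousOn.continuousAt ((isOpen_ball.prod isOpen_Ioo).mem_nhds ⟨?_, ?_⟩)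
      · exact mem_ball_self hδ
      · exact ⟨by linarith, hδ⟩
    refine hc.preimage_mem_nhds ?_
    rw [hφ0 x₀ (mem_ball_self hδ)]
    exact ball_mem_nhds _ (by positivity)
  obtain ⟨δ', hδ', hsub⟩ := Metric.mem_nhds_iff.1 hmem
  rw [← ball_prod_same, Real.ball_eq_Ioo, zero_sub, zero_add] at hsub
  have h1 : ball x₀ (min δ δ') ⊆ ball x₀ δ := ball_subset_ball (min_le_left _ _)
  have h2 : Ioo (-min δ δ') (min δ δ') ⊆ Ioo (-δ) δ :=
    Ioo_subset_Ioo (neg_le_neg (min_le_left _ _)) (min_le_left _ _)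
  refine ⟨min δ δ', lt_min hδ hδ', φ, hφ.mono (prod_mono h1 h2), fun x hx => hφ0 x (h1 hx),
    fun x hx r hr => ?_⟩
  have h3 : φ (x, r) ∈ ball x₀ (ρ / 3) := @hsub (x, r)
    ⟨ball_subset_ball (min_le_right _ _) hx,
      Ioo_subset_Ioo (neg_le_neg (min_le_right _ _)) (min_le_right _ _) hr⟩
  have h4 := hφd x (h1 hx) r (h2 hr)
  have h5 : f (φ (x, r)) = v (φ (x, r)) := by
    simp only [f]
    rw [b.one_of_mem_closedBall (ball_subset_closedBall h3), one_smul]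
  rw [h5] at h4
  exact ⟨hρU (ball_subset_ball (by linarith) h3), h4⟩

/-- The flow box theorem: a smooth vector field is constant in suitable coordinates near a point
where it does not vanish. -/
theorem exists_flowBox {E : Type} [NormedAddCommGroup E] [NormedSpace ℝ E]
    [FiniteDimensional ℝ E] {v : E → E} {U : Set E} (hU : IsOpen U) (hv : ContDiffOn ℝ ∞ v U)
    {p : E} (hp : p ∈ U) (hne : v p ≠ 0) {e : E} {ℓ : E →L[ℝ] ℝ} (he : ℓ e = 1) :
    ∃ Ψ : OpenPartialHomeomorph E E, 0 ∈ Ψ.source ∧ Ψ 0 = p ∧ ContDiffOn ℝ ∞ Ψ Ψ.source ∧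
      ContDiffOn ℝ ∞ Ψ.symm Ψ.target ∧
        ∀ y ∈ Ψ.source, Ψ y ∈ U ∧ fderiv ℝ Ψ y e = v (Ψ y) := by
  have : CompleteSpace E := FiniteDimensional.complete ℝ E
  have he0 : e ≠ 0 := by
    rintro rfl
    simp at he
  -- `L e = v p`. The flow box starts at the point `p + L (y - ℓ y • e)` of the transversal `p + L
  -- (ker ℓ)` and flows for the time `ℓ y`; this choice makes its derivative at `0` equal to `L`.
  obtain ⟨L, hL⟩ := SeparatingDual.exists_continuousLinearEquiv_apply_eq (R := ℝ) he0 hne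
  obtain ⟨δ, hδ, φ, hφ, hφ0, hφd⟩ := exists_local_flow hU hv hp
  let h : E → E × ℝ := fun y => (p + L (y - ℓ y • e), ℓ y)
  have hh : ContDiff ℝ ∞ h := (contDiff_const.add (L.contDiff.comp
    (contDiff_id.sub (ℓ.contDiff.smul contDiff_const)))).prodMk ℓ.contDiff
  have hh0 : h 0 = (p, 0) := by simp [h]
  set B := ball p δ ×ˢ Ioo (-δ) δ with hB
  have hBo : IsOpen B := isOpen_ball.prod isOpen_Ioo
  have hB0 : (p, (0 : ℝ)) ∈ B := ⟨mem_ball_self hδ, by linarith, hδ⟩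
  have hφat : DifferentiableAt ℝ φ (p, 0) :=
    (hφ.contDiffAt (hBo.mem_nhds hB0)).differentiableAt (by simp)
  have hφ1 : ∀ w : E, fderiv ℝ φ (p, 0) (w, 0) = w := by
    intro w
    have hl : HasFDerivAt (fun x : E => (x, (0 : ℝ))) (ContinuousLinearMap.inl ℝ E ℝ) p :=
      hasFDerivAt_prodMk_left p 0
    have h1 := HasFDerivAt.comp p (f := fun x : E => (x, (0 : ℝ))) (g := φ) hφat.hasFDerivAt hl
    have h2 : HasFDerivAt (φ ∘ fun x : E => (x, (0 : ℝ))) (ContinuousLinearMap.id ℝ E) p := by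
      refine (hasFDerivAt_id p).congr_of_eventuallyEq ?_
      filter_upwards [ball_mem_nhds p hδ] with x hx
      exact hφ0 x hx
    exact DFunLike.congr_fun (h1.unique h2) w
  have hφ2 : fderiv ℝ φ (p, 0) (0, 1) = v p := by
    have hl : HasFDerivAt (fun r : ℝ => (p, r)) (ContinuousLinearMap.inr ℝ E ℝ) 0 :=
      hasFDerivAt_prodMk_right p 0
    have h1 := (HasFDerivAt.comp (0 : ℝ) (f := fun r : ℝ => (p, r)) (g := φ)
      hφat.hasFDerivAt hl).hasDerivAt
    have h2 := (hφd p (mem_ball_self hδ) 0 ⟨by linarith, hδ⟩).2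
    rw [hφ0 p (mem_ball_self hδ)] at h2
    simpa using h1.unique h2
  have hhd : ∀ y, HasFDerivAt h (((L : E →L[ℝ] E).comp
      (ContinuousLinearMap.id ℝ E - ℓ.smulRight e)).prod ℓ) y := fun y =>
    ((((L : E →L[ℝ] E).hasFDerivAt.comp y ((hasFDerivAt_id y).sub
      (ℓ.smulRight e).hasFDerivAt)).const_add p).prodMk ℓ.hasFDerivAt)
  have hΨL : HasFDerivAt (φ ∘ h) (L : E →L[ℝ] E) 0 := by
    have h1 : HasFDerivAt φ (fderiv ℝ φ (p, 0)) (h 0) := by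
      rw [hh0]
      exact hφat.hasFDerivAt
    refine (h1.comp 0 (hhd 0)).congr_fderiv ?_
    ext u
    have h2 : ((L (u - ℓ u • e), ℓ u) : E × ℝ) = (L (u - ℓ u • e), 0) + ℓ u • ((0 : E), (1 : ℝ)) := by
      simp
    have h3 : fderiv ℝ φ (p, 0) (L (u - ℓ u • e), ℓ u) = L u := by
      rw [h2, map_add, map_smul, hφ1, hφ2, map_sub, map_smul, hL, sub_add_cancel]
    simpa using h3
  have hW : IsOpen (h ⁻¹' B) := hBo.preimage hh.continuous
  have hsm : ContDiffOn ℝ ∞ (φ ∘ h) (h ⁻¹' B) := hφ.comp hh.contDiffOn fun _ hy => hy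
  have h0W : (0 : E) ∈ h ⁻¹' B := by
    rw [mem_preimage, hh0]
    exact hB0
  obtain ⟨Ψ, hsrc, hsub, hΨ, hsymm⟩ :=
    exists_openPartialHomeomorph_of_contDiffOn hW hsm h0W hΨL
  have hfun : (Ψ : E → E) = φ ∘ h := funext hΨ
  refine ⟨Ψ, hsrc, ?_, ?_, hsymm, ?_⟩
  · rw [hΨ, Function.comp_apply, hh0, hφ0 p (mem_ball_self hδ)]
  · rw [hfun]
    exact hsm.mono hsub
  · intro y hy
    have hyB := hsub hy
    have h1 := hφd (h y).1 hyB.1 (h y).2 hyB.2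
    rw [hfun]
    refine ⟨h1.1, ?_⟩
    have hd : HasFDerivAt (φ ∘ h) (fderiv ℝ (φ ∘ h) y) (y + (0 : ℝ) • e) := by
      rw [zero_smul, add_zero]
      exact ((hsm.contDiffAt (hW.mem_nhds hyB)).differentiableAt (by simp)).hasFDerivAt
    have h2 := hd.comp_hasDerivAt (0 : ℝ) (((hasDerivAt_id (0 : ℝ)).smul_const e).const_add y)
    have h3 : HasDerivAt (fun r : ℝ => φ ((h y).1, ℓ y + r)) (v (φ (h y))) 0 := by
      refine HasDerivAt.comp_const_add (f := fun r => φ ((h y).1, r)) (ℓ y) 0 ?_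
      rw [add_zero]
      exact h1.2
    -- Since `ℓ e = 1`, moving `y` by `r • e` keeps the point of the transversal and adds `r` to the
    -- time.
    have h4 : ((φ ∘ h) ∘ fun r : ℝ => y + id r • e) = fun r : ℝ => φ ((h y).1, ℓ y + r) := by
      funext r
      simp [h, he, add_smul, add_sub_add_right_eq_sub]
    rw [h4] at h2
    simpa using h2.unique h3

end FlowBox

/-! ### Coordinate fields of an adapted chart and the Killing equation. -/

section ChartBasics

variable {N : Type*} [TopologicalSpace N] [ChartedSpace E3 N] [IsManifold (𝓡 3) ∞ N]

namespace AdaptedChart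

open Filter Topology

variable {X : (x : N) → TangentSpace (𝓡 3) x} (A : AdaptedChart X)

theorem contMDiffAt_chart {q : N} (hq : q ∈ A.chart.source) :
    ContMDiffAt (𝓡 3) 𝓘(ℝ, E3) ∞ A.chart q :=
  contMDiffAt_of_mem_maximalAtlas A.mem_atlas hq

theorem contMDiffAt_chart_symm {y : E3} (hy : y ∈ A.chart.target) :
    ContMDiffAt 𝓘(ℝ, E3) (𝓡 3) ∞ A.chart.symm y :=
  contMDiffAt_symm_of_mem_maximalAtlas A.mem_atlas hy

theorem mdifferentiable_chart : A.chart.MDifferentiable (𝓡 3) 𝓘(ℝ, E3) :=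
  ⟨fun _ hq => ((A.contMDiffAt_chart hq).mdifferentiableAt (by simp)).mdifferentiableWithinAt,
    fun _ hy => ((A.contMDiffAt_chart_symm hy).mdifferentiableAt
      (by simp)).mdifferentiableWithinAt⟩

/-- The components of a tangent vector in the coordinates. -/
noncomputable def comps (q : N) : TangentSpace (𝓡 3) q →L[ℝ] E3 :=
  mfderiv (𝓡 3) 𝓘(ℝ, E3) A.chart q

variable {A} {q : N}

theorem symm_comps (hq : q ∈ A.chart.source) (w : TangentSpace (𝓡 3) q) :
    mfderiv 𝓘(ℝ, E3) (𝓡 3) A.chart.symm (A.chart q) (A.comps q w) = w :=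
  DFunLike.congr_fun (A.mdifferentiable_chart.symm_comp_deriv hq) w

theorem comps_symm (hq : q ∈ A.chart.source) (u : E3) :
    A.comps q (mfderiv 𝓘(ℝ, E3) (𝓡 3) A.chart.symm (A.chart q) u) = u := by
  obtain ⟨w, rfl⟩ := A.mdifferentiable_chart.mfderiv_surjective hq u
  exact congrArg _ (symm_comps hq w)

theorem comps_coordField (hq : q ∈ A.chart.source) (i : Fin 3) :
    A.comps q (A.coordField i q) = EuclideanSpace.single i 1 :=
  comps_symm hq _

theorem comps_field (hq : q ∈ A.chart.source) : A.comps q (X q) = EuclideanSpace.single 2 1 :=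
  A.field_eq q hq

theorem comps_injective (hq : q ∈ A.chart.source) : Function.Injective (A.comps q) :=
  Function.LeftInverse.injective (symm_comps hq)

theorem coordField_two (hq : q ∈ A.chart.source) : A.coordField 2 q = X q :=
  comps_injective hq (by rw [comps_coordField hq, comps_field hq])

theorem field_ne_zero (hq : q ∈ A.chart.source) : X q ≠ 0 := by
  intro h
  have h1 := comps_field hq
  rw [h, map_zero] at h1
  simpa using congrArg (fun v : E3 => v 2) h1

theorem eq_sum_coordField (hq : q ∈ A.chart.source) (w : TangentSpace (𝓡 3) q) :
    w = ∑ i, A.comps q w i • A.coordField i q := by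
  refine comps_injective hq ?_
  rw [map_sum]
  simp only [map_smul, comps_coordField hq]
  ext j
  fin_cases j <;> simp [Fin.sum_univ_three]

theorem inner_eq_sum (g : Metric3 N) (hq : q ∈ A.chart.source) (w w' : TangentSpace (𝓡 3) q) :
    g.inner q w w' = ∑ i, ∑ j, A.comps q w i * A.comps q w' j * A.coeff g i j q := by
  conv_lhs => rw [eq_sum_coordField hq w, eq_sum_coordField hq w']
  simp only [map_sum, map_smul, sum_apply, smul_apply,
    smul_eq_mul, coeff, Finset.mul_sum]
  rw [Finset.sum_comm]
  refine Finset.sum_congr rfl fun i _ => Finset.sum_congr rfl fun j _ => ?_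
  ring

theorem coeff_symm (g : Metric3 N) (i j : Fin 3) (q : N) : A.coeff g i j q = A.coeff g j i q :=
  g.symm q _ _

/-- The constant coordinate field of the model space. -/
noncomputable def modelField (i : Fin 3) (y : E3) : TangentSpace 𝓘(ℝ, E3) y :=
  (EuclideanSpace.single i 1 : E3)

/-- As pullbacks of constant fields, the coordinate fields inherit smoothness and vanishing brackets
from the model space. -/
theorem coordField_eq_mpullback (hq : q ∈ A.chart.source) (i : Fin 3) :
    A.coordField i q = VectorField.mpullback (𝓡 3) 𝓘(ℝ, E3) A.chart (modelField i) q := by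
  rw [VectorField.mpullback_apply]
  let L : TangentSpace (𝓡 3) q ≃L[ℝ] E3 := ContinuousLinearEquiv.equivOfInverse (A.comps q)
    (mfderiv 𝓘(ℝ, E3) (𝓡 3) A.chart.symm (A.chart q)) (symm_comps hq) (comps_symm hq)
  exact (DFunLike.congr_fun (ContinuousLinearMap.inverse_equiv L) _).symm

theorem isInvertible_mfderiv_chart (hq : q ∈ A.chart.source) :
    (mfderiv (𝓡 3) 𝓘(ℝ, E3) A.chart q).IsInvertible :=
  ⟨ContinuousLinearEquiv.equivOfInverse (A.comps q)
    (mfderiv 𝓘(ℝ, E3) (𝓡 3) A.chart.symm (A.chart q)) (symm_comps hq) (comps_symm hq), rfl⟩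

theorem contMDiffAt_modelField (i : Fin 3) (y : E3) :
    ContMDiffAt 𝓘(ℝ, E3) 𝓘(ℝ, E3).tangent ∞
      (fun z => (⟨z, modelField i z⟩ : TangentBundle 𝓘(ℝ, E3) E3)) y := by
  have h : ContDiffAt ℝ ∞ (fun _ : E3 => (EuclideanSpace.single i 1 : E3)) y := contDiffAt_const
  exact (contMDiffAt_vectorSpace_iff_contDiffAt (V := modelField i)).2 h

theorem coordField_eventuallyEq (hq : q ∈ A.chart.source) (i : Fin 3) :
    ∀ᶠ y in 𝓝 q, A.coordField i y = VectorField.mpullback (𝓡 3) 𝓘(ℝ, E3) A.chart (modelField i) y :=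
  (A.chart.open_source.eventually_mem hq).mono fun _ hy => coordField_eq_mpullback hy i

theorem smoothFieldAt_coordField (hq : q ∈ A.chart.source) (i : Fin 3) :
    SmoothFieldAt (A.coordField i) q := by
  have h := ContMDiffAt.mpullback_vectorField_preimage (contMDiffAt_modelField _ _)
    (A.contMDiffAt_chart hq) (isInvertible_mfderiv_chart hq) (m := ∞) (n := ∞)
    (V := modelField i) (by simp)
  refine h.congr_of_eventuallyEq ?_
  filter_upwards [coordField_eventuallyEq hq i] with y hy
  rw [hy]

theorem lieBracketWithin_univ_const (u w y : E3) :
    VectorField.lieBracketWithin ℝ (fun _ : E3 => u) (fun _ : E3 => w) univ y = 0 := by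
  simp [VectorField.lieBracketWithin]

/-- Near `q` both fields are pullbacks of constant fields, `X` being the third one; the bracket
commutes with pullback, and constant fields commute. -/
theorem mlieBracket_coordField (hq : q ∈ A.chart.source) (i : Fin 3) :
    VectorField.mlieBracket (𝓡 3) X (A.coordField i) q = 0 := by
  have infty_two : (2 : WithTop ℕ∞) ≤ ∞ := WithTop.coe_le_coe.2 (le_top : (2 : ℕ∞) ≤ ⊤)
  have : IsManifold (𝓡 3) (minSmoothness ℝ 2) N := by
    rw [minSmoothness_of_isRCLikeNormedField]
    exact IsManifold.of_le infty_two
  have hXe : X =ᶠ[𝓝 q] VectorField.mpullback (𝓡 3) 𝓘(ℝ, E3) A.chart (modelField 2) :=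
    (A.chart.open_source.eventually_mem hq).mono fun y hy => by
      rw [← coordField_two hy]
      exact coordField_eq_mpullback hy 2
  rw [Filter.EventuallyEq.mlieBracket_vectorField_eq hXe (coordField_eventuallyEq hq i),
    ← VectorField.mpullback_mlieBracket (n := ∞)]
  · rw [VectorField.mpullback_apply]
    have : VectorField.mlieBracket 𝓘(ℝ, E3) (modelField 2) (modelField i) (A.chart q) = 0 := by
      rw [← VectorField.mlieBracketWithin_univ, VectorField.mlieBracketWithin_eq_lieBracketWithin]
      exact lieBracketWithin_univ_const _ _ _
    rw [this, map_zero]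
  · exact (contMDiffAt_modelField _ _).mdifferentiableAt (by simp)
  · exact (contMDiffAt_modelField _ _).mdifferentiableAt (by simp)
  · exact A.contMDiffAt_chart hq
  · simpa using infty_two

theorem contMDiffAt_coeff (g : Metric3 N) (hq : q ∈ A.chart.source) (i j : Fin 3) :
    ContMDiffAt (𝓡 3) 𝓘(ℝ, ℝ) ∞ (A.coeff g i j) q := by
  have h := ContMDiffAt.clm_bundle_apply₂ (F₁ := E3) (F₂ := E3) (F₃ := ℝ)
    (E₃ := Bundle.Trivial N ℝ) (b := fun x : N => x)
    (g.contMDiff q) (smoothFieldAt_coordField hq i) (smoothFieldAt_coordField hq j)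
  rw [Bundle.contMDiffAt_totalSpace] at h
  exact h.2

/-- The Killing equation for two coordinate fields has no bracket terms left, since these fields
commute with `X`. -/
theorem mfderiv_coeff_field {g : Metric3 N} (hX : IsKilling g X) (hq : q ∈ A.chart.source)
    (i j : Fin 3) : mfderiv (𝓡 3) 𝓘(ℝ, ℝ) (A.coeff g i j) q (X q) = 0 := by
  have h := hX.lie_eq_zero q (A.coordField i) (A.coordField j) (smoothFieldAt_coordField hq i)
    (smoothFieldAt_coordField hq j)
  rw [mlieBracket_coordField hq, mlieBracket_coordField hq, map_zero, map_zero,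
    zero_apply, add_zero] at h
  exact h

end AdaptedChart

end ChartBasics

/-! ### Descent of the metric to the orbit space. -/

section ChartInvariance

variable {N : Type*} [TopologicalSpace N] [ChartedSpace E3 N] [IsManifold (𝓡 3) ∞ N]

namespace AdaptedChart

open Filter Topology

variable {X : (x : N) → TangentSpace (𝓡 3) x} {A : AdaptedChart X} {q : N} {y : ℝ × ℝ} {z : ℝ}

theorem vec_mem_target (hy : y ∈ A.base) (hz : z ∈ A.fib) : !₂[y.1, y.2, z] ∈ A.chart.target := by
  rw [A.target_eq]
  simpa using ⟨hy, hz⟩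

theorem pt_mem (hy : y ∈ A.base) (hz : z ∈ A.fib) : A.pt y z ∈ A.chart.source :=
  A.chart.map_target (vec_mem_target hy hz)

theorem chart_pt (hy : y ∈ A.base) (hz : z ∈ A.fib) : A.chart (A.pt y z) = !₂[y.1, y.2, z] :=
  A.chart.right_inv (vec_mem_target hy hz)

theorem proj_pt (hy : y ∈ A.base) (hz : z ∈ A.fib) : A.proj (A.pt y z) = y := by
  simp [proj, chart_pt hy hz]

theorem height_pt (hy : y ∈ A.base) (hz : z ∈ A.fib) : A.height (A.pt y z) = z := by
  simp [height, chart_pt hy hz]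

theorem chart_mem (hq : q ∈ A.chart.source) :
    A.proj q ∈ A.base ∧ A.height q ∈ A.fib := by
  have h := A.chart.map_source hq
  rw [A.target_eq] at h
  exact h

theorem proj_mem (hq : q ∈ A.chart.source) : A.proj q ∈ A.base := (chart_mem hq).1

theorem height_mem (hq : q ∈ A.chart.source) : A.height q ∈ A.fib := (chart_mem hq).2

theorem vec_proj_height (q : N) : !₂[(A.proj q).1, (A.proj q).2, A.height q] = A.chart q := by
  ext i
  fin_cases i <;> simp [proj, height]

theorem pt_proj_height (hq : q ∈ A.chart.source) : A.pt (A.proj q) (A.height q) = q := by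
  rw [pt, vec_proj_height, A.chart.left_inv hq]

section Maps

variable {F : Type*} [NormedAddCommGroup F] [NormedSpace ℝ F]

theorem hasFDerivAt_chart_comp {f : F → N} {x : F} {f' : F →L[ℝ] TangentSpace (𝓡 3) (f x)}
    (hf : HasMFDerivAt 𝓘(ℝ, F) (𝓡 3) f x f') (hx : f x ∈ A.chart.source) :
    HasFDerivAt (fun y => A.chart (f y)) ((A.comps (f x)).comp f') x := by
  have h1 := (A.mdifferentiable_chart.mdifferentiableAt hx).hasMFDerivAt
  exact (h1.comp x hf).hasFDerivAt

theorem comps_mfderiv {f : F → N} {x : F} (hf : MDifferentiableAt 𝓘(ℝ, F) (𝓡 3) f x)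
    (hx : f x ∈ A.chart.source) (u : F) :
    A.comps (f x) (mfderiv 𝓘(ℝ, F) (𝓡 3) f x u) = fderiv ℝ (fun y => A.chart (f y)) x u := by
  rw [(hasFDerivAt_chart_comp hf.hasMFDerivAt hx).fderiv]
  rfl

theorem contDiffAt_chart_comp {f : F → N} {x : F} (hf : ContMDiffAt 𝓘(ℝ, F) (𝓡 3) ∞ f x)
    (hx : f x ∈ A.chart.source) : ContDiffAt ℝ ∞ (fun y => A.chart (f y)) x :=
  ((A.contMDiffAt_chart hx).comp x hf).contDiffAt

theorem contMDiffAt_symm_comp {Y : F → E3} {x : F} (hY : ContDiffAt ℝ ∞ Y x)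
    (hx : Y x ∈ A.chart.target) : ContMDiffAt 𝓘(ℝ, F) (𝓡 3) ∞ (fun y => A.chart.symm (Y y)) x :=
  (A.contMDiffAt_chart_symm hx).comp x hY.contMDiffAt

theorem contDiffAt_vec {a : F → ℝ × ℝ} {b : F → ℝ} {x : F} (ha : ContDiffAt ℝ ∞ a x)
    (hb : ContDiffAt ℝ ∞ b x) : ContDiffAt ℝ ∞ (fun x => (!₂[(a x).1, (a x).2, b x] : E3)) x := by
  rw [contDiffAt_euclidean]
  intro i
  fin_cases i
  · exact contDiffAt_fst.comp x ha
  · exact contDiffAt_snd.comp x ha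
  · exact hb

theorem contMDiffAt_pt_comp {a : F → ℝ × ℝ} {b : F → ℝ} {x : F} (ha : ContDiffAt ℝ ∞ a x)
    (hb : ContDiffAt ℝ ∞ b x) (hax : a x ∈ A.base) (hbx : b x ∈ A.fib) :
    ContMDiffAt 𝓘(ℝ, F) (𝓡 3) ∞ (fun y => A.pt (a y) (b y)) x :=
  contMDiffAt_symm_comp (contDiffAt_vec ha hb) (vec_mem_target hax hbx)

theorem contDiffAt_proj_comp {f : F → N} {x : F} (hf : ContMDiffAt 𝓘(ℝ, F) (𝓡 3) ∞ f x)
    (hx : f x ∈ A.chart.source) : ContDiffAt ℝ ∞ (fun y => A.proj (f y)) x :=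
  have h := contDiffAt_euclidean.1 (contDiffAt_chart_comp hf hx)
  (h 0).prodMk (h 1)

theorem contDiffAt_height_comp {f : F → N} {x : F} (hf : ContMDiffAt 𝓘(ℝ, F) (𝓡 3) ∞ f x)
    (hx : f x ∈ A.chart.source) : ContDiffAt ℝ ∞ (fun y => A.height (f y)) x :=
  contDiffAt_euclidean.1 (contDiffAt_chart_comp hf hx) 2

/-- The first two components of a tangent vector. -/
noncomputable def planeCLM : E3 →L[ℝ] ℝ × ℝ :=
  (EuclideanSpace.proj 0 : E3 →L[ℝ] ℝ).prod (EuclideanSpace.proj 1)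

theorem planeCLM_apply (u : E3) : planeCLM u = (u 0, u 1) := rfl

theorem hasFDerivAt_proj_comp {f : F → N} {x : F} {f' : F →L[ℝ] TangentSpace (𝓡 3) (f x)}
    (hf : HasMFDerivAt 𝓘(ℝ, F) (𝓡 3) f x f') (hx : f x ∈ A.chart.source) :
    HasFDerivAt (fun y => A.proj (f y)) (planeCLM.comp ((A.comps (f x)).comp f')) x :=
  planeCLM.hasFDerivAt.comp x (hasFDerivAt_chart_comp hf hx)

theorem hasFDerivAt_height_comp {f : F → N} {x : F} {f' : F →L[ℝ] TangentSpace (𝓡 3) (f x)}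
    (hf : HasMFDerivAt 𝓘(ℝ, F) (𝓡 3) f x f') (hx : f x ∈ A.chart.source) :
    HasFDerivAt (fun y => A.height (f y))
      ((EuclideanSpace.proj 2 : E3 →L[ℝ] ℝ).comp ((A.comps (f x)).comp f')) x :=
  (EuclideanSpace.proj 2 : E3 →L[ℝ] ℝ).hasFDerivAt.comp x (hasFDerivAt_chart_comp hf hx)

end Maps

theorem mdifferentiableAt_pt (hy : y ∈ A.base) (hz : z ∈ A.fib) :
    MDifferentiableAt 𝓘(ℝ, ℝ) (𝓡 3) (A.pt y) z :=
  (contMDiffAt_pt_comp (a := fun _ => y) (b := fun z => z) contDiffAt_const contDiffAt_id hy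
    hz).mdifferentiableAt (by simp)

/-- This makes the coordinate lines integral curves of `X`. Tangent vectors are compared through
their components, where the line is `z ↦ (y₁, y₂, z)`. -/
theorem hasMFDerivAt_pt (hy : y ∈ A.base) (hz : z ∈ A.fib) :
    HasMFDerivAt 𝓘(ℝ, ℝ) (𝓡 3) (A.pt y) z ((1 : ℝ →L[ℝ] ℝ).smulRight (X (A.pt y z))) := by
  have hd := mdifferentiableAt_pt hy hz
  have h1 : mfderiv 𝓘(ℝ, ℝ) (𝓡 3) (A.pt y) z (1 : ℝ) = X (A.pt y z) := by
    refine comps_injective (pt_mem hy hz) ?_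
    rw [comps_mfderiv hd (pt_mem hy hz), comps_field (pt_mem hy hz)]
    have h2 : (fun z => A.chart (A.pt y z)) =ᶠ[𝓝 z] fun z => !₂[y.1, y.2, z] :=
      (A.isOpenInterval_fib.1.eventually_mem hz).mono fun z hz => chart_pt hy hz
    rw [h2.fderiv_eq]
    have h3 : HasDerivAt (fun z : ℝ => (!₂[y.1, y.2, z] : E3))
        (EuclideanSpace.single 2 1 : E3) z := by
      have h4 : (fun z : ℝ => (!₂[y.1, y.2, z] : E3))
          = fun z => !₂[y.1, y.2, 0] + z • (EuclideanSpace.single 2 1 : E3) := by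
        funext z
        ext i
        fin_cases i <;> simp
      rw [h4]
      simpa using ((hasDerivAt_id z).smul_const (EuclideanSpace.single 2 1 : E3)).const_add
        (!₂[y.1, y.2, 0] : E3)
    exact h3.deriv
  have h2 : mfderiv 𝓘(ℝ, ℝ) (𝓡 3) (A.pt y) z = (1 : ℝ →L[ℝ] ℝ).smulRight (X (A.pt y z)) :=
    ContinuousLinearMap.ext_ring (h1.trans (one_smul ℝ _).symm)
  rw [← h2]
  exact hd.hasMFDerivAt

/-- A function with vanishing derivative along the field is constant on the fibres. -/
theorem const_on_fib {f : N → ℝ}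
    (hf : ∀ q ∈ A.chart.source, MDifferentiableAt (𝓡 3) 𝓘(ℝ, ℝ) f q)
    (h0 : ∀ q ∈ A.chart.source, mfderiv (𝓡 3) 𝓘(ℝ, ℝ) f q (X q) = 0)
    (hy : y ∈ A.base) {z z' : ℝ} (hz : z ∈ A.fib) (hz' : z' ∈ A.fib) :
    f (A.pt y z) = f (A.pt y z') := by
  have hd : ∀ z ∈ A.fib, HasFDerivAt (fun z => f (A.pt y z)) (0 : ℝ →L[ℝ] ℝ) z := by
    intro z hz
    have h1 := ((hf _ (pt_mem hy hz)).hasMFDerivAt.comp z (hasMFDerivAt_pt hy hz)).hasFDerivAt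
    refine h1.congr_fderiv ?_
    refine ContinuousLinearMap.ext_ring ?_
    have h2 := h0 _ (pt_mem hy hz)
    change mfderiv (𝓡 3) 𝓘(ℝ, ℝ) f (A.pt y z) ((1 : ℝ) • X (A.pt y z)) = 0
    rw [one_smul, h2]
  exact A.isOpenInterval_fib.1.is_const_of_fderiv_eq_zero
    A.isOpenInterval_fib.2.1.isPreconnected
    (fun z hz => (hd z hz).differentiableAt.differentiableWithinAt)
    (fun z hz => (hd z hz).fderiv) hz hz'

variable {g : Metric3 N}

theorem coeff_eq_coeffB (hX : IsKilling g X) (hq : q ∈ A.chart.source) (i j : Fin 3) :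
    A.coeff g i j q = A.coeffB g i j (A.proj q) := by
  have h := const_on_fib (A := A) (f := A.coeff g i j)
    (fun q hq => (contMDiffAt_coeff g hq i j).mdifferentiableAt (by simp))
    (fun q hq => mfderiv_coeff_field hX hq i j) (proj_mem hq) (height_mem hq) A.level_mem
  rwa [pt_proj_height hq] at h

theorem contDiffOn_coeffB (g : Metric3 N) (i j : Fin 3) :
    ContDiffOn ℝ ∞ (A.coeffB g i j) A.base := by
  intro y hy
  have h1 := contMDiffAt_pt_comp (A := A) (a := fun y : ℝ × ℝ => y) (b := fun _ => A.level)
    contDiffAt_id contDiffAt_const hy A.level_mem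
  exact ((contMDiffAt_coeff g (pt_mem hy A.level_mem) i j).comp y h1).contDiffAt.contDiffWithinAt

theorem coeffB_symm (g : Metric3 N) (i j : Fin 3) (y : ℝ × ℝ) :
    A.coeffB g i j y = A.coeffB g j i y :=
  coeff_symm g i j _

theorem inner_eq_sum_coeffB (hX : IsKilling g X) (hq : q ∈ A.chart.source)
    (w w' : TangentSpace (𝓡 3) q) : g.inner q w w' =
      ∑ i, ∑ j, A.comps q w i * A.comps q w' j * A.coeffB g i j (A.proj q) := by
  rw [inner_eq_sum g hq]
  simp only [coeff_eq_coeffB hX hq]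

theorem volumeFn_eq (g : Metric3 N) (hq : q ∈ A.chart.source) :
    volumeFn g X q = Real.sqrt (A.coeff g 2 2 q) := by
  rw [volumeFn, coeff, coordField_two hq]

theorem volumeB_eq (g : Metric3 N) (hy : y ∈ A.base) :
    A.volumeB g y = Real.sqrt (A.coeffB g 2 2 y) :=
  volumeFn_eq g (pt_mem hy A.level_mem)

theorem volumeFn_eq_volumeB (hX : IsKilling g X) (hq : q ∈ A.chart.source) :
    volumeFn g X q = A.volumeB g (A.proj q) := by
  rw [volumeFn_eq g hq, volumeB_eq g (proj_mem hq), coeff_eq_coeffB hX hq]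

theorem coeffB_two_two_pos (g : Metric3 N) (hy : y ∈ A.base) : 0 < A.coeffB g 2 2 y := by
  have hq := pt_mem hy A.level_mem
  rw [coeffB, coeff, coordField_two hq]
  exact g.pos _ _ (field_ne_zero hq)

theorem volumeB_pos (g : Metric3 N) (hy : y ∈ A.base) : 0 < A.volumeB g y := by
  rw [volumeB_eq g hy]
  exact Real.sqrt_pos.2 (coeffB_two_two_pos g hy)

theorem volumeB_sq (g : Metric3 N) (hy : y ∈ A.base) :
    A.volumeB g y ^ 2 = A.coeffB g 2 2 y := by
  rw [volumeB_eq g hy, Real.sq_sqrt (coeffB_two_two_pos g hy).le]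

theorem contDiffOn_volumeB (g : Metric3 N) : ContDiffOn ℝ ∞ (A.volumeB g) A.base :=
  ((contDiffOn_coeffB g 2 2).sqrt fun _ hy => (coeffB_two_two_pos g hy).ne').congr
    fun _ hy => volumeB_eq g hy

/-- The quotient metric is the Schur complement of `g₃₃`: its coefficients are `g_{ij} - g_{i3}
g_{j3} / g₃₃`. -/
theorem quotSq_eq (g : Metric3 N) (hy : y ∈ A.base) (w : ℝ × ℝ) :
    A.quotSq g y w = w.1 ^ 2 * A.coeffB g 0 0 y + 2 * (w.1 * w.2 * A.coeffB g 0 1 y)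
      + w.2 ^ 2 * A.coeffB g 1 1 y
      - (w.1 * A.coeffB g 0 2 y + w.2 * A.coeffB g 1 2 y) ^ 2 / A.coeffB g 2 2 y := by
  have h0 := (coeffB_two_two_pos g hy).ne'
  have hs := fun i j => coeffB_symm (A := A) g i j y
  have hq := pt_mem hy A.level_mem
  have hc : ∀ i, A.comps _ (A.horLift g y w) i = ![w.1, w.2,
      -((w.1 * A.coeffB g 0 2 y + w.2 * A.coeffB g 1 2 y) / A.coeffB g 2 2 y)] i := by
    intro i
    rw [horLift, map_sub, map_add, map_smul, map_smul, map_smul, comps_coordField hq,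
      comps_coordField hq, comps_coordField hq]
    fin_cases i <;> simp
  rw [quotSq, inner_eq_sum g hq]
  simp only [hc]
  change ∑ i, ∑ j, _ * _ * A.coeffB g i j y = _
  simp only [Fin.sum_univ_three, Matrix.cons_val_zero, Matrix.cons_val_one, Matrix.cons_val]
  rw [hs 1 0, hs 2 0, hs 2 1]
  field_simp
  ring

theorem inner_field (hX : IsKilling g X) (hq : q ∈ A.chart.source) (w : TangentSpace (𝓡 3) q) :
    g.inner q w (X q) = ∑ i, A.comps q w i * A.coeffB g i 2 (A.proj q) := by
  rw [inner_eq_sum_coeffB hX hq, comps_field hq]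
  simp [Fin.sum_univ_three]

/-- The metric splits into the quotient metric and the part along the field. -/
theorem inner_self_eq (hX : IsKilling g X) (hq : q ∈ A.chart.source) (w : TangentSpace (𝓡 3) q) :
    g.inner q w w = A.quotSq g (A.proj q) (planeCLM (A.comps q w))
      + (g.inner q w (X q)) ^ 2 / A.coeffB g 2 2 (A.proj q) := by
  have h0 := (coeffB_two_two_pos g (proj_mem hq)).ne'
  have hs := fun i j => coeffB_symm (A := A) g i j (A.proj q)
  rw [inner_field hX hq, quotSq_eq g (proj_mem hq), inner_eq_sum_coeffB hX hq, planeCLM_apply]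
  simp only [Fin.sum_univ_three]
  rw [hs 1 0, hs 2 0, hs 2 1]
  field_simp
  ring

theorem hasMFDerivAt_proj (hq : q ∈ A.chart.source) :
    HasMFDerivAt (𝓡 3) 𝓘(ℝ, ℝ × ℝ) A.proj q (planeCLM.comp (A.comps q)) :=
  (planeCLM.hasFDerivAt.hasMFDerivAt (x := A.chart q)).comp q
    (A.mdifferentiable_chart.mdifferentiableAt hq).hasMFDerivAt

/-- The Riemannian submersion property: for horizontal `w` the part along the field in
`inner_self_eq` vanishes. -/
theorem quotSq_mfderiv_proj (hX : IsKilling g X) (hq : q ∈ A.chart.source)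
    (w : TangentSpace (𝓡 3) q) (hw : g.inner q w (X q) = 0) :
    A.quotSq g (A.proj q) (mfderiv (𝓡 3) 𝓘(ℝ, ℝ × ℝ) A.proj q w) = g.inner q w w := by
  rw [inner_self_eq hX hq, hw, (hasMFDerivAt_proj hq).mfderiv]
  simp
  rfl

end AdaptedChart

end ChartInvariance

/-- `FlowsTo` asks for a bounded interval of times, while `A.fib` may be unbounded. -/
theorem IsOpenInterval.exists_Ioo_subset {I : Set ℝ} (hI : IsOpenInterval I) {x z : ℝ}
    (hx : x ∈ I) (hz : z ∈ I) : ∃ a b, x ∈ Ioo a b ∧ z ∈ Ioo a b ∧ Ioo a b ⊆ I := by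
  wlog hxz : x ≤ z generalizing x z
  · obtain ⟨a, b, h1, h2, h3⟩ := this hz hx (le_of_not_ge hxz)
    exact ⟨a, b, h2, h1, h3⟩
  obtain ⟨ε, hε, h1⟩ := Metric.isOpen_iff.1 hI.1 x hx
  obtain ⟨δ, hδ, h2⟩ := Metric.isOpen_iff.1 hI.1 z hz
  rw [Real.ball_eq_Ioo] at h1 h2
  refine ⟨x - ε, z + δ, ⟨by linarith, by linarith⟩, ⟨by linarith, by linarith⟩, fun r hr => ?_⟩
  rcases lt_or_ge r x with h | h
  · exact h1 ⟨hr.1, by linarith⟩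
  rcases lt_or_ge z r with h' | h'
  · exact h2 ⟨by linarith, hr.2⟩
  exact hI.2.1.out hx hz ⟨h, h'⟩

/-! ### The flow in adapted coordinates, and existence of these coordinates. -/

section Flow

variable {N : Type*} [TopologicalSpace N] [ChartedSpace E3 N] [IsManifold (𝓡 3) ∞ N]

namespace AdaptedChart

open Filter Topology

variable {X : (x : N) → TangentSpace (𝓡 3) x} {A : AdaptedChart X} {q : N}

theorem hasMFDerivAt_of_isMIntegralCurveOn {c : ℝ → N} {s : Set ℝ} (hs : IsOpen s)
    (hc : IsMIntegralCurveOn c X s) {t : ℝ} (ht : t ∈ s) :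
    HasMFDerivAt 𝓘(ℝ, ℝ) (𝓡 3) c t ((1 : ℝ →L[ℝ] ℝ).smulRight (X (c t))) :=
  (hc t ht).hasMFDerivAt (hs.mem_nhds ht)

theorem hasDerivAt_chart_comp {c : ℝ → N} {t k : ℝ}
    (hc : HasMFDerivAt 𝓘(ℝ, ℝ) (𝓡 3) c t ((1 : ℝ →L[ℝ] ℝ).smulRight (k • X (c t))))
    (hq : c t ∈ A.chart.source) :
    HasDerivAt (fun t => A.chart (c t)) (EuclideanSpace.single 2 k : E3) t := by
  have h := (hasFDerivAt_chart_comp hc hq).hasDerivAt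
  have h2 : A.comps (c t) ((1 : ℝ) • k • X (c t)) = (EuclideanSpace.single 2 k : E3) := by
    rw [one_smul, map_smul, comps_field hq]
    ext i
    fin_cases i <;> simp
  exact h2 ▸ h

/-- In adapted coordinates the local flow of the field is the translation of `x₃`. -/
theorem flowsTo_iff (hq : q ∈ A.chart.source) (r : ℝ) (q' : N) :
    FlowsTo X A.chart.source q r q' ↔
      A.height q + r ∈ A.fib ∧ q' = A.pt (A.proj q) (A.height q + r) := by
  constructor
  · rintro ⟨c, a, b, h0, hr, hc, hmap, rfl, rfl⟩
    -- In coordinates an integral curve has velocity `∂/∂x₃`, so subtracting `t` from its third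
    -- coordinate leaves a constant.
    have hd : ∀ t ∈ Ioo a b, HasDerivAt (fun t => A.chart (c t) - t • (EuclideanSpace.single 2 1 : E3))
        0 t := by
      intro t ht
      have h1 := hasDerivAt_chart_comp (k := 1) (A := A) (by
        rw [one_smul]
        exact hasMFDerivAt_of_isMIntegralCurveOn isOpen_Ioo hc ht) (hmap ht)
      have h2 := h1.sub ((hasDerivAt_id t).smul_const (EuclideanSpace.single 2 1 : E3))
      rw [one_smul, sub_self] at h2
      exact h2
    have h2 := isOpen_Ioo.is_const_of_deriv_eq_zero isPreconnected_Ioo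
      (fun t ht => (hd t ht).differentiableAt.differentiableWithinAt)
      (fun t ht => (hd t ht).deriv) hr h0
    simp only [zero_smul, sub_zero] at h2
    have h3 : A.chart (c r) = !₂[(A.proj (c 0)).1, (A.proj (c 0)).2, A.height (c 0) + r] := by
      rw [sub_eq_iff_eq_add] at h2
      rw [h2]
      ext i
      fin_cases i <;> simp [proj, height]
    have h4 : A.height (c r) = A.height (c 0) + r := by simp [height, h3]
    have h5 := height_mem (hmap hr)
    rw [h4] at h5
    refine ⟨h5, ?_⟩
    rw [pt, ← h3, A.chart.left_inv (hmap hr)]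
  · rintro ⟨hr, rfl⟩
    obtain ⟨a, b, h1, h2, h3⟩ := A.isOpenInterval_fib.exists_Ioo_subset (height_mem hq) hr
    refine ⟨fun t => A.pt (A.proj q) (A.height q + t), a - A.height q, b - A.height q,
      ⟨by linarith [h1.1], by linarith [h1.2]⟩, ⟨by linarith [h2.1], by linarith [h2.2]⟩, ?_, ?_,
      ?_, rfl⟩
    · intro t ht
      have ht' : A.height q + t ∈ A.fib := h3 ⟨by linarith [ht.1], by linarith [ht.2]⟩
      have h4 := hasMFDerivAt_pt (proj_mem hq) ht'
      have h5 : HasMFDerivAt 𝓘(ℝ, ℝ) 𝓘(ℝ, ℝ) (fun t => A.height q + t) t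
          (ContinuousLinearMap.id ℝ ℝ) :=
        ((hasFDerivAt_id t).const_add (A.height q)).hasMFDerivAt
      exact (h4.comp t h5).hasMFDerivWithinAt
    · intro t ht
      exact pt_mem (proj_mem hq) (h3 ⟨by linarith [ht.1], by linarith [ht.2]⟩)
    · simp only [add_zero]
      exact pt_proj_height hq

end AdaptedChart

open Filter Topology

/-- Around a point where a smooth field does not vanish there are adapted coordinates. -/
theorem exists_adaptedChart {X : (x : N) → TangentSpace (𝓡 3) x} (hX : ∀ x, SmoothFieldAt X x)
    {p : N} (hp : X p ≠ 0) : ∃ A : AdaptedChart X, p ∈ A.chart.source := by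
  let e := chartAt E3 p
  have he : e ∈ IsManifold.maximalAtlas (𝓡 3) ∞ N := IsManifold.chart_mem_maximalAtlas p
  have hesm : ContMDiffOn (𝓡 3) 𝓘(ℝ, E3) ∞ e e.source := contMDiffOn_of_mem_maximalAtlas he
  have hesm' : ContMDiffOn 𝓘(ℝ, E3) (𝓡 3) ∞ e.symm e.target :=
    contMDiffOn_symm_of_mem_maximalAtlas he
  have hemd : e.MDifferentiable (𝓡 3) 𝓘(ℝ, E3) := mdifferentiable_chart p
  let v : E3 → E3 := VectorField.mpullback 𝓘(ℝ, E3) (𝓡 3) e.symm X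
  have hinv : ∀ y ∈ e.target, (mfderiv 𝓘(ℝ, E3) (𝓡 3) e.symm y).IsInvertible := by
    intro y hy
    refine ⟨ContinuousLinearEquiv.equivOfInverse _ (mfderiv (𝓡 3) 𝓘(ℝ, E3) e (e.symm y))
      (fun u => DFunLike.congr_fun (hemd.comp_symm_deriv hy) u) (fun w => ?_), rfl⟩
    obtain ⟨u, rfl⟩ := hemd.symm.mfderiv_surjective (x := y) hy w
    exact congrArg _ (DFunLike.congr_fun (hemd.comp_symm_deriv hy) u)
  have hvX : ∀ y ∈ e.target, mfderiv 𝓘(ℝ, E3) (𝓡 3) e.symm y (v y) = X (e.symm y) := by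
    intro y hy
    exact (hinv y hy).self_apply_inverse _
  have hv : ContDiffOn ℝ ∞ v e.target := by
    intro y hy
    have h1 := ContMDiffAt.mpullback_vectorField_preimage (hX (e.symm y))
      (hesm'.contMDiffAt (e.open_target.mem_nhds hy)) (hinv y hy) (m := ∞) (n := ∞) (by simp)
    exact (contMDiffAt_vectorSpace_iff_contDiffAt.1 h1).contDiffWithinAt
  have hpt : e p ∈ e.target := e.map_source (mem_chart_source E3 p)
  have hvp : v (e p) ≠ 0 := by
    intro h0
    have h1 : X (e.symm (e p)) = 0 :=
      (hvX (e p) hpt).symm.trans ((congrArg _ h0).trans (map_zero _))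
    rw [e.left_inv (mem_chart_source E3 p)] at h1
    exact hp h1
  obtain ⟨Ψ, h0, hΨ0, hΨ, hΨ', hfl⟩ := exists_flowBox e.open_target hv hpt hvp
    (e := (EuclideanSpace.single 2 1 : E3)) (ℓ := EuclideanSpace.proj 2) (by simp)
  -- The image of an adapted chart must be a product. Balls of the sup norm are cubes, so passing to
  -- `Fin 3 → ℝ` yields a cube inside the flow box.
  let K : E3 ≃L[ℝ] (Fin 3 → ℝ) := EuclideanSpace.equiv (Fin 3) ℝ
  obtain ⟨ε, hε, hball⟩ := Metric.mem_nhds_iff.1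
    ((Ψ.open_source.preimage K.symm.continuous).mem_nhds (x := 0) (by simpa using h0))
  let box : Set E3 := {y | (y 0, y 1) ∈ Ioo (-ε) ε ×ˢ Ioo (-ε) ε ∧ y 2 ∈ Ioo (-ε) ε}
  have hbox : IsOpen box := by
    have hc : ∀ i : Fin 3, Continuous fun y : E3 => y i := fun i =>
      (EuclideanSpace.proj i : E3 →L[ℝ] ℝ).continuous
    exact ((isOpen_Ioo.prod isOpen_Ioo).preimage ((hc 0).prodMk (hc 1))).inter
      (isOpen_Ioo.preimage (hc 2))
  have hboxs : box ⊆ Ψ.source := by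
    intro y hy
    have h1 : K y ∈ Metric.ball (0 : Fin 3 → ℝ) ε := by
      rw [mem_ball_zero_iff, pi_norm_lt_iff hε]
      intro i
      rw [Real.norm_eq_abs, abs_lt]
      fin_cases i
      · exact hy.1.1
      · exact hy.1.2
      · exact hy.2
    have h2 := hball h1
    rwa [mem_preimage, K.symm_apply_apply] at h2
  have h0box : (0 : E3) ∈ box := by simp [box, hε]
  let Φ := Ψ.restrOpen box hbox
  have hΦs : Φ.source = box := inter_eq_right.2 hboxs
  have hΦsm : ContDiffOn ℝ ∞ Φ Φ.source := hΨ.mono inter_subset_left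
  have hΦsm' : ContDiffOn ℝ ∞ Φ.symm Φ.target := hΨ'.mono (by
    intro y hy
    have h1 := Φ.map_target hy
    have h2 : Φ (Φ.symm y) = y := Φ.right_inv hy
    rw [← h2]
    exact Ψ.map_source h1.1)
  -- The adapted chart is the given chart followed by the inverse of the flow box restricted to the
  -- cube.
  let c := e.trans Φ.symm
  have hct : c.target = box := by
    change Φ.source ∩ Φ ⁻¹' e.target = box
    rw [hΦs]
    exact inter_eq_left.2 fun y hy => (hfl y (hboxs hy)).1
  have hcsm : ContMDiffOn (𝓡 3) 𝓘(ℝ, E3) ∞ c c.source :=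
    hΦsm'.contMDiffOn.comp (hesm.mono inter_subset_left) fun x hx => hx.2
  have hcsm' : ContMDiffOn 𝓘(ℝ, E3) (𝓡 3) ∞ c.symm c.target :=
    hesm'.comp (hΦsm.contMDiffOn.mono inter_subset_left) fun x hx => hx.2
  have hcmd : c.MDifferentiable (𝓡 3) 𝓘(ℝ, E3) :=
    ⟨hcsm.mdifferentiableOn (by simp), hcsm'.mdifferentiableOn (by simp)⟩
  refine ⟨⟨c, OpenPartialHomeomorph.mem_maximalAtlas_of_contMDiffOn c hcsm hcsm', _,
    isOpen_Ioo.prod isOpen_Ioo, _, ⟨isOpen_Ioo, ordConnected_Ioo, 0, by linarith, hε⟩, hct, ?_, 0,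
    ⟨by linarith, hε⟩⟩, mem_chart_source E3 p, ?_⟩
  · intro q hq
    have hy := c.map_source hq
    set y := c q with hyq
    have hyb : y ∈ box := hct ▸ hy
    have hΨd : HasFDerivAt Ψ (fderiv ℝ Ψ y) y :=
      ((hΨ.contDiffAt (Ψ.open_source.mem_nhds (hboxs hyb))).differentiableAt
        (by simp)).hasFDerivAt
    have h1 : HasMFDerivAt 𝓘(ℝ, E3) (𝓡 3) c.symm y
        ((mfderiv 𝓘(ℝ, E3) (𝓡 3) e.symm (Ψ y)).comp (fderiv ℝ Ψ y)) :=
      (hemd.mdifferentiableAt_symm (hfl y (hboxs hyb)).1).hasMFDerivAt.comp y hΨd.hasMFDerivAt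
    have h2 : mfderiv 𝓘(ℝ, E3) (𝓡 3) c.symm y (EuclideanSpace.single 2 1 : E3)
        = X (c.symm y) := by
      rw [h1.mfderiv]
      have h3 := hvX (Ψ y) (hfl y (hboxs hyb)).1
      rw [← (hfl y (hboxs hyb)).2] at h3
      exact h3
    have h3 := DFunLike.congr_fun (hcmd.comp_symm_deriv hy) (EuclideanSpace.single 2 1 : E3)
    have h4 : mfderiv (𝓡 3) 𝓘(ℝ, E3) c (c.symm y) (X (c.symm y))
        = (EuclideanSpace.single 2 1 : E3) := by
      rw [← h2]
      exact h3
    rwa [hyq, c.left_inv hq] at h4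
  · change e p ∈ Φ.target
    rw [← hΨ0]
    exact Φ.map_source (hΦs ▸ h0box)

end Flow

theorem ContDiffOn.matrix_det {F n : Type*} [NormedAddCommGroup F] [NormedSpace ℝ F] [Fintype n]
    [DecidableEq n] {M : F → Matrix n n ℝ} {s : Set F}
    (hM : ∀ i j, ContDiffOn ℝ ∞ (fun x => M x i j) s) : ContDiffOn ℝ ∞ (fun x => (M x).det) s := by
  simp only [Matrix.det_apply']
  exact ContDiffOn.sum fun σ _ => contDiffOn_const.mul (contDiffOn_prod fun i _ => hM _ _)

/-- Cramer's rule: the entries of the inverse are quotients of determinants. -/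
theorem ContDiffOn.matrix_inv {F n : Type*} [NormedAddCommGroup F] [NormedSpace ℝ F] [Fintype n]
    [DecidableEq n] {M : F → Matrix n n ℝ} {s : Set F}
    (hM : ∀ i j, ContDiffOn ℝ ∞ (fun x => M x i j) s) (hdet : ∀ x ∈ s, (M x).det ≠ 0) (i j : n) :
    ContDiffOn ℝ ∞ (fun x => (M x)⁻¹ i j) s := by
  simp only [Matrix.inv_def, Matrix.smul_apply, Ring.inverse_eq_inv', smul_eq_mul,
    Matrix.adjugate_apply]
  refine ((ContDiffOn.matrix_det hM).inv hdet).mul (ContDiffOn.matrix_det fun k l => ?_)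
  by_cases hk : k = j
  · simp only [hk, Matrix.updateRow_self]
    exact contDiffOn_const
  · simp only [Matrix.updateRow_ne hk]
    exact hM k l

/-! ### Gradients of invariant functions and the metric on covectors of the base. -/

section Gradient

variable {N : Type*} [TopologicalSpace N] [ChartedSpace E3 N] [IsManifold (𝓡 3) ∞ N]

namespace AdaptedChart

open Filter Topology

variable {X : (x : N) → TangentSpace (𝓡 3) x} {A : AdaptedChart X} {g : Metric3 N} {q : N}
  {y : ℝ × ℝ}

variable (A) in
/-- The Gram matrix of the metric in the coordinates. -/
noncomputable def gram (g : Metric3 N) (y : ℝ × ℝ) : Matrix (Fin 3) (Fin 3) ℝ :=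
  Matrix.of fun k l => A.coeffB g k l y

theorem gram_apply (i j : Fin 3) : A.gram g y i j = A.coeffB g i j y := rfl

theorem coeffInv_eq (i j : Fin 3) : A.coeffInv g i j y = (A.gram g y)⁻¹ i j := rfl

/-- The quadratic form of the Gram matrix at `u` is the squared length of `∑ uᵢ ∂/∂xᵢ`. -/
theorem gram_posDef (g : Metric3 N) (hy : y ∈ A.base) : (A.gram g y).PosDef := by
  have hq := pt_mem hy A.level_mem
  refine Matrix.PosDef.of_dotProduct_mulVec_pos ?_ fun {u} hu => ?_
  · ext i j
    simpa [gram_apply] using coeffB_symm g j i y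
  · let w : TangentSpace (𝓡 3) (A.pt y A.level) := ∑ i, u i • A.coordField i (A.pt y A.level)
    have hc : ∀ i, A.comps _ w i = u i := by
      intro i
      simp only [w, map_sum, map_smul, comps_coordField hq]
      fin_cases i <;> simp [Fin.sum_univ_three]
    have hw : w ≠ 0 := by
      intro h
      refine hu (funext fun i => ?_)
      rw [← hc i, h, map_zero]
      rfl
    have h := g.pos _ w hw
    rw [inner_eq_sum g hq] at h
    simp only [hc] at h
    refine h.trans_eq ?_
    simp only [dotProduct, Matrix.mulVec, Finset.mul_sum, gram_apply, star_trivial]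
    refine Finset.sum_congr rfl fun i _ => Finset.sum_congr rfl fun j _ => ?_
    rw [coeffB]
    ring

theorem gram_inv_symm (hy : y ∈ A.base) (i j : Fin 3) :
    (A.gram g y)⁻¹ i j = (A.gram g y)⁻¹ j i := by
  have h := congrFun (congrFun (gram_posDef g hy).inv.isHermitian i) j
  simpa using h.symm

theorem contDiffOn_coeffInv (g : Metric3 N) (i j : Fin 3) :
    ContDiffOn ℝ ∞ (A.coeffInv g i j) A.base :=
  ContDiffOn.matrix_inv (M := A.gram g) (fun i j => contDiffOn_coeffB g i j)
    (fun _ hy => (gram_posDef g hy).det_pos.ne') i j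

variable (A) in
/-- The quotient metric on covectors of the orbit space. -/
noncomputable def cometric (g : Metric3 N) (y : ℝ × ℝ) (φ η : ℝ × ℝ →L[ℝ] ℝ) : ℝ :=
  (A.coeffInv g 0 0 y * φ (1, 0) + A.coeffInv g 0 1 y * φ (0, 1)) * η (1, 0)
    + (A.coeffInv g 0 1 y * φ (1, 0) + A.coeffInv g 1 1 y * φ (0, 1)) * η (0, 1)

/-- A covector of the base pulled back to `N` has third component `0`. The form on covectors is thus
a restriction of the full inverse Gram matrix and inherits its positivity. -/
theorem cometric_eq_dotProduct (hy : y ∈ A.base) (φ η : ℝ × ℝ →L[ℝ] ℝ) :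
    A.cometric g y φ η = ![φ (1, 0), φ (0, 1), 0] ⬝ᵥ
      ((A.gram g y)⁻¹.mulVec ![η (1, 0), η (0, 1), 0]) := by
  simp only [cometric, coeffInv_eq, dotProduct, Matrix.mulVec, Fin.sum_univ_three]
  rw [gram_inv_symm hy 1 0]
  simp
  ring

theorem eq_zero_of_basis {φ : ℝ × ℝ →L[ℝ] ℝ} (h1 : φ (1, 0) = 0) (h2 : φ (0, 1) = 0) : φ = 0 := by
  ext <;> simp [h1, h2]

theorem clm_apply_eq (φ : ℝ × ℝ →L[ℝ] ℝ) (z : ℝ × ℝ) :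
    φ z = z.1 * φ (1, 0) + z.2 * φ (0, 1) := by
  conv_lhs => rw [show z = z.1 • ((1 : ℝ), (0 : ℝ)) + z.2 • ((0 : ℝ), (1 : ℝ)) by ext <;> simp]
  rw [map_add, map_smul, map_smul, smul_eq_mul, smul_eq_mul]

theorem cometric_pos (hy : y ∈ A.base) {φ : ℝ × ℝ →L[ℝ] ℝ} (hφ : φ ≠ 0) :
    0 < A.cometric g y φ φ := by
  rw [cometric_eq_dotProduct hy]
  have hne : ![φ (1, 0), φ (0, 1), 0] ≠ 0 := by
    intro h
    exact hφ (eq_zero_of_basis (congrFun h 0) (congrFun h 1))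
  simpa using (gram_posDef g hy).inv.dotProduct_mulVec_pos hne

/-- Orthogonal nonzero covectors of the plane have no common kernel. -/
theorem eq_zero_of_cometric_eq_zero (hy : y ∈ A.base) {φ η : ℝ × ℝ →L[ℝ] ℝ} (hφ : φ ≠ 0)
    (hη : η ≠ 0) (h : A.cometric g y φ η = 0) {z : ℝ × ℝ} (h1 : φ z = 0) (h2 : η z = 0) :
    z = 0 := by
  by_contra hz
  have hn : 0 < z.1 ^ 2 + z.2 ^ 2 := by
    rcases eq_or_ne z.1 0 with h3 | h3
    · have h4 : z.2 ≠ 0 := fun h4 => hz (Prod.ext h3 h4)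
      positivity
    · positivity
  -- Covectors vanishing at `z ≠ 0` form the line spanned by `ν`. If `φ = a ν` and `η = b ν`, their
  -- product is `a b` times the positive squared length of `ν`, contrary to orthogonality.
  let ν : ℝ × ℝ →L[ℝ] ℝ :=
    z.1 • ContinuousLinearMap.snd ℝ ℝ ℝ - z.2 • ContinuousLinearMap.fst ℝ ℝ ℝ
  have hν : ∀ φ : ℝ × ℝ →L[ℝ] ℝ, φ z = 0 →
      φ = ((φ (0, 1) * z.1 - φ (1, 0) * z.2) / (z.1 ^ 2 + z.2 ^ 2)) • ν := by
    intro φ hφz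
    rw [clm_apply_eq] at hφz
    rw [← sub_eq_zero]
    refine eq_zero_of_basis ?_ ?_
    · simp [ν]
      field_simp
      linear_combination z.1 * hφz
    · simp [ν]
      field_simp
      linear_combination z.2 * hφz
  have hφ' := hν φ h1
  have hη' := hν η h2
  set a := (φ (0, 1) * z.1 - φ (1, 0) * z.2) / (z.1 ^ 2 + z.2 ^ 2)
  set b := (η (0, 1) * z.1 - η (1, 0) * z.2) / (z.1 ^ 2 + z.2 ^ 2)
  have ha : a ≠ 0 := fun h0 => hφ (by rw [hφ', h0, zero_smul])
  have hb : b ≠ 0 := fun h0 => hη (by rw [hη', h0, zero_smul])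
  have hν0 : ν ≠ 0 := fun h0 => hφ (by rw [hφ', h0, smul_zero])
  have h3 : A.cometric g y φ η = a * b * A.cometric g y ν ν := by
    rw [hφ', hη']
    simp only [cometric, smul_apply, smul_eq_mul]
    ring
  rw [h] at h3
  exact mul_ne_zero (mul_ne_zero ha hb) (cometric_pos hy hν0).ne' h3.symm

theorem inner_grad (g : Metric3 N) (f : N → ℝ) (q : N) (u : TangentSpace (𝓡 3) q) :
    g.inner q (grad g f q) u = mfderiv (𝓡 3) 𝓘(ℝ, ℝ) f q u :=
  (exists_grad g f q).choose_spec u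

/-- The scalar product of the gradients of two functions which factor through the projection. -/
theorem inner_grad_grad (hX : IsKilling g X) (hq : q ∈ A.chart.source) {f h : N → ℝ}
    {φ η : ℝ × ℝ →L[ℝ] ℝ}
    (hf : ∀ u, mfderiv (𝓡 3) 𝓘(ℝ, ℝ) f q u = φ (planeCLM (A.comps q u)))
    (hh : ∀ u, mfderiv (𝓡 3) 𝓘(ℝ, ℝ) h q u = η (planeCLM (A.comps q u))) :
    g.inner q (grad g f q) (grad g h q) = A.cometric g (A.proj q) φ η := by
  have hy := proj_mem hq
  have hdet : IsUnit (A.gram g (A.proj q)).det := (gram_posDef g hy).det_pos.ne'.isUnit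
  set a : Fin 3 → ℝ := fun i => A.comps q (grad g h q) i with ha
  -- Pairing the gradient of `h` with the coordinate fields gives the partial derivatives of `h`,
  -- the third one being zero. Inverting the Gram matrix then yields the components of the gradient.
  have h1 : Matrix.vecMul a (A.gram g (A.proj q)) = ![η (1, 0), η (0, 1), 0] := by
    funext j
    have h2 := inner_grad g h q (A.coordField j q)
    rw [hh, inner_eq_sum_coeffB hX hq, comps_coordField hq] at h2
    have h3 : Matrix.vecMul a (A.gram g (A.proj q)) j = ∑ i, a i * A.coeffB g i j (A.proj q) := rfl
    rw [h3]
    refine Eq.trans ?_ (h2.trans ?_)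
    · refine Finset.sum_congr rfl fun i _ => ?_
      fin_cases j <;> simp [ha]
    · rw [planeCLM_apply, clm_apply_eq]
      fin_cases j <;> simp
  have h4 : a = Matrix.mulVec (A.gram g (A.proj q))⁻¹ ![η (1, 0), η (0, 1), 0] := by
    have h5 := congrArg (fun v => Matrix.vecMul v (A.gram g (A.proj q))⁻¹) h1
    simp only [Matrix.vecMul_vecMul, Matrix.mul_nonsing_inv _ hdet, Matrix.vecMul_one] at h5
    rw [h5, ← Matrix.mulVec_transpose]
    congr 1
    ext i j
    exact gram_inv_symm hy j i
  rw [inner_grad, hf, cometric_eq_dotProduct hy, ← h4, planeCLM_apply, clm_apply_eq]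
  simp [dotProduct, Fin.sum_univ_three, ha]
  ring

theorem gradNorm_eq (hX : IsKilling g X) (hq : q ∈ A.chart.source) {f : N → ℝ}
    {φ : ℝ × ℝ →L[ℝ] ℝ}
    (hf : ∀ u, mfderiv (𝓡 3) 𝓘(ℝ, ℝ) f q u = φ (planeCLM (A.comps q u))) :
    gradNorm g f q = Real.sqrt (A.cometric g (A.proj q) φ φ) := by
  rw [gradNorm, inner_grad_grad hX hq hf hf]

theorem mfderiv_comp_proj (hq : q ∈ A.chart.source) {f : ℝ × ℝ → ℝ}
    (hf : DifferentiableAt ℝ f (A.proj q)) (u : TangentSpace (𝓡 3) q) :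
    mfderiv (𝓡 3) 𝓘(ℝ, ℝ) (fun q => f (A.proj q)) q u
      = fderiv ℝ f (A.proj q) (planeCLM (A.comps q u)) := by
  have h := hf.hasFDerivAt.hasMFDerivAt.comp q (hasMFDerivAt_proj hq)
  exact DFunLike.congr_fun h.mfderiv u

theorem differentiableAt_volumeB (g : Metric3 N) (hy : y ∈ A.base) :
    DifferentiableAt ℝ (A.volumeB g) y :=
  ((contDiffOn_volumeB g).contDiffAt (A.isOpen_base.mem_nhds hy)).differentiableAt (by simp)

theorem mfderiv_volumeFn (hX : IsKilling g X) (hq : q ∈ A.chart.source)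
    (u : TangentSpace (𝓡 3) q) : mfderiv (𝓡 3) 𝓘(ℝ, ℝ) (volumeFn g X) q u
      = fderiv ℝ (A.volumeB g) (A.proj q) (planeCLM (A.comps q u)) := by
  have h : volumeFn g X =ᶠ[𝓝 q] fun q => A.volumeB g (A.proj q) :=
    (A.chart.open_source.eventually_mem hq).mono fun q hq => volumeFn_eq_volumeB hX hq
  have h2 := (differentiableAt_volumeB g (proj_mem hq)).hasFDerivAt.hasMFDerivAt.comp q
    (hasMFDerivAt_proj hq)
  exact DFunLike.congr_fun (h2.congr_of_eventuallyEq h).mfderiv u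

theorem gradNorm_volumeFn (hX : IsKilling g X) (hq : q ∈ A.chart.source) :
    gradNorm g (volumeFn g X) q = Real.sqrt (A.cometric g (A.proj q)
      (fderiv ℝ (A.volumeB g) (A.proj q)) (fderiv ℝ (A.volumeB g) (A.proj q))) :=
  gradNorm_eq hX hq (mfderiv_volumeFn hX hq)

theorem gradNorm_comp_proj (hX : IsKilling g X) (hq : q ∈ A.chart.source) {f : ℝ × ℝ → ℝ}
    (hf : DifferentiableAt ℝ f (A.proj q)) :
    gradNorm g (fun q => f (A.proj q)) q = Real.sqrt (A.cometric g (A.proj q)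
      (fderiv ℝ f (A.proj q)) (fderiv ℝ f (A.proj q))) :=
  gradNorm_eq hX hq (mfderiv_comp_proj hq hf)

theorem normGradVolume_eq (hX : IsKilling g X) (hy : y ∈ A.base) :
    A.normGradVolume g y = Real.sqrt (A.cometric g y
      (fderiv ℝ (A.volumeB g) y) (fderiv ℝ (A.volumeB g) y)) := by
  rw [normGradVolume, gradNorm_volumeFn hX (pt_mem hy A.level_mem), proj_pt hy A.level_mem]

theorem normGradTheta_eq (hX : IsKilling g X) (hy : y ∈ A.base) {θ : ℝ × ℝ → ℝ}
    (hθ : DifferentiableAt ℝ θ y) : A.normGradTheta g θ y = Real.sqrt (A.cometric g y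
      (fderiv ℝ θ y) (fderiv ℝ θ y)) := by
  rw [← proj_pt hy A.level_mem] at hθ
  rw [normGradTheta, gradNorm_comp_proj hX (pt_mem hy A.level_mem) hθ, proj_pt hy A.level_mem]

theorem contDiffOn_cometric {φ η : ℝ × ℝ → ℝ} {D : Set (ℝ × ℝ)} (hD : IsOpen D)
    (hDb : D ⊆ A.base) (hφ : ContDiffOn ℝ ∞ φ D) (hη : ContDiffOn ℝ ∞ η D) :
    ContDiffOn ℝ ∞ (fun y => A.cometric g y (fderiv ℝ φ y) (fderiv ℝ η y)) D := by
  have h1 : ∀ {φ : ℝ × ℝ → ℝ}, ContDiffOn ℝ ∞ φ D → ∀ u,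
      ContDiffOn ℝ ∞ (fun y => fderiv ℝ φ y u) D := fun hφ u =>
    (hφ.fderiv_of_isOpen hD (by simp)).clm_apply contDiffOn_const
  have h2 := fun i j => (contDiffOn_coeffInv (A := A) g i j).mono hDb
  exact ((((h2 0 0).mul (h1 hφ _)).add ((h2 0 1).mul (h1 hφ _))).mul (h1 hη _)).add
    ((((h2 0 1).mul (h1 hφ _)).add ((h2 1 1).mul (h1 hφ _))).mul (h1 hη _))

end AdaptedChart

end Gradient

/-! ### The coordinates `(ω,θ)` on the orbit space. -/

section OrbitCoordinates

variable {N : Type*} [TopologicalSpace N] [ChartedSpace E3 N] [IsManifold (𝓡 3) ∞ N]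

namespace AdaptedChart

open Filter Topology

variable {X : (x : N) → TangentSpace (𝓡 3) x} {A : AdaptedChart X} {g : Metric3 N} {q : N}
  {y : ℝ × ℝ} {D : Set (ℝ × ℝ)} {θ : ℝ × ℝ → ℝ}

/-- Orthogonal covectors are the components of a linear isomorphism. -/
theorem exists_equiv_of_cometric (hy : y ∈ A.base) {φ η : ℝ × ℝ →L[ℝ] ℝ} (hφ : φ ≠ 0)
    (hη : η ≠ 0) (h : A.cometric g y φ η = 0) :
    ∃ L : (ℝ × ℝ) ≃L[ℝ] (ℝ × ℝ), (L : ℝ × ℝ →L[ℝ] ℝ × ℝ) = φ.prod η := by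
  have hinj : Function.Injective (φ.prod η : ℝ × ℝ →ₗ[ℝ] ℝ × ℝ) := by
    rw [injective_iff_map_eq_zero]
    intro z hz
    exact eq_zero_of_cometric_eq_zero hy hφ hη h (congrArg Prod.fst hz) (congrArg Prod.snd hz)
  exact ⟨(LinearEquiv.ofInjectiveEndo _ hinj).toContinuousLinearEquiv, by ext <;> rfl⟩

/-- Orthogonal nonzero covectors of the plane have no common kernel, so the differential of `(ω,θ)`
is invertible and the inverse function theorem applies. -/
theorem exists_local_inverse (hU : IsOpen D) (hDb : D ⊆ A.base) (hθ : ContDiffOn ℝ ∞ θ D)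
    (hy : y ∈ D) (hω : fderiv ℝ (A.volumeB g) y ≠ 0) (hθ0 : fderiv ℝ θ y ≠ 0)
    (h : A.cometric g y (fderiv ℝ (A.volumeB g) y) (fderiv ℝ θ y) = 0) :
    ∃ e : OpenPartialHomeomorph (ℝ × ℝ) (ℝ × ℝ), y ∈ e.source ∧ e.source ⊆ D ∧
      (∀ x, e x = A.orbitMap g θ x) ∧ ContDiffOn ℝ ∞ e.symm e.target := by
  obtain ⟨L, hL⟩ := exists_equiv_of_cometric (hDb hy) hω hθ0 h
  have hd : HasFDerivAt (A.orbitMap g θ) (L : ℝ × ℝ →L[ℝ] ℝ × ℝ) y := by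
    rw [hL]
    exact (differentiableAt_volumeB g (hDb hy)).hasFDerivAt.prodMk
      ((hθ.contDiffAt (hU.mem_nhds hy)).differentiableAt (by simp)).hasFDerivAt
  exact exists_openPartialHomeomorph_of_contDiffOn hU
    (((contDiffOn_volumeB g).mono hDb).prodMk hθ) hy hd

/-- Existence of orthogonal coordinates on the orbit space. -/
theorem exists_isOrbitCoord (hX : IsKilling g X) (A : AdaptedChart X) (hq : q ∈ A.chart.source)
    (hd : mfderiv (𝓡 3) 𝓘(ℝ, ℝ) (volumeFn g X) q ≠ 0) :
    ∃ (D : Set (ℝ × ℝ)) (θ : ℝ × ℝ → ℝ), A.proj q ∈ D ∧ A.IsOrbitCoord g D θ := by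
  have hy₀ := proj_mem hq
  have hω₀ : fderiv ℝ (A.volumeB g) (A.proj q) ≠ 0 := by
    intro h0
    refine hd (ContinuousLinearMap.ext fun u => ?_)
    refine (mfderiv_volumeFn hX hq u).trans ?_
    rw [h0]
    rfl
  have hfd : ContDiffOn ℝ ∞ (fderiv ℝ (A.volumeB g)) A.base :=
    (contDiffOn_volumeB g).fderiv_of_isOpen A.isOpen_base (by simp)
  let U : Set (ℝ × ℝ) := A.base ∩ fderiv ℝ (A.volumeB g) ⁻¹' {0}ᶜ
  have hU : IsOpen U :=
    hfd.continuousOn.isOpen_inter_preimage A.isOpen_base isOpen_compl_singleton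
  -- `v` is the gradient of `ω` on the base. The linear equation for `θ` says `dθ(v) = 0`, and
  -- `dω(v) > 0` wherever `dω ≠ 0`.
  let v : ℝ × ℝ → ℝ × ℝ := fun y =>
    (A.coeffInv g 0 0 y * fderiv ℝ (A.volumeB g) y (1, 0)
      + A.coeffInv g 0 1 y * fderiv ℝ (A.volumeB g) y (0, 1),
     A.coeffInv g 0 1 y * fderiv ℝ (A.volumeB g) y (1, 0)
      + A.coeffInv g 1 1 y * fderiv ℝ (A.volumeB g) y (0, 1))
  have hv : ContDiffOn ℝ ∞ v U := by
    have h1 : ∀ u, ContDiffOn ℝ ∞ (fun y => fderiv ℝ (A.volumeB g) y u) A.base := fun u =>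
      hfd.clm_apply contDiffOn_const
    have h2 := contDiffOn_coeffInv (A := A) g
    exact ((((h2 0 0).mul (h1 _)).add ((h2 0 1).mul (h1 _))).prodMk
      (((h2 0 1).mul (h1 _)).add ((h2 1 1).mul (h1 _)))).mono inter_subset_left
  have hvη : ∀ y (η : ℝ × ℝ →L[ℝ] ℝ), η (v y) = A.cometric g y (fderiv ℝ (A.volumeB g) y) η := by
    intro y η
    rw [clm_apply_eq]
    rfl
  have hv₀ : v (A.proj q) ≠ 0 := by
    intro h0
    have h1 := hvη (A.proj q) (fderiv ℝ (A.volumeB g) (A.proj q))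
    rw [h0, map_zero] at h1
    exact (cometric_pos hy₀ hω₀).ne h1
  obtain ⟨F, hF0, hFp, hF, hF', hfl⟩ := exists_flowBox hU hv (p := A.proj q) ⟨hy₀, hω₀⟩ hv₀
    (e := ((0 : ℝ), (1 : ℝ))) (ℓ := ContinuousLinearMap.snd ℝ ℝ ℝ) (by simp)
  -- In the flow box `v` is the second coordinate field, so the first coordinate is constant along
  -- `v` and has nonzero differential.
  let θ : ℝ × ℝ → ℝ := fun y => (F.symm y).1
  have hθ : ContDiffOn ℝ ∞ θ F.target := contDiff_fst.comp_contDiffOn hF'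
  have hpt : A.proj q ∈ F.target := hFp ▸ F.map_source hF0
  have hθF : ∀ x ∈ F.source, ∀ u, fderiv ℝ θ (F x) (fderiv ℝ F x u) = u.1 := by
    intro x hx u
    have h1 : HasFDerivAt θ (fderiv ℝ θ (F x)) (F x) :=
      ((hθ.contDiffAt (F.open_target.mem_nhds (F.map_source hx))).differentiableAt
        (by simp)).hasFDerivAt
    have h2 : HasFDerivAt F (fderiv ℝ F x) x :=
      ((hF.contDiffAt (F.open_source.mem_nhds hx)).differentiableAt (by simp)).hasFDerivAt
    have h3 : HasFDerivAt (θ ∘ F) (ContinuousLinearMap.fst ℝ ℝ ℝ) x := by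
      refine hasFDerivAt_fst.congr_of_eventuallyEq ?_
      filter_upwards [F.open_source.mem_nhds hx] with z hz
      simp [θ, F.left_inv hz]
    exact DFunLike.congr_fun ((h1.comp x h2).unique h3) u
  have hθ0 : ∀ y ∈ F.target, fderiv ℝ θ y ≠ 0 := by
    intro y hy h0
    have h1 := hθF _ (F.map_target hy) (1, 0)
    rw [F.right_inv hy, h0] at h1
    simp at h1
  have hpde : ∀ y ∈ F.target, A.cometric g y (fderiv ℝ (A.volumeB g) y) (fderiv ℝ θ y) = 0 := by
    intro y hy
    have h1 := hθF _ (F.map_target hy) (0, 1)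
    rw [(hfl _ (F.map_target hy)).2, F.right_inv hy] at h1
    rw [← hvη, h1]
  have hFU : F.target ⊆ U := fun y hy => by
    rw [← F.right_inv hy]
    exact (hfl _ (F.map_target hy)).1
  -- Shrinking to the source of a local inverse makes `(ω,θ)` injective.
  obtain ⟨e, he1, he2, he3, -⟩ := exists_local_inverse F.open_target
    (fun y hy => (hFU hy).1) hθ hpt hω₀ (hθ0 _ hpt) (hpde _ hpt)
  refine ⟨e.source, θ, he1, e.open_source, fun y hy => (hFU (he2 hy)).1, hθ.mono he2,
    fun y hy => (hFU (he2 hy)).2, fun y hy => hθ0 y (he2 hy), fun y hy => hpde y (he2 hy), ?_⟩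
  intro a ha b hb hab
  exact e.injOn ha hb ((he3 a).trans (hab.trans (he3 b).symm))

namespace IsOrbitCoord

variable (h : A.IsOrbitCoord g D θ)
include h

theorem differentiableAt_theta (hy : y ∈ D) : DifferentiableAt ℝ θ y :=
  (h.smooth.contDiffAt (h.isOpen.mem_nhds hy)).differentiableAt (by simp)

theorem cometric_eq_zero (hy : y ∈ D) :
    A.cometric g y (fderiv ℝ (A.volumeB g) y) (fderiv ℝ θ y) = 0 :=
  h.pde y hy

theorem exists_inverse (hy : y ∈ D) :
    ∃ e : OpenPartialHomeomorph (ℝ × ℝ) (ℝ × ℝ), y ∈ e.source ∧ e.source ⊆ D ∧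
      (∀ x, e x = A.orbitMap g θ x) ∧ ContDiffOn ℝ ∞ e.symm e.target :=
  exists_local_inverse h.isOpen h.subset h.smooth hy (h.volume_ne y hy) (h.theta_ne y hy)
    (h.cometric_eq_zero hy)

theorem orbitInv_orbitMap (hy : y ∈ D) : A.orbitInv g D θ (A.orbitMap g θ y) = y :=
  h.injOn.leftInvOn_invFunOn hy

theorem orbitInv_mem {z : ℝ × ℝ} (hz : z ∈ A.orbitMap g θ '' D) : A.orbitInv g D θ z ∈ D :=
  Function.invFunOn_mem hz

theorem orbitMap_orbitInv {z : ℝ × ℝ} (hz : z ∈ A.orbitMap g θ '' D) :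
    A.orbitMap g θ (A.orbitInv g D θ z) = z :=
  Function.invFunOn_eq hz

theorem isOpen_image : IsOpen (A.orbitMap g θ '' D) := by
  rw [isOpen_iff_mem_nhds]
  rintro _ ⟨y, hy, rfl⟩
  obtain ⟨e, h1, h2, h3, -⟩ := h.exists_inverse hy
  refine Filter.mem_of_superset (e.open_target.mem_nhds (h3 y ▸ e.map_source h1)) fun z hz => ?_
  exact ⟨e.symm z, h2 (e.map_target hz), by rw [← h3, e.right_inv hz]⟩

theorem contDiffOn_orbitMap : ContDiffOn ℝ ∞ (A.orbitMap g θ) D :=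
  ((contDiffOn_volumeB g).mono h.subset).prodMk h.smooth

/-- `orbitInv` is defined by choice on the whole image; injectivity on `D` forces it to agree with
the smooth local inverse near each point. -/
theorem contDiffOn_orbitInv : ContDiffOn ℝ ∞ (A.orbitInv g D θ) (A.orbitMap g θ '' D) := by
  rintro _ ⟨y, hy, rfl⟩
  obtain ⟨e, h1, h2, h3, h4⟩ := h.exists_inverse hy
  have hm : A.orbitMap g θ y ∈ e.target := h3 y ▸ e.map_source h1
  refine ContDiffAt.contDiffWithinAt ?_
  refine (h4.contDiffAt (e.open_target.mem_nhds hm)).congr_of_eventuallyEq ?_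
  filter_upwards [e.open_target.mem_nhds hm] with z hz
  have h5 := h.orbitInv_orbitMap (h2 (e.map_target hz))
  rwa [← h3, e.right_inv hz] at h5

theorem normGradVolume_sq (hX : IsKilling g X) (hy : y ∈ D) :
    A.normGradVolume g y ^ 2
      = A.cometric g y (fderiv ℝ (A.volumeB g) y) (fderiv ℝ (A.volumeB g) y) := by
  rw [normGradVolume_eq hX (h.subset hy), Real.sq_sqrt]
  exact (cometric_pos (h.subset hy) (h.volume_ne y hy)).le

theorem normGradTheta_sq (hX : IsKilling g X) (hy : y ∈ D) :
    A.normGradTheta g θ y ^ 2 = A.cometric g y (fderiv ℝ θ y) (fderiv ℝ θ y) := by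
  rw [normGradTheta_eq hX (h.subset hy) (h.differentiableAt_theta hy), Real.sq_sqrt]
  exact (cometric_pos (h.subset hy) (h.theta_ne y hy)).le

theorem normGradVolume_pos (hX : IsKilling g X) (hy : y ∈ D) : 0 < A.normGradVolume g y := by
  rw [normGradVolume_eq hX (h.subset hy)]
  exact Real.sqrt_pos.2 (cometric_pos (h.subset hy) (h.volume_ne y hy))

theorem normGradTheta_pos (hX : IsKilling g X) (hy : y ∈ D) : 0 < A.normGradTheta g θ y := by
  rw [normGradTheta_eq hX (h.subset hy) (h.differentiableAt_theta hy)]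
  exact Real.sqrt_pos.2 (cometric_pos (h.subset hy) (h.theta_ne y hy))

theorem contDiffOn_normGradVolume (hX : IsKilling g X) :
    ContDiffOn ℝ ∞ (A.normGradVolume g) D :=
  ((contDiffOn_cometric h.isOpen h.subset ((contDiffOn_volumeB g).mono h.subset)
    ((contDiffOn_volumeB g).mono h.subset)).sqrt fun y hy =>
      (cometric_pos (h.subset hy) (h.volume_ne y hy)).ne').congr
        fun _ hy => normGradVolume_eq hX (h.subset hy)

theorem contDiffOn_normGradTheta (hX : IsKilling g X) :
    ContDiffOn ℝ ∞ (A.normGradTheta g θ) D :=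
  ((contDiffOn_cometric h.isOpen h.subset h.smooth h.smooth).sqrt fun y hy =>
      (cometric_pos (h.subset hy) (h.theta_ne y hy)).ne').congr
        fun _ hy => normGradTheta_eq hX (h.subset hy) (h.differentiableAt_theta hy)

/-- Orthogonality of the gradients and independence of their lengths of `x₃`. -/
theorem grad_properties (hX : IsKilling g X) (hq : q ∈ A.chart.source) (hqD : A.proj q ∈ D) :
    g.inner q (grad g (volumeFn g X) q) (grad g (fun q' => θ (A.proj q')) q) = 0 ∧
      gradNorm g (volumeFn g X) q = A.normGradVolume g (A.proj q) ∧
      gradNorm g (fun q' => θ (A.proj q')) q = A.normGradTheta g θ (A.proj q) := by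
  have hθ := h.differentiableAt_theta hqD
  refine ⟨?_, ?_, ?_⟩
  · rw [inner_grad_grad hX hq (mfderiv_volumeFn hX hq) (mfderiv_comp_proj hq hθ),
      h.cometric_eq_zero hqD]
  · rw [gradNorm_volumeFn hX hq, normGradVolume_eq hX (proj_mem hq)]
  · rw [gradNorm_comp_proj hX hq hθ, normGradTheta_eq hX (proj_mem hq) hθ]

/-- The quotient metric is diagonal in the coordinates `(ω,θ)`. -/
theorem quotSq_eq_add (hX : IsKilling g X) (hy : y ∈ D) (w : ℝ × ℝ) :
    A.quotSq g y w = (fderiv ℝ (A.volumeB g) y w) ^ 2 / A.normGradVolume g y ^ 2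
      + (fderiv ℝ θ y w) ^ 2 / A.normGradTheta g θ y ^ 2 := by
  have hyb := h.subset hy
  have hq := pt_mem hyb A.level_mem
  have hpr := proj_pt hyb A.level_mem
  set q := A.pt y A.level with hqdef
  have hθ := h.differentiableAt_theta hy
  have hω := mfderiv_volumeFn hX hq
  have hθ' : ∀ u, mfderiv (𝓡 3) 𝓘(ℝ, ℝ) (fun q => θ (A.proj q)) q u
      = fderiv ℝ θ (A.proj q) (planeCLM (A.comps q u)) :=
    mfderiv_comp_proj hq (hpr.symm ▸ hθ)
  set a := fderiv ℝ (A.volumeB g) y w / A.normGradVolume g y ^ 2 with ha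
  set b := fderiv ℝ θ y w / A.normGradTheta g θ y ^ 2 with hb
  have hna := (h.normGradVolume_pos hX hy).ne'
  have hnb := (h.normGradTheta_pos hX hy).ne'
  set G₁ := grad g (volumeFn g X) q
  set G₂ := grad g (fun q => θ (A.proj q)) q
  have h11 : g.inner q G₁ G₁ = A.normGradVolume g y ^ 2 := by
    rw [h.normGradVolume_sq hX hy, inner_grad_grad hX hq hω hω, hpr]
  have h22 : g.inner q G₂ G₂ = A.normGradTheta g θ y ^ 2 := by
    rw [h.normGradTheta_sq hX hy, inner_grad_grad hX hq hθ' hθ', hpr]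
  have h12 : g.inner q G₁ G₂ = 0 := by
    rw [inner_grad_grad hX hq hω hθ', hpr, h.cometric_eq_zero hy]
  have h21 : g.inner q G₂ G₁ = 0 := by rw [g.symm, h12]
  set W : TangentSpace (𝓡 3) q := A.horLift g y w
  have hWp : planeCLM (A.comps q W) = w := by
    simp only [W, horLift, map_sub, map_add, map_smul]
    rw [← hqdef, comps_coordField hq, comps_coordField hq, comps_coordField hq]
    ext <;> simp [planeCLM_apply]
  have hG1 : ∀ u, g.inner q G₁ u = fderiv ℝ (A.volumeB g) y (planeCLM (A.comps q u)) := by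
    intro u
    rw [inner_grad, hω, hpr]
  have hG2 : ∀ u, g.inner q G₂ u = fderiv ℝ θ y (planeCLM (A.comps q u)) := by
    intro u
    rw [inner_grad, hθ', hpr]
  have hXp : planeCLM (A.comps q (X q)) = 0 := by
    rw [comps_field hq, planeCLM_apply]
    simp
  have hWX : g.inner q W (X q) = 0 := by
    have h0 := (coeffB_two_two_pos g hyb).ne'
    rw [← coordField_two hq]
    simp only [W, horLift, map_sub, map_add, map_smul, sub_apply, add_apply, smul_apply,
      smul_eq_mul]
    change w.1 * A.coeffB g 0 2 y + w.2 * A.coeffB g 1 2 y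
      - (w.1 * A.coeffB g 0 2 y + w.2 * A.coeffB g 1 2 y) / A.coeffB g 2 2 y
        * A.coeffB g 2 2 y = 0
    field_simp
    ring
  have hW1 : g.inner q G₁ W = fderiv ℝ (A.volumeB g) y w := by rw [hG1, hWp]
  have hW2 : g.inner q G₂ W = fderiv ℝ θ y w := by rw [hG2, hWp]
  -- The horizontal lift minus its components along both gradients. It is orthogonal to `∇ω` and
  -- `∇θ`, so `dω` and `dθ` vanish on its projection, which is therefore zero; being also orthogonal
  -- to `X`, it has length zero. Expanding `g(Z,Z) = 0` gives the formula.
  set Z := W - a • G₁ - b • G₂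
  have hZ1 : g.inner q G₁ Z = 0 := by
    simp only [Z, map_sub, map_smul, h11, h12, hW1, smul_eq_mul, ha]
    field_simp
    ring
  have hZ2 : g.inner q G₂ Z = 0 := by
    simp only [Z, map_sub, map_smul, h22, h21, hW2, smul_eq_mul, hb]
    field_simp
    ring
  have hZX : g.inner q Z (X q) = 0 := by
    simp only [Z, map_sub, map_smul, sub_apply, smul_apply, hWX, hG1, hG2, hXp, map_zero,
      smul_zero, sub_zero]
  have hZp : planeCLM (A.comps q Z) = 0 := by
    refine eq_zero_of_cometric_eq_zero hyb (h.volume_ne y hy) (h.theta_ne y hy)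
      (h.cometric_eq_zero hy) ?_ ?_
    · rw [← hG1, hZ1]
    · rw [← hG2, hZ2]
  have hZZ : g.inner q Z Z = 0 := by
    rw [inner_self_eq hX hq, hZX, hZp, quotSq_eq g (proj_mem hq)]
    simp
  have hWW : g.inner q Z Z = g.inner q W W - a * fderiv ℝ (A.volumeB g) y w
      - b * fderiv ℝ θ y w := by
    have h1 : g.inner q Z Z = g.inner q W Z - a * g.inner q G₁ Z - b * g.inner q G₂ Z := by
      simp only [Z, map_sub, map_smul, sub_apply, smul_apply, smul_eq_mul]
      rw [g.symm q W G₁, g.symm q W G₂, h12, h21]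
    rw [h1, hZ1, hZ2, mul_zero, mul_zero, sub_zero, sub_zero]
    simp only [Z, map_sub, map_smul, smul_eq_mul]
    rw [g.symm q W G₁, g.symm q W G₂, hW1, hW2]
  have h1 : A.quotSq g y w = g.inner q W W := rfl
  rw [h1]
  rw [hZZ, ha, hb] at hWW
  linear_combination -hWW

end IsOrbitCoord

end AdaptedChart

end OrbitCoordinates

/-! ### Partial derivatives on a rectangle. -/

section Rectangle

variable {F : Type*} [NormedAddCommGroup F] [NormedSpace ℝ F] {J T : Set ℝ}

theorem hasDerivAt_slice {f : ℝ × ℝ → F} {s t : ℝ} (hf : DifferentiableAt ℝ f (s, t)) :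
    HasDerivAt (fun t => f (s, t)) (fderiv ℝ f (s, t) (0, 1)) t := by
  have h := hf.hasFDerivAt.comp_hasDerivAt t ((hasDerivAt_const t s).prodMk (hasDerivAt_id t))
  exact h

theorem hasDerivAt_slice_fst {f : ℝ × ℝ → F} {s t : ℝ} (hf : DifferentiableAt ℝ f (s, t)) :
    HasDerivAt (fun s => f (s, t)) (fderiv ℝ f (s, t) (1, 0)) s := by
  have h := hf.hasFDerivAt.comp_hasDerivAt s ((hasDerivAt_id s).prodMk (hasDerivAt_const s t))
  exact h

/-- A function on a rectangle with vanishing second partial derivative. -/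
theorem eq_of_partial_eq_zero (hT : IsOpenInterval T) {f : ℝ × ℝ → F} {s : ℝ}
    (hf : ∀ t ∈ T, DifferentiableAt ℝ f (s, t)) (h0 : ∀ t ∈ T, fderiv ℝ f (s, t) (0, 1) = 0)
    {t t' : ℝ} (ht : t ∈ T) (ht' : t' ∈ T) : f (s, t) = f (s, t') :=
  hT.1.is_const_of_deriv_eq_zero hT.2.1.isPreconnected
    (fun t ht => (hasDerivAt_slice (hf t ht)).differentiableAt.differentiableWithinAt)
    (fun t ht => (hasDerivAt_slice (hf t ht)).deriv.trans (h0 t ht)) ht ht'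

theorem partial_eq_zero_of_eq (hT : IsOpen T) {f : ℝ × ℝ → F} {s t : ℝ} (ht : t ∈ T)
    (hf : DifferentiableAt ℝ f (s, t)) (h : ∀ t' ∈ T, f (s, t') = f (s, t)) :
    fderiv ℝ f (s, t) (0, 1) = 0 := by
  refine (hasDerivAt_slice hf).unique ((hasDerivAt_const t (f (s, t))).congr_of_eventuallyEq ?_)
  filter_upwards [hT.mem_nhds ht] with t' ht'
  exact h t' ht'

theorem fderiv_fderiv_apply {f : ℝ × ℝ → F} {p : ℝ × ℝ} (hf : ContDiffAt ℝ ∞ f p)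
    (u w : ℝ × ℝ) :
    fderiv ℝ (fun p => fderiv ℝ f p u) p w = fderiv ℝ (fun p => fderiv ℝ f p w) p u := by
  have h1 : DifferentiableAt ℝ (fderiv ℝ f) p :=
    (hf.fderiv_right (m := ∞) (by simp)).differentiableAt (by simp)
  have h2 : ∀ u, fderiv ℝ (fun p => fderiv ℝ f p u) p
      = (ContinuousLinearMap.apply ℝ F u).comp (fderiv ℝ (fderiv ℝ f) p) := fun u =>
    ((ContinuousLinearMap.apply ℝ F u).hasFDerivAt.comp p h1.hasFDerivAt).fderiv
  have h3 : IsSymmSndFDerivAt ℝ f p := hf.isSymmSndFDerivAt (by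
    rw [minSmoothness_of_isRCLikeNormedField]
    exact WithTop.coe_le_coe.2 (le_top : (2 : ℕ∞) ≤ ⊤))
  rw [h2, h2]
  exact h3 w u

theorem contDiffAt_partial {f : ℝ × ℝ → F} {p : ℝ × ℝ} (hf : ContDiffAt ℝ ∞ f p) (u : ℝ × ℝ) :
    ContDiffAt ℝ ∞ (fun p => fderiv ℝ f p u) p :=
  (hf.fderiv_right (m := ∞) (by simp)).clm_apply contDiffAt_const

end Rectangle

/-! ### Equations of an invariant surface in adapted coordinates. -/

section Surfaces

variable {N : Type*} [TopologicalSpace N] [ChartedSpace E3 N] [IsManifold (𝓡 3) ∞ N]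

open Filter Topology

variable {X : (x : N) → TangentSpace (𝓡 3) x} {A : AdaptedChart X} {g : Metric3 N}
  {J T : Set ℝ} {U : ℝ → ℝ} {ψ : ℝ × ℝ → N}

theorem FlowsTo.mono {V V' : Set N} (hV : V ⊆ V') {p q : N} {r : ℝ} (h : FlowsTo X V p r q) :
    FlowsTo X V' p r q := by
  obtain ⟨c, a, b, h0, hr, hc, hmap, h1, h2⟩ := h
  exact ⟨c, a, b, h0, hr, hc, hmap.mono_right hV, h1, h2⟩

/-- The second coordinate curves of a surface swept out by the flow are tangent to the field. -/
theorem IsFlowOut.hasMFDerivAt [T2Space N] (hX : ∀ x, SmoothFieldAt X x) (hJ : IsOpen J)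
    (hT : IsOpen T) {γ : ℝ → N} {v : ℝ × ℝ → ℝ} (h : IsFlowOut X J T γ v ψ) {s t : ℝ}
    (hs : s ∈ J) (ht : t ∈ T) :
    HasMFDerivAt 𝓘(ℝ, ℝ) (𝓡 3) (fun t => ψ (s, t)) t
      ((1 : ℝ →L[ℝ] ℝ).smulRight (fderiv ℝ v (s, t) (0, 1) • X (ψ (s, t)))) := by
  obtain ⟨-, hv, hflow⟩ := h
  obtain ⟨c, a, b, h0, hr, hc, -, hc0, hcr⟩ := hflow s hs t ht
  have hvd : HasDerivAt (fun t => v (s, t)) (fderiv ℝ v (s, t) (0, 1)) t :=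
    hasDerivAt_slice ((hv.contDiffAt ((hJ.prod hT).mem_nhds ⟨hs, ht⟩)).differentiableAt (by simp))
  have hX1 : ContMDiff (𝓡 3) (𝓡 3).tangent 1 (fun x => (⟨x, X x⟩ : TangentBundle (𝓡 3) N)) :=
    fun x => (hX x).of_le (WithTop.coe_le_coe.2 (le_top : (1 : ℕ∞) ≤ ⊤))
  -- `FlowsTo` supplies a separate integral curve for each parameter. All of them start at `γ s`, so
  -- uniqueness of integral curves in a Hausdorff manifold lets the curve `c` serve for every `t'`
  -- near `t`.
  have heq : (fun t => ψ (s, t)) =ᶠ[𝓝 t] fun t => c (v (s, t)) := by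
    filter_upwards [hT.mem_nhds ht, hvd.continuousAt (isOpen_Ioo.mem_nhds hr)] with t' ht' hv'
    obtain ⟨c', a', b', h0', hr', hc', -, hc0', hcr'⟩ := hflow s hs t' ht'
    rw [← hcr']
    have hsub : Ioo (max a a') (min b b') ⊆ Ioo a b :=
      Ioo_subset_Ioo (le_max_left _ _) (min_le_left _ _)
    have hsub' : Ioo (max a a') (min b b') ⊆ Ioo a' b' :=
      Ioo_subset_Ioo (le_max_right _ _) (min_le_right _ _)
    exact isMIntegralCurveOn_Ioo_eqOn_of_contMDiff_boundaryless
      (⟨max_lt h0.1 h0'.1, lt_min h0.2 h0'.2⟩ : (0 : ℝ) ∈ Ioo (max a a') (min b b')) hX1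
      (hc'.mono hsub') (hc.mono hsub) (hc0'.trans hc0.symm)
      ⟨max_lt hv'.1 hr'.1, lt_min hv'.2 hr'.2⟩
  have h1 : HasMFDerivAt 𝓘(ℝ, ℝ) (𝓡 3) c (v (s, t))
      ((1 : ℝ →L[ℝ] ℝ).smulRight (X (c (v (s, t))))) :=
    AdaptedChart.hasMFDerivAt_of_isMIntegralCurveOn isOpen_Ioo hc hr
  have h2 := (h1.comp t hvd.hasFDerivAt.hasMFDerivAt).congr_of_eventuallyEq heq
  rw [hcr] at h2
  have h3 : ((1 : ℝ →L[ℝ] ℝ).smulRight (X (ψ (s, t)))).comp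
      ((1 : ℝ →L[ℝ] ℝ).smulRight (fderiv ℝ v (s, t) (0, 1)))
      = (1 : ℝ →L[ℝ] ℝ).smulRight (fderiv ℝ v (s, t) (0, 1) • X (ψ (s, t))) := by
    refine ContinuousLinearMap.ext_ring ?_
    simp
  rw [← h3]
  exact h2

theorem hasMFDerivAt_slice {s t : ℝ} (hψ : MDifferentiableAt 𝓘(ℝ, ℝ × ℝ) (𝓡 3) ψ (s, t)) :
    HasMFDerivAt 𝓘(ℝ, ℝ) (𝓡 3) (fun t => ψ (s, t)) t
      ((1 : ℝ →L[ℝ] ℝ).smulRight (partialT ψ (s, t))) := by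
  have h1 : HasMFDerivAt 𝓘(ℝ, ℝ) 𝓘(ℝ, ℝ × ℝ) (fun t : ℝ => (s, t)) t
      (ContinuousLinearMap.inr ℝ ℝ ℝ) := (hasFDerivAt_prodMk_right s t).hasMFDerivAt
  have h2 := hψ.hasMFDerivAt.comp t h1
  have h3 : (mfderiv 𝓘(ℝ, ℝ × ℝ) (𝓡 3) ψ (s, t)).comp (ContinuousLinearMap.inr ℝ ℝ ℝ)
      = (1 : ℝ →L[ℝ] ℝ).smulRight (partialT ψ (s, t)) :=
    ContinuousLinearMap.ext_ring (one_smul ℝ (partialT ψ (s, t))).symm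
  rw [← h3]
  exact h2

theorem IsFlowOut.partialT_eq [T2Space N] (hX : ∀ x, SmoothFieldAt X x) (hJ : IsOpen J)
    (hT : IsOpen T) {γ : ℝ → N} {v : ℝ × ℝ → ℝ} (h : IsFlowOut X J T γ v ψ)
    (hψ : ContMDiffOn 𝓘(ℝ, ℝ × ℝ) (𝓡 3) ∞ ψ (J ×ˢ T)) {p : ℝ × ℝ} (hp : p ∈ J ×ˢ T) :
    partialT ψ p = fderiv ℝ v p (0, 1) • X (ψ p) := by
  obtain ⟨s, t⟩ := p
  have h1 := h.hasMFDerivAt hX hJ hT hp.1 hp.2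
  have h2 := hasMFDerivAt_slice (((hψ.contMDiffAt ((hJ.prod hT).mem_nhds hp))).mdifferentiableAt
    (by simp))
  have h3 := DFunLike.congr_fun (hasMFDerivAt_unique h1 h2) (1 : ℝ)
  exact ((one_smul ℝ _).symm.trans (h3.symm.trans (one_smul ℝ _)))

namespace AdaptedChart

variable (A) in
/-- The equations in adapted coordinates of an invariant surface `(s,t) ↦ (σ(s,t), H(s,t))` with
metric `ds² + U(s)² dt²` whose second partial derivative is `h` times the field. -/
structure SurfaceEqs (g : Metric3 N) (U : ℝ → ℝ) (J T : Set ℝ) (σ : ℝ × ℝ → ℝ × ℝ)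
    (H h : ℝ × ℝ → ℝ) : Prop where
  smooth_proj : ∀ p ∈ J ×ˢ T, ContDiffAt ℝ ∞ σ p
  smooth_height : ∀ p ∈ J ×ˢ T, ContDiffAt ℝ ∞ H p
  mem : ∀ p ∈ J ×ˢ T, σ p ∈ A.base
  proj_t : ∀ p ∈ J ×ˢ T, fderiv ℝ σ p (0, 1) = 0
  height_t : ∀ p ∈ J ×ˢ T, fderiv ℝ H p (0, 1) = h p
  factor : ∀ p ∈ J ×ˢ T, h p ^ 2 * A.coeffB g 2 2 (σ p) = U p.1 ^ 2
  orth : ∀ p ∈ J ×ˢ T, h p * ((fderiv ℝ σ p (1, 0)).1 * A.coeffB g 0 2 (σ p)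
    + (fderiv ℝ σ p (1, 0)).2 * A.coeffB g 1 2 (σ p)
    + fderiv ℝ H p (1, 0) * A.coeffB g 2 2 (σ p)) = 0
  speed : ∀ p ∈ J ×ˢ T, h p ≠ 0 → A.quotSq g (σ p) (fderiv ℝ σ p (1, 0)) = 1

theorem fderiv_proj_comp {F : Type*} [NormedAddCommGroup F] [NormedSpace ℝ F] {f : F → N} {x : F}
    (hf : MDifferentiableAt 𝓘(ℝ, F) (𝓡 3) f x) (hx : f x ∈ A.chart.source) (u : F) :
    fderiv ℝ (fun y => A.proj (f y)) x u
      = planeCLM (A.comps (f x) (mfderiv 𝓘(ℝ, F) (𝓡 3) f x u)) := by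
  rw [(hasFDerivAt_proj_comp hf.hasMFDerivAt hx).fderiv]
  rfl

theorem fderiv_height_comp {F : Type*} [NormedAddCommGroup F] [NormedSpace ℝ F] {f : F → N} {x : F}
    (hf : MDifferentiableAt 𝓘(ℝ, F) (𝓡 3) f x) (hx : f x ∈ A.chart.source) (u : F) :
    fderiv ℝ (fun y => A.height (f y)) x u
      = A.comps (f x) (mfderiv 𝓘(ℝ, F) (𝓡 3) f x u) 2 := by
  rw [(hasFDerivAt_height_comp hf.hasMFDerivAt hx).fderiv]
  rfl

/-- With `ψ_t = h X`, the metric coefficients give `h² g₃₃ = U²` and `h g(ψ_s,X) = 0`. Where `h ≠ 0`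
the vector `ψ_s` is horizontal, so its unit length is the speed of the projection in the quotient
metric. -/
theorem surfaceEqs (hX : IsKilling g X) (hJ : IsOpen J) (hT : IsOpen T)
    (hψ : ContMDiffOn 𝓘(ℝ, ℝ × ℝ) (𝓡 3) ∞ ψ (J ×ˢ T)) (hmem : ∀ p ∈ J ×ˢ T, ψ p ∈ A.chart.source)
    {h : ℝ × ℝ → ℝ} (hh : ∀ p ∈ J ×ˢ T, partialT ψ p = h p • X (ψ p))
    (hmet : HasInducedMetric g U J T ψ) :
    A.SurfaceEqs g U J T (fun p => A.proj (ψ p)) (fun p => A.height (ψ p)) h := by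
  have hat : ∀ p ∈ J ×ˢ T, ContMDiffAt 𝓘(ℝ, ℝ × ℝ) (𝓡 3) ∞ ψ p := fun p hp =>
    hψ.contMDiffAt ((hJ.prod hT).mem_nhds hp)
  have hmd : ∀ p ∈ J ×ˢ T, MDifferentiableAt 𝓘(ℝ, ℝ × ℝ) (𝓡 3) ψ p := fun p hp =>
    (hat p hp).mdifferentiableAt (by simp)
  have hct : ∀ p ∈ J ×ˢ T, A.comps (ψ p) (partialT ψ p) = EuclideanSpace.single 2 (h p) := by
    intro p hp
    rw [hh p hp, map_smul, comps_field (hmem p hp)]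
    ext i
    fin_cases i <;> simp
  have hXX : ∀ p ∈ J ×ˢ T, g.inner (ψ p) (X (ψ p)) (X (ψ p))
      = A.coeffB g 2 2 (A.proj (ψ p)) := by
    intro p hp
    rw [inner_field hX (hmem p hp), comps_field (hmem p hp)]
    simp
  have horth : ∀ p ∈ J ×ˢ T, h p * g.inner (ψ p) (partialS ψ p) (X (ψ p)) = 0 := by
    intro p hp
    have h1 := (hmet p.1 hp.1 p.2 hp.2).2.1
    rw [Prod.mk.eta, hh p hp, map_smul, smul_eq_mul] at h1
    exact h1
  have hS : ∀ p ∈ J ×ˢ T, g.inner (ψ p) (partialS ψ p) (X (ψ p))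
      = (fderiv ℝ (fun p => A.proj (ψ p)) p (1, 0)).1 * A.coeffB g 0 2 (A.proj (ψ p))
        + (fderiv ℝ (fun p => A.proj (ψ p)) p (1, 0)).2 * A.coeffB g 1 2 (A.proj (ψ p))
        + fderiv ℝ (fun p => A.height (ψ p)) p (1, 0) * A.coeffB g 2 2 (A.proj (ψ p)) := by
    intro p hp
    rw [inner_field hX (hmem p hp), fderiv_proj_comp (hmd p hp) (hmem p hp),
      fderiv_height_comp (hmd p hp) (hmem p hp), Fin.sum_univ_three]
    rfl
  refine ⟨fun p hp => contDiffAt_proj_comp (hat p hp) (hmem p hp),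
    fun p hp => contDiffAt_height_comp (hat p hp) (hmem p hp), fun p hp => proj_mem (hmem p hp),
    ?_, ?_, ?_, ?_, ?_⟩
  · intro p hp
    rw [fderiv_proj_comp (hmd p hp) (hmem p hp)]
    refine (congrArg planeCLM (hct p hp)).trans ?_
    simp [planeCLM_apply]
  · intro p hp
    rw [fderiv_height_comp (hmd p hp) (hmem p hp)]
    refine (congrArg (fun u : E3 => u 2) (hct p hp)).trans ?_
    simp
  · intro p hp
    have h1 := (hmet p.1 hp.1 p.2 hp.2).2.2
    rw [Prod.mk.eta, hh p hp, map_smul, map_smul, smul_apply, hXX p hp] at h1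
    rw [← h1, smul_eq_mul, smul_eq_mul]
    ring
  · intro p hp
    rw [← hS p hp, horth p hp]
  · intro p hp h0
    have h1 := (hmet p.1 hp.1 p.2 hp.2).1
    have h2 := (mul_eq_zero.1 (horth p hp)).resolve_left h0
    rw [Prod.mk.eta, inner_self_eq hX (hmem p hp), h2] at h1
    rw [fderiv_proj_comp (hmd p hp) (hmem p hp)]
    change A.quotSq g (A.proj (ψ p)) (planeCLM (A.comps (ψ p) (partialS ψ p))) = 1
    simpa using h1

namespace SurfaceEqs

variable {σ : ℝ × ℝ → ℝ × ℝ} {H h : ℝ × ℝ → ℝ} (e : A.SurfaceEqs g U J T σ H h)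
include e

theorem factor_ne_zero (hU : ∀ s ∈ J, 0 < U s) {p : ℝ × ℝ} (hp : p ∈ J ×ˢ T) : h p ≠ 0 := by
  intro h0
  have h1 := e.factor p hp
  rw [h0] at h1
  have h2 := hU p.1 hp.1
  nlinarith

theorem proj_eq (hT : IsOpenInterval T) {s t t' : ℝ} (hs : s ∈ J) (ht : t ∈ T) (ht' : t' ∈ T) :
    σ (s, t) = σ (s, t') :=
  eq_of_partial_eq_zero hT
    (fun t ht => (e.smooth_proj (s, t) ⟨hs, ht⟩).differentiableAt (by simp))
    (fun t ht => e.proj_t (s, t) ⟨hs, ht⟩) ht ht'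

theorem eventually_mem (hJ : IsOpen J) (hT : IsOpen T) {p : ℝ × ℝ} (hp : p ∈ J ×ˢ T) :
    ∀ᶠ p' in 𝓝 p, p' ∈ J ×ˢ T :=
  (hJ.prod hT).eventually_mem hp

/-- Mixed partials commute: `∂_t σ_s = ∂_s σ_t = 0`. -/
theorem proj_s_eq (hJ : IsOpen J) (hT : IsOpenInterval T) {s t t' : ℝ} (hs : s ∈ J) (ht : t ∈ T)
    (ht' : t' ∈ T) : fderiv ℝ σ (s, t) (1, 0) = fderiv ℝ σ (s, t') (1, 0) := by
  refine eq_of_partial_eq_zero (f := fun p => fderiv ℝ σ p (1, 0)) hT (fun t ht =>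
    (contDiffAt_partial (e.smooth_proj (s, t) ⟨hs, ht⟩) _).differentiableAt (by simp))
    (fun t ht => ?_) ht ht'
  have hp : (s, t) ∈ J ×ˢ T := ⟨hs, ht⟩
  rw [fderiv_fderiv_apply (e.smooth_proj _ hp)]
  have h1 : (fun p => fderiv ℝ σ p (0, 1)) =ᶠ[𝓝 (s, t)] fun _ => 0 :=
    (e.eventually_mem hJ hT.1 hp).mono fun p hp => e.proj_t p hp
  rw [h1.fderiv_eq]
  simp

/-- Horizontality of `ψ_s`, solved for its third component. The right-hand side involves only `σ`
and its `s`-derivative, hence does not depend on `t`. -/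
theorem height_s_eq (hU : ∀ s ∈ J, 0 < U s) {p : ℝ × ℝ} (hp : p ∈ J ×ˢ T) :
    fderiv ℝ H p (1, 0) = -(((fderiv ℝ σ p (1, 0)).1 * A.coeffB g 0 2 (σ p)
      + (fderiv ℝ σ p (1, 0)).2 * A.coeffB g 1 2 (σ p)) / A.coeffB g 2 2 (σ p)) := by
  have h0 := (coeffB_two_two_pos g (e.mem p hp)).ne'
  have h1 := (mul_eq_zero.1 (e.orth p hp)).resolve_left (e.factor_ne_zero hU hp)
  field_simp
  linear_combination h1

/-- The factor `∂v/∂t` is locally constant. -/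
theorem fderiv_factor_eq_zero (hJ : IsOpen J) (hT : IsOpenInterval T) (hU : ∀ s ∈ J, 0 < U s)
    {p : ℝ × ℝ} (hp : p ∈ J ×ˢ T) : fderiv ℝ h p = 0 := by
  obtain ⟨s, t⟩ := p
  have hh : h =ᶠ[𝓝 (s, t)] fun p => fderiv ℝ H p (0, 1) :=
    (e.eventually_mem hJ hT.1 hp).mono fun p hp => (e.height_t p hp).symm
  have hH := e.smooth_height _ hp
  have hd : DifferentiableAt ℝ h (s, t) :=
    ((contDiffAt_partial hH (0, 1)).congr_of_eventuallyEq hh).differentiableAt (by simp)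
  -- `∂_s h = ∂_s ∂_t H = ∂_t ∂_s H`, and `∂_s H` does not depend on `t`.
  have h1 : fderiv ℝ h (s, t) (1, 0) = 0 := by
    rw [hh.fderiv_eq, fderiv_fderiv_apply hH]
    refine partial_eq_zero_of_eq (f := fun p => fderiv ℝ H p (1, 0)) hT.1 hp.2
      ((contDiffAt_partial hH _).differentiableAt (by simp)) fun t' ht' => ?_
    rw [e.height_s_eq hU (p := (s, t')) ⟨hp.1, ht'⟩, e.height_s_eq hU hp,
      e.proj_s_eq hJ hT hp.1 ht' hp.2, e.proj_eq hT hp.1 ht' hp.2]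
  -- `h² = U²/g₃₃` does not depend on `t`, so `2 h ∂_t h = 0` with `h ≠ 0`.
  have h2 : fderiv ℝ h (s, t) (0, 1) = 0 := by
    have h3 : fderiv ℝ (fun p => h p ^ 2) (s, t) (0, 1) = 0 := by
      refine partial_eq_zero_of_eq (f := fun p => h p ^ 2) hT.1 hp.2 (hd.pow 2) fun t' ht' => ?_
      have h4 := e.factor (s, t') ⟨hp.1, ht'⟩
      rw [e.proj_eq hT hp.1 ht' hp.2, ← e.factor _ hp] at h4
      exact mul_right_cancel₀ (coeffB_two_two_pos g (e.mem _ hp)).ne' h4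
    have h5 := (hd.hasFDerivAt.pow 2).fderiv
    rw [h5] at h3
    have h6 := e.factor_ne_zero hU hp
    simpa [h6] using h3
  ext
  · simpa using h1
  · simpa using h2

end SurfaceEqs

end AdaptedChart

end Surfaces

/-! ### Primitives on an open interval. -/

section Primitive

variable {J : Set ℝ} {f : ℝ → ℝ}

theorem IsOpenInterval.intervalIntegrable (hJ : IsOpenInterval J) (hf : ContinuousOn f J) {a b : ℝ}
    (ha : a ∈ J) (hb : b ∈ J) : IntervalIntegrable f MeasureTheory.volume a b :=
  (hf.mono (hJ.2.1.uIcc_subset ha hb)).intervalIntegrable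

theorem IsOpenInterval.hasDerivAt_integral (hJ : IsOpenInterval J) (hf : ContinuousOn f J) {a s : ℝ}
    (ha : a ∈ J) (hs : s ∈ J) : HasDerivAt (fun s => ∫ r in a..s, f r) (f s) s :=
  intervalIntegral.integral_hasDerivAt_right (hJ.intervalIntegrable hf ha hs)
    (hf.stronglyMeasurableAtFilter hJ.1 s hs) (hf.continuousAt (hJ.1.mem_nhds hs))

theorem IsOpenInterval.contDiffOn_integral (hJ : IsOpenInterval J) (hf : ContDiffOn ℝ ∞ f J) {a : ℝ}
    (ha : a ∈ J) : ContDiffOn ℝ ∞ (fun s => ∫ r in a..s, f r) J := by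
  rw [contDiffOn_infty_iff_deriv_of_isOpen hJ.1]
  refine ⟨fun s hs => (hJ.hasDerivAt_integral hf.continuousOn ha
    hs).differentiableAt.differentiableWithinAt, hf.congr fun s hs => ?_⟩
  exact (hJ.hasDerivAt_integral hf.continuousOn ha hs).deriv

theorem IsOpenInterval.integral_eq_sub (hJ : IsOpenInterval J) (hf : ContinuousOn f J) {K : ℝ → ℝ}
    (hK : ∀ s ∈ J, HasDerivAt K (f s) s) {a s : ℝ} (ha : a ∈ J) (hs : s ∈ J) :
    ∫ r in a..s, f r = K s - K a :=
  intervalIntegral.integral_eq_sub_of_hasDerivAt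
    (fun r hr => hK r (hJ.2.1.uIcc_subset ha hs hr)) (hJ.intervalIntegrable hf ha hs)

end Primitive

/-! ### From invariant surfaces to the parameter `m` and the profile curve. -/

section Surfaces

variable {N : Type*} [TopologicalSpace N] [ChartedSpace E3 N] [IsManifold (𝓡 3) ∞ N]

open Filter Topology

variable {X : (x : N) → TangentSpace (𝓡 3) x} {A : AdaptedChart X} {g : Metric3 N}
  {J T : Set ℝ} {U : ℝ → ℝ} {ψ : ℝ × ℝ → N} {m : ℝ}

/-- Along a surface swept out by the flow the field does not vanish. -/
theorem field_ne_zero_of_partialT (hU : ∀ s ∈ J, 0 < U s) (hmet : HasInducedMetric g U J T ψ)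
    {h : ℝ} {p : ℝ × ℝ} (hp : p ∈ J ×ˢ T) (hh : partialT ψ p = h • X (ψ p)) : X (ψ p) ≠ 0 := by
  intro h0
  have h1 := (hmet p.1 hp.1 p.2 hp.2).2.2
  rw [Prod.mk.eta, hh, h0, smul_zero, map_zero] at h1
  exact (pow_pos (hU p.1 hp.1) 2).ne h1

theorem IsOpenInterval.Ioo {a b : ℝ} (h : a < b) : IsOpenInterval (Ioo a b) :=
  ⟨isOpen_Ioo, ordConnected_Ioo, nonempty_Ioo.2 h⟩

theorem HasInducedMetric.mono {J' T' : Set ℝ} (h : HasInducedMetric g U J T ψ) (hJ : J' ⊆ J)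
    (hT : T' ⊆ T) : HasInducedMetric g U J' T' ψ :=
  fun s hs t ht => h s (hJ hs) t (hT ht)

theorem exists_Ioo_prod_subset {S : Set (ℝ × ℝ)} {p : ℝ × ℝ} (hS : S ∈ 𝓝 p) :
    ∃ a b c d : ℝ, p.1 ∈ Ioo a b ∧ p.2 ∈ Ioo c d ∧ Ioo a b ×ˢ Ioo c d ⊆ S := by
  obtain ⟨u, hu, w, hw, huw⟩ := mem_nhds_prod_iff.1 hS
  obtain ⟨a, b, hab, habu⟩ := mem_nhds_iff_exists_Ioo_subset.1 hu
  obtain ⟨c, d, hcd, hcdw⟩ := mem_nhds_iff_exists_Ioo_subset.1 hw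
  exact ⟨a, b, c, d, hab, hcd, (prod_mono habu hcdw).trans huw⟩

/-- On an invariant surface in natural parameters `∂v/∂t` is locally constant. -/
theorem fderiv_flowFactor_eq_zero [T2Space N] (hX : IsKilling g X) (hJ : IsOpen J) (hT : IsOpen T)
    (hU : ∀ s ∈ J, 0 < U s) (hψ : ContMDiffOn 𝓘(ℝ, ℝ × ℝ) (𝓡 3) ∞ ψ (J ×ˢ T))
    (hmet : HasInducedMetric g U J T ψ) {h : ℝ × ℝ → ℝ}
    (hh : ∀ p ∈ J ×ˢ T, partialT ψ p = h p • X (ψ p)) {p : ℝ × ℝ} (hp : p ∈ J ×ˢ T) :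
    fderiv ℝ h p = 0 := by
  obtain ⟨A, hA⟩ := exists_adaptedChart hX.smooth
    (field_ne_zero_of_partialT hU hmet hp (hh p hp))
  have hopen : IsOpen (J ×ˢ T ∩ ψ ⁻¹' A.chart.source) :=
    hψ.continuousOn.isOpen_inter_preimage (hJ.prod hT) A.chart.open_source
  -- The surface need not lie in one adapted chart; the claim is local, so a small rectangle mapped
  -- into a chart around `ψ p` suffices.
  obtain ⟨a, b, c, d, hab, hcd, hsub⟩ := exists_Ioo_prod_subset (hopen.mem_nhds ⟨hp, hA⟩)
  have hsub' : Ioo a b ×ˢ Ioo c d ⊆ J ×ˢ T := fun q hq => (hsub hq).1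
  have hJ' : Ioo a b ⊆ J := fun s hs => (hsub' (⟨hs, hcd⟩ : (s, p.2) ∈ Ioo a b ×ˢ Ioo c d)).1
  have hT' : Ioo c d ⊆ T := fun t ht => (hsub' (⟨hab, ht⟩ : (p.1, t) ∈ Ioo a b ×ˢ Ioo c d)).2
  have e := AdaptedChart.surfaceEqs hX isOpen_Ioo isOpen_Ioo (hψ.mono hsub')
    (fun q hq => (hsub hq).2) (fun q hq => hh q (hsub' hq)) (hmet.mono hJ' hT')
  exact e.fderiv_factor_eq_zero isOpen_Ioo (IsOpenInterval.Ioo (hcd.1.trans hcd.2))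
    (fun s hs => hU s (hJ' hs)) ⟨hab, hcd⟩

theorem IsBourSurface.partialT_eq [T2Space N] (hX : ∀ x, SmoothFieldAt X x) (hJ : IsOpen J)
    (hT : IsOpen T) (h : IsBourSurface g X U m J T ψ) {p : ℝ × ℝ} (hp : p ∈ J ×ˢ T) :
    partialT ψ p = (1 / m) • X (ψ p) := by
  obtain ⟨hψ, -, γ, v, hfl, hv⟩ := h
  rw [hfl.partialT_eq hX hJ hT hψ hp, hv p hp]

/-- Every invariant surface in natural parameters belongs to the Bour family for exactly one
parameter. -/
theorem IsNaturalSurface.existsUnique_parameter [T2Space N] (hX : IsKilling g X)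
    (hJ : IsOpenInterval J) (hT : IsOpenInterval T) (hU : ∀ s ∈ J, 0 < U s)
    (h : IsNaturalSurface g X U J T ψ) : ∃! m : ℝ, m ≠ 0 ∧ IsBourSurface g X U m J T ψ := by
  obtain ⟨hψ, hmet, γ, v, hfl⟩ := h
  have hop : IsOpen (J ×ˢ T) := hJ.1.prod hT.1
  obtain ⟨s₁, hs₁⟩ := hJ.2.2
  obtain ⟨t₁, ht₁⟩ := hT.2.2
  have hp₁ : (s₁, t₁) ∈ J ×ˢ T := ⟨hs₁, ht₁⟩
  have hpt : ∀ p ∈ J ×ˢ T, partialT ψ p = fderiv ℝ v p (0, 1) • X (ψ p) := fun p hp =>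
    hfl.partialT_eq hX.smooth hJ.1 hT.1 hψ hp
  have hX₁ := field_ne_zero_of_partialT hU hmet hp₁ (hpt _ hp₁)
  have hconst : ∀ p ∈ J ×ˢ T, fderiv ℝ v p (0, 1) = fderiv ℝ v (s₁, t₁) (0, 1) := fun p hp =>
    hop.is_const_of_fderiv_eq_zero (f := fun p => fderiv ℝ v p (0, 1))
      (hJ.2.1.isPreconnected.prod hT.2.1.isPreconnected)
      (fun q hq => ((contDiffAt_partial (hfl.2.1.contDiffAt (hop.mem_nhds hq))
        (0, 1)).differentiableAt (by simp)).differentiableWithinAt)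
      (fun q hq => fderiv_flowFactor_eq_zero hX hJ.1 hT.1 hU hψ hmet hpt hq) hp hp₁
  have hne : fderiv ℝ v (s₁, t₁) (0, 1) ≠ 0 := by
    intro h0
    have h1 := (hmet s₁ hs₁ t₁ ht₁).2.2
    rw [hpt _ hp₁, h0, zero_smul, map_zero] at h1
    exact (pow_pos (hU s₁ hs₁) 2).ne h1
  refine ⟨1 / fderiv ℝ v (s₁, t₁) (0, 1), ⟨one_div_ne_zero hne, hψ, hmet, γ, v, hfl, fun p hp => ?_⟩,
    ?_⟩
  · rw [one_div_one_div, hconst p hp]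
  · rintro m ⟨hm, hB⟩
    have h1 := hB.partialT_eq hX.smooth hJ.1 hT.1 hp₁
    rw [hpt _ hp₁] at h1
    rw [smul_left_injective ℝ hX₁ h1, one_div_one_div]

namespace AdaptedChart

variable (A) in
/-- The rate at which the third coordinate decreases along a profile curve. -/
noncomputable def heightRate (g : Metric3 N) (U : ℝ → ℝ) (m : ℝ) (σ : ℝ → ℝ × ℝ) (r : ℝ) : ℝ :=
  ((deriv σ r).1 * A.coeffB g 0 2 (σ r) + (deriv σ r).2 * A.coeffB g 1 2 (σ r))
    / (m ^ 2 * U r ^ 2)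

theorem contDiffOn_heightRate {σ : ℝ → ℝ × ℝ} (hJ : IsOpen J) (hUs : ContDiffOn ℝ ∞ U J)
    (hU : ∀ s ∈ J, 0 < U s) (hm : m ≠ 0) (hσ : ContDiffOn ℝ ∞ σ J) (hmem : ∀ s ∈ J, σ s ∈ A.base) :
    ContDiffOn ℝ ∞ (A.heightRate g U m σ) J := by
  have hd : ContDiffOn ℝ ∞ (deriv σ) J := hσ.deriv_of_isOpen hJ (by simp)
  have hc : ∀ i, ContDiffOn ℝ ∞ (fun r => A.coeffB g i 2 (σ r)) J := fun i =>
    (contDiffOn_coeffB g i 2).comp hσ hmem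
  refine ContDiffOn.div ((hd.fst.mul (hc 0)).add (hd.snd.mul (hc 1)))
    (contDiffOn_const.mul (hUs.pow 2)) fun s hs => ?_
  have := (hU s hs).ne'
  positivity

theorem IsProfile.coeffB_two_two {σ : ℝ → ℝ × ℝ} (h : A.IsProfile g U m J σ) {s : ℝ} (hs : s ∈ J) :
    A.coeffB g 2 2 (σ s) = m ^ 2 * U s ^ 2 := by
  rw [← volumeB_sq g (h.2 s hs).1, (h.2 s hs).2.1, mul_pow, sq_abs]

/-- Surfaces of the Bour family in adapted coordinates: the profile curve and the third
coordinate. -/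
theorem _root_.IsBourSurface.exists_profile [T2Space N] (hX : IsKilling g X) (hJ : IsOpenInterval J)
    (hT : IsOpenInterval T) (hUs : ContDiffOn ℝ ∞ U J) (hU : ∀ s ∈ J, 0 < U s) (hm : m ≠ 0)
    (h : IsBourSurface g X U m J T ψ) (hmem : ∀ p ∈ J ×ˢ T, ψ p ∈ A.chart.source) {s₀ : ℝ}
    (hs₀ : s₀ ∈ J) :
    ∃ (σ : ℝ → ℝ × ℝ) (c : ℝ), A.IsProfile g U m J σ ∧ ∀ s ∈ J, ∀ t ∈ T,
      A.thirdCoord g U m σ s₀ c s t ∈ A.fib ∧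
        ψ (s, t) = A.pt (σ s) (A.thirdCoord g U m σ s₀ c s t) := by
  have e := surfaceEqs hX hJ.1 hT.1 h.1 hmem (h := fun _ => 1 / m)
    (fun p hp => h.partialT_eq hX.smooth hJ.1 hT.1 hp) h.2.1
  set σ : ℝ × ℝ → ℝ × ℝ := fun p => A.proj (ψ p) with hσdef
  set H : ℝ × ℝ → ℝ := fun p => A.height (ψ p) with hHdef
  obtain ⟨t₀, ht₀⟩ := hT.2.2
  have hσs : ContDiffOn ℝ ∞ (fun s => σ (s, t₀)) J := fun s hs =>
    ((e.smooth_proj (s, t₀) ⟨hs, ht₀⟩).comp s (contDiffAt_id.prodMk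
      contDiffAt_const)).contDiffWithinAt
  have hσd : ∀ s ∈ J, deriv (fun s => σ (s, t₀)) s = fderiv ℝ σ (s, t₀) (1, 0) := fun s hs =>
    (hasDerivAt_slice_fst ((e.smooth_proj (s, t₀) ⟨hs, ht₀⟩).differentiableAt (by simp))).deriv
  have h22 : ∀ s ∈ J, A.coeffB g 2 2 (σ (s, t₀)) = m ^ 2 * U s ^ 2 := by
    intro s hs
    have h1 := e.factor (s, t₀) ⟨hs, ht₀⟩
    rw [← h1]
    field_simp
  have hprof : A.IsProfile g U m J fun s => σ (s, t₀) := by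
    refine ⟨hσs, fun s hs => ⟨e.mem _ ⟨hs, ht₀⟩, ?_, ?_⟩⟩
    · have h1 := volumeB_sq g (e.mem (s, t₀) ⟨hs, ht₀⟩)
      rw [h22 s hs, ← sq_abs m, ← mul_pow] at h1
      exact (pow_left_inj₀ (volumeB_pos g (e.mem _ ⟨hs, ht₀⟩)).le
        (mul_nonneg (abs_nonneg m) (hU s hs).le) two_ne_zero).1 h1
    · rw [hσd s hs]
      exact e.speed _ ⟨hs, ht₀⟩ (one_div_ne_zero hm)
  have hrate := contDiffOn_heightRate (g := g) hJ.1 hUs hU hm hσs fun s hs => (hprof.2 s hs).1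
  -- The factor equation with `h = 1/m` gives `g₃₃ = m² U²` along the curve, so horizontality makes
  -- `-H` a primitive of `heightRate`.
  have hK : ∀ s ∈ J, HasDerivAt (fun s => -H (s, t₀))
      (A.heightRate g U m (fun s => σ (s, t₀)) s) s := by
    intro s hs
    have hp : (s, t₀) ∈ J ×ˢ T := ⟨hs, ht₀⟩
    have h1 := (hasDerivAt_slice_fst ((e.smooth_height _ hp).differentiableAt (by simp))).neg
    rw [e.height_s_eq hU hp, neg_neg, ← hσd s hs, h22 s hs] at h1
    exact h1
  -- `H - t/m` is independent of `t` because `H_t = 1/m`; the constant of integration is its value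
  -- at `(s₀, t₀)`.
  have hthird : ∀ s ∈ J, ∀ t ∈ T,
      A.thirdCoord g U m (fun s => σ (s, t₀)) s₀ (H (s₀, t₀) - t₀ / m) s t = H (s, t) := by
    intro s hs t ht
    have h1 := hJ.integral_eq_sub hrate.continuousOn hK hs₀ hs
    have h2 : H (s, t) - t * m⁻¹ = H (s, t₀) - t₀ * m⁻¹ := by
      refine eq_of_partial_eq_zero (f := fun p => H p - p.2 * m⁻¹) hT (fun t ht => ?_)
        (fun t ht => ?_) ht ht₀
      · exact ((e.smooth_height (s, t) ⟨hs, ht⟩).differentiableAt (by simp)).sub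
          (differentiableAt_snd.mul_const m⁻¹)
      · have h3 := ((e.smooth_height (s, t) ⟨hs, ht⟩).differentiableAt (by simp)).hasFDerivAt.sub
          (hasFDerivAt_snd.mul_const m⁻¹)
        have h4 := e.height_t (s, t) ⟨hs, ht⟩
        refine (congrArg (fun L : ℝ × ℝ →L[ℝ] ℝ => L (0, 1)) h3.fderiv).trans ?_
        simp [h4]
    change H (s₀, t₀) - t₀ / m + t / m
      - ∫ r in s₀..s, A.heightRate g U m (fun s => σ (s, t₀)) r = H (s, t)
    rw [h1, div_eq_mul_inv, div_eq_mul_inv]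
    linarith
  refine ⟨fun s => σ (s, t₀), H (s₀, t₀) - t₀ / m, hprof, fun s hs t ht => ?_⟩
  have hp : (s, t) ∈ J ×ˢ T := ⟨hs, ht⟩
  rw [hthird s hs t ht]
  beta_reduce
  rw [e.proj_eq hT hs ht₀ ht]
  exact ⟨height_mem (hmem _ hp), (pt_proj_height (hmem _ hp)).symm⟩

end AdaptedChart

end Surfaces

/-! ### From profile curves to surfaces, and independence of the lift. -/

section Surfaces

variable {N : Type*} [TopologicalSpace N] [ChartedSpace E3 N] [IsManifold (𝓡 3) ∞ N]

open Filter Topology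

variable {X : (x : N) → TangentSpace (𝓡 3) x} {A : AdaptedChart X} {g : Metric3 N}
  {J T : Set ℝ} {U : ℝ → ℝ} {ψ : ℝ × ℝ → N} {m : ℝ}

namespace AdaptedChart

theorem inner_field_eq (hX : IsKilling g X) {q : N} (hq : q ∈ A.chart.source)
    (w : TangentSpace (𝓡 3) q) :
    g.inner q w (X q) = (planeCLM (A.comps q w)).1 * A.coeffB g 0 2 (A.proj q)
      + (planeCLM (A.comps q w)).2 * A.coeffB g 1 2 (A.proj q)
      + A.comps q w 2 * A.coeffB g 2 2 (A.proj q) := by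
  rw [inner_field hX hq, Fin.sum_univ_three]
  rfl

theorem hasFDerivAt_thirdCoord {σ : ℝ → ℝ × ℝ} (hJ : IsOpenInterval J)
    (hrate : ContDiffOn ℝ ∞ (A.heightRate g U m σ) J) {s₀ c : ℝ} (hs₀ : s₀ ∈ J) {p : ℝ × ℝ}
    (hp : p.1 ∈ J) :
    HasFDerivAt (fun p : ℝ × ℝ => A.thirdCoord g U m σ s₀ c p.1 p.2)
      (m⁻¹ • ContinuousLinearMap.snd ℝ ℝ ℝ
        - A.heightRate g U m σ p.1 • ContinuousLinearMap.fst ℝ ℝ ℝ) p := by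
  have h1 := (hJ.hasDerivAt_integral hrate.continuousOn hs₀ hp).comp_hasFDerivAt p
    (hasFDerivAt_fst (𝕜 := ℝ) (E := ℝ) (F := ℝ) (p := p))
  have h2 := ((hasFDerivAt_snd (𝕜 := ℝ) (p := p)).mul_const m⁻¹).const_add c
  exact h2.sub h1

theorem contDiffAt_thirdCoord {σ : ℝ → ℝ × ℝ} (hJ : IsOpenInterval J)
    (hrate : ContDiffOn ℝ ∞ (A.heightRate g U m σ) J) {s₀ c : ℝ} (hs₀ : s₀ ∈ J) {p : ℝ × ℝ}
    (hp : p.1 ∈ J) :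
    ContDiffAt ℝ ∞ (fun p : ℝ × ℝ => A.thirdCoord g U m σ s₀ c p.1 p.2) p := by
  have h1 := ((hJ.contDiffOn_integral hrate hs₀).contDiffAt (hJ.1.mem_nhds hp)).comp p
    contDiffAt_fst
  exact (contDiffAt_const.add (contDiffAt_snd.div_const m)).sub h1

/-- A profile curve and the explicit third coordinate give a surface of the Bour family. -/
theorem IsProfile.isBourSurface (hX : IsKilling g X) (hJ : IsOpenInterval J)
    (hT : IsOpenInterval T) (hUs : ContDiffOn ℝ ∞ U J) (hU : ∀ s ∈ J, 0 < U s) (hm : m ≠ 0)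
    {σ : ℝ → ℝ × ℝ} {s₀ c : ℝ} (hσ : A.IsProfile g U m J σ) (hs₀ : s₀ ∈ J)
    (h : ∀ s ∈ J, ∀ t ∈ T, A.thirdCoord g U m σ s₀ c s t ∈ A.fib ∧
      ψ (s, t) = A.pt (σ s) (A.thirdCoord g U m σ s₀ c s t)) :
    IsBourSurface g X U m J T ψ ∧ ∀ p ∈ J ×ˢ T, ψ p ∈ A.chart.source := by
  have hop : IsOpen (J ×ˢ T) := hJ.1.prod hT.1
  have hrate := contDiffOn_heightRate (g := g) hJ.1 hUs hU hm hσ.1 fun s hs => (hσ.2 s hs).1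
  set Z : ℝ × ℝ → ℝ := fun p => A.thirdCoord g U m σ s₀ c p.1 p.2 with hZ
  have hfib : ∀ p ∈ J ×ˢ T, Z p ∈ A.fib := fun p hp => (h p.1 hp.1 p.2 hp.2).1
  have hbase : ∀ p ∈ J ×ˢ T, σ p.1 ∈ A.base := fun p hp => (hσ.2 p.1 hp.1).1
  have hψ : ∀ p ∈ J ×ˢ T, ψ p = A.pt (σ p.1) (Z p) := fun p hp => (h p.1 hp.1 p.2 hp.2).2
  have hsrc : ∀ p ∈ J ×ˢ T, ψ p ∈ A.chart.source := fun p hp =>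
    hψ p hp ▸ pt_mem (hbase p hp) (hfib p hp)
  have hproj : ∀ p ∈ J ×ˢ T, A.proj (ψ p) = σ p.1 := fun p hp => by
    rw [hψ p hp, proj_pt (hbase p hp) (hfib p hp)]
  have hheight : ∀ p ∈ J ×ˢ T, A.height (ψ p) = Z p := fun p hp => by
    rw [hψ p hp, height_pt (hbase p hp) (hfib p hp)]
  have hsm : ∀ p ∈ J ×ˢ T, ContMDiffAt 𝓘(ℝ, ℝ × ℝ) (𝓡 3) ∞ ψ p := fun p hp =>
    (contMDiffAt_pt_comp ((hσ.1.contDiffAt (hJ.1.mem_nhds hp.1)).comp p contDiffAt_fst)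
      (contDiffAt_thirdCoord hJ hrate hs₀ hp.1) (hbase p hp) (hfib p hp)).congr_of_eventuallyEq
      ((hop.eventually_mem hp).mono hψ)
  have hmd : ∀ p ∈ J ×ˢ T, MDifferentiableAt 𝓘(ℝ, ℝ × ℝ) (𝓡 3) ψ p := fun p hp =>
    (hsm p hp).mdifferentiableAt (by simp)
  have hplane : ∀ p ∈ J ×ˢ T, ∀ u : ℝ × ℝ,
      planeCLM (A.comps (ψ p) (mfderiv 𝓘(ℝ, ℝ × ℝ) (𝓡 3) ψ p u)) = u.1 • deriv σ p.1 := by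
    intro p hp u
    rw [← fderiv_proj_comp (hmd p hp) (hsrc p hp),
      EventuallyEq.fderiv_eq (f := fun p => σ p.1) ((hop.eventually_mem hp).mono hproj)]
    have h1 := ((hσ.1.contDiffAt (hJ.1.mem_nhds hp.1)).differentiableAt
      (by simp)).hasDerivAt.hasFDerivAt.comp p hasFDerivAt_fst
    exact congrArg (fun L : ℝ × ℝ →L[ℝ] ℝ × ℝ => L u) h1.fderiv
  have hthird : ∀ p ∈ J ×ˢ T, ∀ u : ℝ × ℝ,
      A.comps (ψ p) (mfderiv 𝓘(ℝ, ℝ × ℝ) (𝓡 3) ψ p u) 2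
        = m⁻¹ * u.2 - A.heightRate g U m σ p.1 * u.1 := by
    intro p hp u
    rw [← fderiv_height_comp (hmd p hp) (hsrc p hp),
      EventuallyEq.fderiv_eq (f := Z) ((hop.eventually_mem hp).mono hheight),
      (hasFDerivAt_thirdCoord hJ hrate hs₀ hp.1).fderiv]
    rfl
  have hT' : ∀ p ∈ J ×ˢ T, partialT ψ p = m⁻¹ • X (ψ p) := by
    intro p hp
    refine comps_injective (hsrc p hp) ?_
    rw [map_smul, comps_field (hsrc p hp), partialT]
    have h1 := hplane p hp (0, 1)
    have h2 := hthird p hp (0, 1)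
    rw [zero_smul, planeCLM_apply] at h1
    ext i
    fin_cases i
    · simpa using congrArg Prod.fst h1
    · simpa using congrArg Prod.snd h1
    · simpa using h2
  have h22 : ∀ p ∈ J ×ˢ T, A.coeffB g 2 2 (σ p.1) = m ^ 2 * U p.1 ^ 2 := fun p hp =>
    hσ.coeffB_two_two hp.1
  -- The integrand of the third coordinate is exactly the rate that cancels `x₁' g₁₃ + x₂' g₂₃`,
  -- given `g₃₃ = m² U²`.
  have hSX : ∀ p ∈ J ×ˢ T, g.inner (ψ p) (partialS ψ p) (X (ψ p)) = 0 := by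
    intro p hp
    have h1 := hplane p hp (1, 0)
    have h2 := hthird p hp (1, 0)
    rw [partialS, inner_field_eq hX (hsrc p hp), h1, h2, hproj p hp, h22 p hp, heightRate]
    have := (hU p.1 hp.1).ne'
    simp only [one_smul]
    field_simp
    ring
  have hSS : ∀ p ∈ J ×ˢ T, g.inner (ψ p) (partialS ψ p) (partialS ψ p) = 1 := by
    intro p hp
    have h1 := hplane p hp (1, 0)
    rw [one_smul] at h1
    rw [inner_self_eq hX (hsrc p hp), hSX p hp, partialS, h1, hproj p hp, (hσ.2 p.1 hp.1).2.2]
    simp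
  have hXX : ∀ p ∈ J ×ˢ T, g.inner (ψ p) (X (ψ p)) (X (ψ p)) = m ^ 2 * U p.1 ^ 2 := by
    intro p hp
    rw [inner_field hX (hsrc p hp), comps_field (hsrc p hp), ← h22 p hp, hproj p hp]
    simp
  refine ⟨⟨fun p hp => (hsm p hp).contMDiffWithinAt, ?_, ?_⟩, hsrc⟩
  · intro s hs t ht
    have hp : (s, t) ∈ J ×ˢ T := ⟨hs, ht⟩
    refine ⟨hSS _ hp, ?_, ?_⟩
    · rw [hT' _ hp, map_smul, hSX _ hp, smul_zero]
    · rw [hT' _ hp, map_smul, map_smul, smul_apply, hXX _ hp, smul_eq_mul, smul_eq_mul]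
      field_simp
  · obtain ⟨t₁, ht₁⟩ := hT.2.2
    -- Taking the slice `t = t₁` as the generating curve keeps both ends of every flow line at
    -- heights in `A.fib`, so that the flow can be followed inside the chart.
    refine ⟨fun s => ψ (s, t₁), fun p => (p.2 - t₁) * m⁻¹, ⟨?_, ?_, ?_⟩, ?_⟩
    · intro s hs
      exact ((hsm (s, t₁) ⟨hs, ht₁⟩).comp s
        (contDiffAt_id.prodMk contDiffAt_const).contMDiffAt).contMDiffWithinAt
    · exact ((contDiff_snd.sub contDiff_const).mul contDiff_const).contDiffOn
    · intro s hs t ht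
      refine FlowsTo.mono (subset_univ A.chart.source) ((flowsTo_iff (hsrc _ ⟨hs, ht₁⟩) _ _).2 ?_)
      have h1 : A.height (ψ (s, t₁)) + (t - t₁) * m⁻¹ = Z (s, t) := by
        rw [hheight _ ⟨hs, ht₁⟩]
        simp only [hZ, thirdCoord]
        ring
      rw [h1, hproj _ ⟨hs, ht₁⟩]
      exact ⟨hfib _ ⟨hs, ht⟩, hψ _ ⟨hs, ht⟩⟩
    · intro p hp
      have h1 := (((hasFDerivAt_snd (𝕜 := ℝ) (p := p)).sub_const t₁).mul_const m⁻¹).fderiv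
      rw [h1]
      simp

/-- The third coordinate does not depend on the lift of the profile curve. -/
theorem IsProfile.lift_independence (hX : IsKilling g X) (hJ : IsOpenInterval J)
    (hUs : ContDiffOn ℝ ∞ U J) (hU : ∀ s ∈ J, 0 < U s) (hm : m ≠ 0)
    {σ : ℝ → ℝ × ℝ} {γ : ℝ → N} {s₀ : ℝ} (hs₀ : s₀ ∈ J) (hσ : A.IsProfile g U m J σ)
    (hγ : ContMDiffOn 𝓘(ℝ, ℝ) (𝓡 3) ∞ γ J)
    (hlift : ∀ s ∈ J, γ s ∈ A.chart.source ∧ A.proj (γ s) = σ s) (a : ℝ) {s : ℝ} (hs : s ∈ J)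
    (t : ℝ) :
    A.height (γ s) + (a + t / m - ∫ r in s₀..s,
        g.inner (γ r) (X (γ r)) (velocity γ r) / (m ^ 2 * U r ^ 2))
      = A.thirdCoord g U m σ s₀ (a + A.height (γ s₀)) s t := by
  have hrate := contDiffOn_heightRate (g := g) hJ.1 hUs hU hm hσ.1 fun s hs => (hσ.2 s hs).1
  have hat : ∀ s ∈ J, ContMDiffAt 𝓘(ℝ, ℝ) (𝓡 3) ∞ γ s := fun s hs =>
    hγ.contMDiffAt (hJ.1.mem_nhds hs)
  have hmd : ∀ s ∈ J, MDifferentiableAt 𝓘(ℝ, ℝ) (𝓡 3) γ s := fun s hs =>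
    (hat s hs).mdifferentiableAt (by simp)
  have hH : ContDiffOn ℝ ∞ (fun s => A.height (γ s)) J := fun s hs =>
    (contDiffAt_height_comp (hat s hs) (hlift s hs).1).contDiffWithinAt
  -- As `g₃₃ = m² U²` along the curve, `g(X,γ')/(m² U²)` is `heightRate` plus `x₃'`. Integration of
  -- the last term cancels the height of the lift up to its value at `s₀`.
  have hint : ∀ s ∈ J, g.inner (γ s) (X (γ s)) (velocity γ s) / (m ^ 2 * U s ^ 2)
      = A.heightRate g U m σ s + deriv (fun s => A.height (γ s)) s := by
    intro s hs
    have hplane : planeCLM (A.comps (γ s) (velocity γ s)) = deriv σ s := by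
      have h1 := fderiv_proj_comp (hmd s hs) (hlift s hs).1 1
      rw [EventuallyEq.fderiv_eq (f := σ)
        ((hJ.1.eventually_mem hs).mono fun s hs => (hlift s hs).2)] at h1
      exact h1.symm
    have h2 : A.comps (γ s) (velocity γ s) 2 = deriv (fun s => A.height (γ s)) s :=
      (fderiv_height_comp (hmd s hs) (hlift s hs).1 1).symm
    have h3 : g.inner (γ s) (X (γ s)) (velocity γ s) = g.inner (γ s) (velocity γ s) (X (γ s)) :=
      g.symm _ _ _
    rw [h3, inner_field_eq hX (hlift s hs).1, hplane, h2, (hlift s hs).2, hσ.coeffB_two_two hs,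
      heightRate]
    have := (hU s hs).ne'
    field_simp
  have hK : ∀ s ∈ J, HasDerivAt (fun s => (∫ r in s₀..s, A.heightRate g U m σ r) + A.height (γ s))
      (g.inner (γ s) (X (γ s)) (velocity γ s) / (m ^ 2 * U s ^ 2)) s := by
    intro s hs
    rw [hint s hs]
    exact (hJ.hasDerivAt_integral hrate.continuousOn hs₀ hs).add
      ((hH.contDiffAt (hJ.1.mem_nhds hs)).differentiableAt (by simp)).hasDerivAt
  have hcont : ContinuousOn
      (fun r => g.inner (γ r) (X (γ r)) (velocity γ r) / (m ^ 2 * U r ^ 2)) J :=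
    (hrate.continuousOn.add ((hH.deriv_of_isOpen (m := ∞) hJ.1 (by simp)).continuousOn)).congr hint
  rw [hJ.integral_eq_sub hcont hK hs₀ hs, intervalIntegral.integral_same]
  change _ = a + A.height (γ s₀) + t / m - ∫ r in s₀..s, A.heightRate g U m σ r
  ring

end AdaptedChart

end Surfaces

/-! ### Local existence and uniqueness for a scalar differential equation. -/

section ScalarODE

open Filter Topology

variable {W : Set (ℝ × ℝ)} {F : ℝ × ℝ → ℝ}

/-- Local solutions of `x' = F(s,x)`. -/
theorem exists_scalar_solution (hW : IsOpen W) (hF : ContDiffOn ℝ ∞ F W) {s₀ x₀ : ℝ}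
    (h₀ : (s₀, x₀) ∈ W) :
    ∃ δ > 0, ∃ x : ℝ → ℝ, ContDiffOn ℝ ∞ x (Ioo (s₀ - δ) (s₀ + δ)) ∧ x s₀ = x₀ ∧
      ∀ s ∈ Ioo (s₀ - δ) (s₀ + δ), (s, x s) ∈ W ∧ HasDerivAt x (F (s, x s)) s := by
  -- The equation becomes autonomous in the plane with field `(1, F)`; the first component of its
  -- flow is `s₀ + r`, and the second, reparametrized by `s`, is the solution.
  obtain ⟨δ, hδ, φ, hφ, hφ0, hφ'⟩ := exists_local_flow (v := fun p => ((1 : ℝ), F p)) hW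
    (contDiffOn_const.prodMk hF) h₀
  have hmem : ((s₀, x₀) : ℝ × ℝ) ∈ Metric.ball (s₀, x₀) δ := Metric.mem_ball_self hδ
  have h0 : (0 : ℝ) ∈ Ioo (-δ) δ := ⟨by linarith, hδ⟩
  have hd := hφ' _ hmem
  have hfst : ∀ r ∈ Ioo (-δ) δ, HasDerivAt (fun r => (φ ((s₀, x₀), r)).1) 1 r := fun r hr =>
    (hasFDerivAt_fst (𝕜 := ℝ) (E := ℝ) (F := ℝ)).comp_hasDerivAt r (hd r hr).2
  have hsnd : ∀ r ∈ Ioo (-δ) δ,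
      HasDerivAt (fun r => (φ ((s₀, x₀), r)).2) (F (φ ((s₀, x₀), r))) r := fun r hr =>
    (hasFDerivAt_snd (𝕜 := ℝ) (E := ℝ) (F := ℝ)).comp_hasDerivAt r (hd r hr).2
  have htime : ∀ r ∈ Ioo (-δ) δ, (φ ((s₀, x₀), r)).1 = s₀ + r := by
    intro r hr
    have h1 := isOpen_Ioo.is_const_of_deriv_eq_zero
      (f := fun r => (φ ((s₀, x₀), r)).1 - r) isPreconnected_Ioo
      (fun r hr => ((hfst r hr).sub (hasDerivAt_id r)).differentiableAt.differentiableWithinAt)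
      (fun r hr => ((hfst r hr).sub (hasDerivAt_id r)).deriv.trans (sub_self 1)) hr h0
    simp only [hφ0 _ hmem] at h1
    linarith
  have hsub : ∀ s ∈ Ioo (s₀ - δ) (s₀ + δ), s - s₀ ∈ Ioo (-δ) δ := fun s hs =>
    ⟨by linarith [hs.1], by linarith [hs.2]⟩
  have hpt : ∀ s ∈ Ioo (s₀ - δ) (s₀ + δ),
      φ ((s₀, x₀), s - s₀) = (s, (φ ((s₀, x₀), s - s₀)).2) := fun s hs =>
    Prod.ext ((htime _ (hsub s hs)).trans (by ring)) rfl
  refine ⟨δ, hδ, fun s => (φ ((s₀, x₀), s - s₀)).2, ?_, by simp [hφ0 _ hmem], fun s hs => ⟨?_, ?_⟩⟩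
  · exact (hφ.comp (contDiff_const.prodMk (contDiff_id.sub contDiff_const)).contDiffOn
      fun s hs => ⟨hmem, hsub s hs⟩).snd
  · rw [← hpt s hs]
    exact (hd _ (hsub s hs)).1
  · rw [← hpt s hs]
    exact (hsnd _ (hsub s hs)).comp_sub_const s s₀

/-- Solutions of `x' = F(s,x)` on an interval are determined by one value. -/
theorem scalar_solution_unique (hW : IsOpen W) (hF : ContDiffOn ℝ ∞ F W) {J : Set ℝ}
    (hJ : IsOpenInterval J) {x₁ x₂ : ℝ → ℝ}
    (h₁ : ∀ s ∈ J, (s, x₁ s) ∈ W ∧ HasDerivAt x₁ (F (s, x₁ s)) s)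
    (h₂ : ∀ s ∈ J, (s, x₂ s) ∈ W ∧ HasDerivAt x₂ (F (s, x₂ s)) s) {s₀ : ℝ} (hs₀ : s₀ ∈ J)
    (h0 : x₁ s₀ = x₂ s₀) : EqOn x₁ x₂ J := by
  -- `F` is only locally Lipschitz, so uniqueness is first obtained near each parameter where the
  -- two solutions meet.
  have hloc : ∀ s ∈ J, x₁ s = x₂ s → x₁ =ᶠ[𝓝 s] x₂ := by
    intro s hs heq
    have hFs : ContDiffAt ℝ 1 F (s, x₁ s) := (hF.contDiffAt (hW.mem_nhds (h₁ s hs).1)).of_le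
      (WithTop.coe_le_coe.2 (le_top : (1 : ℕ∞) ≤ ⊤))
    obtain ⟨K, S, hS, hK⟩ := hFs.exists_lipschitzOnWith
    obtain ⟨a, b, c, d, hab, hcd, hsub⟩ := exists_Ioo_prod_subset hS
    have hin : ∀ x : ℝ → ℝ, (∀ s ∈ J, (s, x s) ∈ W ∧ HasDerivAt x (F (s, x s)) s) →
        x s ∈ Ioo c d → ∀ᶠ r in 𝓝 s, HasDerivAt x (F (r, x r)) r ∧ x r ∈ Ioo c d := by
      intro x hx hxs
      filter_upwards [hJ.1.mem_nhds hs,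
        (hx s hs).2.continuousAt (isOpen_Ioo.mem_nhds hxs)] with r hr hr'
      exact ⟨(hx r hr).2, hr'⟩
    refine ODE_solution_unique_of_eventually (v := fun r x => F (r, x)) (s := fun _ => Ioo c d)
      (K := K) ?_ (hin x₁ h₁ hcd) (hin x₂ h₂ (heq ▸ hcd)) heq
    filter_upwards [isOpen_Ioo.mem_nhds hab] with r hr x hx y hy
    have h3 := hK (hsub (⟨hr, hx⟩ : (r, x) ∈ Ioo a b ×ˢ Ioo c d))
      (hsub (⟨hr, hy⟩ : (r, y) ∈ Ioo a b ×ˢ Ioo c d))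
    simpa [Prod.edist_eq] using h3
  -- The parameters near which the solutions agree form an open set. It is closed in `J` by
  -- continuity and `hloc`, hence contains the connected `J`.
  have hsubset : J ⊆ {s | x₁ =ᶠ[𝓝 s] x₂} := by
    refine hJ.2.1.isPreconnected.subset_of_closure_inter_subset isOpen_setOfPred_eventually_nhds
      ⟨s₀, hs₀, hloc s₀ hs₀ h0⟩ ?_
    rintro s ⟨hsc, hs⟩
    refine hloc s hs ?_
    have hcont : ContinuousAt (fun s => x₁ s - x₂ s) s :=
      (h₁ s hs).2.continuousAt.sub (h₂ s hs).2.continuousAt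
    have hzero : (fun s => x₁ s - x₂ s) '' {s | x₁ =ᶠ[𝓝 s] x₂} ⊆ {0} := by
      rintro _ ⟨r, hr, rfl⟩
      exact sub_eq_zero.2 (EventuallyEq.eq_of_nhds hr)
    have hmem := closure_mono hzero (mem_closure_image hcont hsc)
    rw [closure_singleton] at hmem
    exact sub_eq_zero.1 hmem
  exact fun s hs => (hsubset hs).self_of_nhds

end ScalarODE

/-- Clearing denominators turns the left side into `b² (a² - u²) = (a d)²`. This forces `u² ≤ a²`,
and taking square roots introduces the sign `ε`. -/
theorem unit_speed_iff {a b u d : ℝ} (ha : 0 < a) (hb : 0 < b) :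
    u ^ 2 / a ^ 2 + d ^ 2 / b ^ 2 = 1 ↔
      ∃ ε : ℝ, (ε = 1 ∨ ε = -1) ∧ u ^ 2 ≤ a ^ 2 ∧
        b * Real.sqrt (a ^ 2 - u ^ 2) + ε * a * d = 0 := by
  have hkey : u ^ 2 / a ^ 2 + d ^ 2 / b ^ 2 = 1 ↔ b ^ 2 * (a ^ 2 - u ^ 2) = (a * d) ^ 2 := by
    rw [div_add_div _ _ (by positivity) (by positivity), div_eq_one_iff_eq (by positivity)]
    constructor <;> intro h <;> linear_combination -h
  rw [hkey]
  constructor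
  · intro h
    have hle : 0 ≤ a ^ 2 - u ^ 2 := by
      by_contra! hlt
      nlinarith [mul_neg_of_pos_of_neg (pow_pos hb 2) hlt, sq_nonneg (a * d)]
    have h1 : (b * Real.sqrt (a ^ 2 - u ^ 2)) ^ 2 = (a * d) ^ 2 := by
      rw [mul_pow, Real.sq_sqrt hle, h]
    rcases sq_eq_sq_iff_eq_or_eq_neg.1 h1 with h2 | h2
    · exact ⟨-1, Or.inr rfl, by linarith, by rw [h2]; ring⟩
    · exact ⟨1, Or.inl rfl, by linarith, by rw [h2]; ring⟩
  · rintro ⟨ε, hε, hle, h⟩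
    have h1 : b * Real.sqrt (a ^ 2 - u ^ 2) = -(ε * a * d) := by linarith
    have h2 : ε ^ 2 = 1 := by rcases hε with rfl | rfl <;> norm_num
    have h3 : (b * Real.sqrt (a ^ 2 - u ^ 2)) ^ 2 = (a * d) ^ 2 := by
      rw [h1]
      linear_combination (a * d) ^ 2 * h2
    rwa [mul_pow, Real.sq_sqrt (by linarith)] at h3

/-! ### The differential equation of the profile curve. -/

section Profile

variable {N : Type*} [TopologicalSpace N] [ChartedSpace E3 N] [IsManifold (𝓡 3) ∞ N]

open Filter Topology

variable {X : (x : N) → TangentSpace (𝓡 3) x} {A : AdaptedChart X} {g : Metric3 N}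
  {J : Set ℝ} {U : ℝ → ℝ} {m ε : ℝ} {D : Set (ℝ × ℝ)} {θ : ℝ × ℝ → ℝ}

namespace AdaptedChart.IsOrbitCoord

variable (A g U m J D θ) in
/-- The domain where the profile equation is nondegenerate. -/
def profileDomain : Set (ℝ × ℝ) :=
  {p | p.1 ∈ J ∧ (|m| * U p.1, p.2) ∈ A.orbitMap g θ '' D ∧
    m ^ 2 * deriv U p.1 ^ 2
      < A.normGradVolume g (A.orbitInv g D θ (|m| * U p.1, p.2)) ^ 2}

variable (A g U m D θ ε) in
/-- The right-hand side of the profile equation solved for `ϑ'`. -/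
noncomputable def profileSlope (p : ℝ × ℝ) : ℝ :=
  -(ε * (A.normGradTheta g θ (A.orbitInv g D θ (|m| * U p.1, p.2))
    * Real.sqrt (A.normGradVolume g (A.orbitInv g D θ (|m| * U p.1, p.2)) ^ 2
      - m ^ 2 * deriv U p.1 ^ 2)
    / A.normGradVolume g (A.orbitInv g D θ (|m| * U p.1, p.2))))

variable (h : A.IsOrbitCoord g D θ)
include h

/-- A curve in `D` with `ω = |m| U` has unit speed if and only if its coordinate `θ` solves the
profile equation. -/
theorem quotSq_deriv_eq_one_iff (hX : IsKilling g X) (hJ : IsOpen J) (hUs : ContDiffOn ℝ ∞ U J)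
    {σ : ℝ → ℝ × ℝ} {ϑ : ℝ → ℝ} (hσ : ContDiffOn ℝ ∞ σ J) (hσD : ∀ s ∈ J, σ s ∈ D)
    (hΨ : ∀ s ∈ J, A.orbitMap g θ (σ s) = (|m| * U s, ϑ s)) {s : ℝ} (hs : s ∈ J) :
    A.quotSq g (σ s) (deriv σ s) = 1 ↔
      ∃ ε : ℝ, (ε = 1 ∨ ε = -1) ∧ A.ProfileODE g U m D θ ε ϑ s := by
  have hd := ((hσ.contDiffAt (hJ.mem_nhds hs)).differentiableAt (by simp)).hasDerivAt
  have hvol : fderiv ℝ (A.volumeB g) (σ s) (deriv σ s) = |m| * deriv U s := by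
    have h1 := (differentiableAt_volumeB g
      (h.subset (hσD s hs))).hasFDerivAt.comp_hasDerivAt s hd
    have h2 : A.volumeB g ∘ σ =ᶠ[𝓝 s] fun s => |m| * U s :=
      (hJ.eventually_mem hs).mono fun s hs => congrArg Prod.fst (hΨ s hs)
    have h3 := (((hUs.contDiffAt (hJ.mem_nhds hs)).differentiableAt
      (by simp)).hasDerivAt.const_mul |m|).congr_of_eventuallyEq h2
    exact h1.unique h3
  have hthe : fderiv ℝ θ (σ s) (deriv σ s) = deriv ϑ s := by
    have h1 := (h.differentiableAt_theta (hσD s hs)).hasFDerivAt.comp_hasDerivAt s hd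
    have h2 : ϑ =ᶠ[𝓝 s] θ ∘ σ :=
      (hJ.eventually_mem hs).mono fun s hs => (congrArg Prod.snd (hΨ s hs)).symm
    exact (h1.congr_of_eventuallyEq h2).deriv.symm
  have hinv : A.orbitInv g D θ (|m| * U s, ϑ s) = σ s := by
    rw [← hΨ s hs, h.orbitInv_orbitMap (hσD s hs)]
  have him : (|m| * U s, ϑ s) ∈ A.orbitMap g θ '' D := ⟨σ s, hσD s hs, hΨ s hs⟩
  rw [h.quotSq_eq_add hX (hσD s hs), hvol, hthe,
    unit_speed_iff (h.normGradVolume_pos hX (hσD s hs)) (h.normGradTheta_pos hX (hσD s hs))]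
  simp only [ProfileODE, hinv, mul_pow, sq_abs, him, true_and]

/-- Curves in `D` with `ω = |m| U` correspond to functions `ϑ` through the diffeomorphism `(ω,θ)`,
and the unit speed condition is translated pointwise. The sign may therefore vary with `s`. -/
theorem isProfile_iff (hX : IsKilling g X) (hJ : IsOpen J) (hUs : ContDiffOn ℝ ∞ U J)
    (σ : ℝ → ℝ × ℝ) : (A.IsProfile g U m J σ ∧ ∀ s ∈ J, σ s ∈ D) ↔
      ∃ ϑ : ℝ → ℝ, ContDiffOn ℝ ∞ ϑ J ∧ ∀ s ∈ J,
        (∃ ε : ℝ, (ε = 1 ∨ ε = -1) ∧ A.ProfileODE g U m D θ ε ϑ s) ∧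
        σ s = A.orbitInv g D θ (|m| * U s, ϑ s) := by
  constructor
  · rintro ⟨⟨hσ, hprof⟩, hD⟩
    have hΨ : ∀ s ∈ J, A.orbitMap g θ (σ s) = (|m| * U s, θ (σ s)) := fun s hs =>
      Prod.ext (hprof s hs).2.1 rfl
    refine ⟨fun s => θ (σ s), h.smooth.comp hσ hD, fun s hs => ⟨?_, ?_⟩⟩
    · exact (h.quotSq_deriv_eq_one_iff hX hJ hUs hσ hD hΨ hs).1 (hprof s hs).2.2
    · rw [← hΨ s hs, h.orbitInv_orbitMap (hD s hs)]
  · rintro ⟨ϑ, hϑ, hode⟩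
    have him : ∀ s ∈ J, (|m| * U s, ϑ s) ∈ A.orbitMap g θ '' D := fun s hs => by
      obtain ⟨⟨ε, -, h1⟩, -⟩ := hode s hs
      exact h1.1
    have hD : ∀ s ∈ J, σ s ∈ D := fun s hs => (hode s hs).2 ▸ h.orbitInv_mem (him s hs)
    have hΨ : ∀ s ∈ J, A.orbitMap g θ (σ s) = (|m| * U s, ϑ s) := fun s hs => by
      rw [(hode s hs).2, h.orbitMap_orbitInv (him s hs)]
    have hσ : ContDiffOn ℝ ∞ σ J :=
      (h.contDiffOn_orbitInv.comp ((contDiffOn_const.mul hUs).prodMk hϑ) him).congr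
        fun s hs => (hode s hs).2
    refine ⟨⟨hσ, fun s hs => ⟨h.subset (hD s hs), congrArg Prod.fst (hΨ s hs), ?_⟩⟩, hD⟩
    exact (h.quotSq_deriv_eq_one_iff hX hJ hUs hσ hD hΨ hs).2 (hode s hs).1

/-- Where the profile equation is nondegenerate its sign is constant. -/
theorem exists_sign (hX : IsKilling g X) (hJ : IsOpenInterval J) {ϑ : ℝ → ℝ}
    (hϑ : ContDiffOn ℝ ∞ ϑ J) (hode : ∀ s ∈ J, A.Nondegenerate g U m D θ ϑ s ∧
      ∃ ε : ℝ, (ε = 1 ∨ ε = -1) ∧ A.ProfileODE g U m D θ ε ϑ s) :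
    ∃ ε : ℝ, (ε = 1 ∨ ε = -1) ∧ ∀ s ∈ J, A.ProfileODE g U m D θ ε ϑ s := by
  -- The strict inequality makes the root term positive, so `ε ϑ' < 0`. Thus `ϑ'` never vanishes,
  -- has constant sign on `J` by the intermediate value theorem, and determines `ε`.
  have hpos : ∀ s ∈ J, ∀ ε, A.ProfileODE g U m D θ ε ϑ s → ε * deriv ϑ s < 0 := by
    rintro s hs ε ⟨him, -, h1⟩
    have hD := h.orbitInv_mem him
    have ha := h.normGradVolume_pos hX hD
    have hb := mul_pos (h.normGradTheta_pos hX hD)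
      (Real.sqrt_pos.2 (sub_pos.2 (hode s hs).1))
    by_contra! hε
    nlinarith [mul_nonneg ha.le hε]
  have hne : ∀ s ∈ J, deriv ϑ s ≠ 0 := by
    intro s hs h0
    obtain ⟨ε, -, h1⟩ := (hode s hs).2
    simpa [h0] using hpos s hs ε h1
  have hcont : ContinuousOn (deriv ϑ) J :=
    (hϑ.deriv_of_isOpen (m := ∞) hJ.1 (by simp)).continuousOn
  have hsign : ∀ s ∈ J, ∀ r ∈ J, deriv ϑ s < 0 → deriv ϑ r < 0 := by
    intro s hs r hr h1
    by_contra! h2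
    obtain ⟨z, hz, h3⟩ := hJ.2.1.isPreconnected.intermediate_value hs hr hcont ⟨h1.le, h2⟩
    exact hne z hz h3
  obtain ⟨s₁, hs₁⟩ := hJ.2.2
  rcases (hne s₁ hs₁).lt_or_gt with h1 | h1
  · refine ⟨1, Or.inl rfl, fun s hs => ?_⟩
    obtain ⟨ε, hε | hε, h2⟩ := (hode s hs).2
    · exact hε ▸ h2
    · have h3 := hpos s hs ε h2
      have h4 := hsign s₁ hs₁ s hs h1
      rw [hε] at h3
      linarith
  · refine ⟨-1, Or.inr rfl, fun s hs => ?_⟩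
    obtain ⟨ε, hε | hε, h2⟩ := (hode s hs).2
    · have h3 := hpos s hs ε h2
      rw [hε] at h3
      have h4 := hsign s hs s₁ hs₁ (by linarith)
      linarith
    · exact hε ▸ h2

/-- The strict inequality is an open condition and keeps the radicand positive, where the square
root is smooth. -/
theorem profileDomain_and_slope (hX : IsKilling g X) (hJ : IsOpen J) (hUs : ContDiffOn ℝ ∞ U J) :
    IsOpen (profileDomain A g J U m D θ) ∧
      ContDiffOn ℝ ∞ (profileSlope A g U m ε D θ) (profileDomain A g J U m D θ) := by
  have hc : ContDiffOn ℝ ∞ (fun p : ℝ × ℝ => (|m| * U p.1, p.2)) (J ×ˢ univ) :=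
    (contDiffOn_const.mul (hUs.comp contDiffOn_fst fun p hp => hp.1)).prodMk contDiffOn_snd
  have hd : ContDiffOn ℝ ∞ (fun p : ℝ × ℝ => deriv U p.1) (J ×ˢ univ) :=
    (hUs.deriv_of_isOpen (m := ∞) hJ (by simp)).comp contDiffOn_fst fun p hp => hp.1
  set S : Set (ℝ × ℝ) := (J ×ˢ univ) ∩ (fun p : ℝ × ℝ => (|m| * U p.1, p.2)) ⁻¹'
    (A.orbitMap g θ '' D) with hS
  have hSo : IsOpen S :=
    hc.continuousOn.isOpen_inter_preimage (hJ.prod isOpen_univ) h.isOpen_image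
  have hinv : ContDiffOn ℝ ∞ (fun p : ℝ × ℝ => A.orbitInv g D θ (|m| * U p.1, p.2)) S :=
    h.contDiffOn_orbitInv.comp (hc.mono inter_subset_left) fun p hp => hp.2
  have hinvD : ∀ p ∈ S, A.orbitInv g D θ (|m| * U p.1, p.2) ∈ D := fun p hp =>
    h.orbitInv_mem hp.2
  have ha : ContDiffOn ℝ ∞
      (fun p : ℝ × ℝ => A.normGradVolume g (A.orbitInv g D θ (|m| * U p.1, p.2))) S :=
    (h.contDiffOn_normGradVolume hX).comp hinv hinvD
  have hb : ContDiffOn ℝ ∞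
      (fun p : ℝ × ℝ => A.normGradTheta g θ (A.orbitInv g D θ (|m| * U p.1, p.2))) S :=
    (h.contDiffOn_normGradTheta hX).comp hinv hinvD
  have hrad : ContDiffOn ℝ ∞
      (fun p : ℝ × ℝ => A.normGradVolume g (A.orbitInv g D θ (|m| * U p.1, p.2)) ^ 2
        - m ^ 2 * deriv U p.1 ^ 2) S :=
    (ha.pow 2).sub (contDiffOn_const.mul ((hd.mono inter_subset_left).pow 2))
  have heq : profileDomain A g J U m D θ
      = S ∩ (fun p : ℝ × ℝ => A.normGradVolume g (A.orbitInv g D θ (|m| * U p.1, p.2)) ^ 2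
        - m ^ 2 * deriv U p.1 ^ 2) ⁻¹' Ioi 0 := by
    ext p
    simp only [profileDomain, hS, mem_ofPred_eq, mem_inter_iff, mem_prod, mem_univ, and_true,
      mem_preimage, mem_Ioi, sub_pos, and_assoc]
  rw [heq]
  refine ⟨hrad.continuousOn.isOpen_inter_preimage hSo isOpen_Ioi, ?_⟩
  exact (contDiffOn_const.mul (((hb.mono inter_subset_left).mul
    ((hrad.mono inter_subset_left).sqrt fun p hp => ne_of_gt hp.2)).div
      (ha.mono inter_subset_left) fun p hp => (h.normGradVolume_pos hX (hinvD p hp.1)).ne')).neg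

/-- Normal form of the equation: division by `‖∇ω‖ > 0` and `ε² = 1` solve it for `ϑ'`. -/
theorem profileODE_iff (hX : IsKilling g X) (hε : ε = 1 ∨ ε = -1) {ϑ : ℝ → ℝ} {s : ℝ}
    (hs : s ∈ J) : (A.Nondegenerate g U m D θ ϑ s ∧ A.ProfileODE g U m D θ ε ϑ s) ↔
      (s, ϑ s) ∈ profileDomain A g J U m D θ ∧
        deriv ϑ s = profileSlope A g U m ε D θ (s, ϑ s) := by
  have h2 : ε * ε = 1 := by rcases hε with rfl | rfl <;> norm_num
  have key : ∀ {a b d : ℝ}, 0 < a → (b + ε * a * d = 0 ↔ d = -(ε * (b / a))) := by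
    intro a b d ha
    constructor
    · intro h1
      field_simp
      linear_combination ε * h1 - a * d * h2
    · rintro rfl
      field_simp
      linear_combination (-b) * h2
  constructor
  · rintro ⟨h3, h4, -, h5⟩
    exact ⟨⟨hs, h4, h3⟩, (key (h.normGradVolume_pos hX (h.orbitInv_mem h4))).1 h5⟩
  · rintro ⟨⟨-, h4, h3⟩, h5⟩
    exact ⟨h3, h4, h3.le, (key (h.normGradVolume_pos hX (h.orbitInv_mem h4))).2 h5⟩

/-- The initial value problem for the profile equation. -/
theorem exists_profile_solution (hX : IsKilling g X) (hJ : IsOpen J) (hUs : ContDiffOn ℝ ∞ U J)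
    (hε : ε = 1 ∨ ε = -1) {s₀ : ℝ} {y₀ : ℝ × ℝ} (hs₀ : s₀ ∈ J) (hy₀ : y₀ ∈ D)
    (hvol : A.volumeB g y₀ = |m| * U s₀)
    (hnd : m ^ 2 * deriv U s₀ ^ 2 < A.normGradVolume g y₀ ^ 2) :
    ∃ (J' : Set ℝ) (ϑ : ℝ → ℝ), IsOpenInterval J' ∧ J' ⊆ J ∧ s₀ ∈ J' ∧
      ContDiffOn ℝ ∞ ϑ J' ∧ ϑ s₀ = θ y₀ ∧
      ∀ s ∈ J', A.Nondegenerate g U m D θ ϑ s ∧ A.ProfileODE g U m D θ ε ϑ s := by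
  obtain ⟨hW, hF⟩ := h.profileDomain_and_slope (m := m) (ε := ε) hX hJ hUs
  have hΨ : (|m| * U s₀, θ y₀) = A.orbitMap g θ y₀ := Prod.ext hvol.symm rfl
  have h₀ : (s₀, θ y₀) ∈ profileDomain A g J U m D θ := by
    refine ⟨hs₀, ⟨y₀, hy₀, hΨ.symm⟩, ?_⟩
    change _ < A.normGradVolume g (A.orbitInv g D θ (|m| * U s₀, θ y₀)) ^ 2
    rwa [hΨ, h.orbitInv_orbitMap hy₀]
  obtain ⟨δ, hδ, ϑ, hϑ, hϑ0, hsol⟩ := exists_scalar_solution hW hF h₀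
  refine ⟨Ioo (s₀ - δ) (s₀ + δ), ϑ, IsOpenInterval.Ioo (by linarith),
    fun s hs => (hsol s hs).1.1, ⟨by linarith, by linarith⟩, hϑ, hϑ0, fun s hs => ?_⟩
  exact (h.profileODE_iff hX hε (hsol s hs).1.1).2 ⟨(hsol s hs).1, (hsol s hs).2.deriv⟩

theorem profile_solution_unique (hX : IsKilling g X) (hJ : IsOpen J) (hUs : ContDiffOn ℝ ∞ U J)
    (hε : ε = 1 ∨ ε = -1) {J' : Set ℝ} (hJ' : IsOpenInterval J') (hsub : J' ⊆ J) {s₀ : ℝ}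
    (hs₀ : s₀ ∈ J') {ϑ₁ ϑ₂ : ℝ → ℝ} (h₁ : ContDiffOn ℝ ∞ ϑ₁ J') (h₂ : ContDiffOn ℝ ∞ ϑ₂ J')
    (h0 : ϑ₁ s₀ = ϑ₂ s₀)
    (ho₁ : ∀ s ∈ J', A.Nondegenerate g U m D θ ϑ₁ s ∧ A.ProfileODE g U m D θ ε ϑ₁ s)
    (ho₂ : ∀ s ∈ J', A.Nondegenerate g U m D θ ϑ₂ s ∧ A.ProfileODE g U m D θ ε ϑ₂ s) :
    EqOn ϑ₁ ϑ₂ J' := by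
  obtain ⟨hW, hF⟩ := h.profileDomain_and_slope (m := m) (ε := ε) hX hJ hUs
  have hsol : ∀ ϑ : ℝ → ℝ, ContDiffOn ℝ ∞ ϑ J' →
      (∀ s ∈ J', A.Nondegenerate g U m D θ ϑ s ∧ A.ProfileODE g U m D θ ε ϑ s) →
      ∀ s ∈ J', (s, ϑ s) ∈ profileDomain A g J U m D θ ∧
        HasDerivAt ϑ (profileSlope A g U m ε D θ (s, ϑ s)) s := by
    intro ϑ hϑ ho s hs
    obtain ⟨h3, h4⟩ := (h.profileODE_iff hX hε (hsub hs)).1 (ho s hs)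
    exact ⟨h3, h4 ▸ ((hϑ.contDiffAt (hJ'.1.mem_nhds hs)).differentiableAt (by simp)).hasDerivAt⟩
  exact scalar_solution_unique hW hF hJ' (hsol ϑ₁ h₁ ho₁) (hsol ϑ₂ h₂ ho₂) hs₀ h0

end AdaptedChart.IsOrbitCoord

end Profile

/-! ### Assembly of the theorem. -/

theorem theoremB {N : Type*} [TopologicalSpace N] [T2Space N] [ChartedSpace E3 N]
    [IsManifold (𝓡 3) ∞ N] (g : Metric3 N) (X : (x : N) → TangentSpace (𝓡 3) x)
    (hX : IsKilling g X) :
    -- `X`-adapted coordinates exist around every point where `X` does not vanish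
    (∀ p : N, X p ≠ 0 → ∃ A : AdaptedChart X, p ∈ A.chart.source) ∧
    -- in `X`-adapted coordinates `g_{ij}` and `ω = √g₃₃` do not depend on `x₃`, the local flow of
    -- `X` is the translation of `x₃`, and `π` is a Riemannian submersion onto the orbit space
    (∀ A : AdaptedChart X, ∀ q ∈ A.chart.source,
      (∀ i j : Fin 3, A.coeff g i j q = A.coeffB g i j (A.proj q)) ∧
      volumeFn g X q = A.volumeB g (A.proj q) ∧
      A.volumeB g (A.proj q) = Real.sqrt (A.coeffB g 2 2 (A.proj q)) ∧
      (∀ (r : ℝ) (q' : N), FlowsTo X A.chart.source q r q' ↔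
        A.height q + r ∈ A.fib ∧ q' = A.pt (A.proj q) (A.height q + r)) ∧
      (∀ w : TangentSpace (𝓡 3) q, g.inner q w (X q) = 0 →
        A.quotSq g (A.proj q) (mfderiv (𝓡 3) 𝓘(ℝ, ℝ × ℝ) A.proj q w) = g.inner q w w)) ∧
    -- around every point where moreover `dω ≠ 0` the linear equation for `θ` can be solved so that
    -- `(ω,θ)` are coordinates on the orbit space
    (∀ A : AdaptedChart X, ∀ p ∈ A.chart.source,
      mfderiv (𝓡 3) 𝓘(ℝ, ℝ) (volumeFn g X) p ≠ 0 →
        ∃ (D : Set (ℝ × ℝ)) (θ : ℝ × ℝ → ℝ), A.proj p ∈ D ∧ A.IsOrbitCoord g D θ) ∧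
    -- such coordinates are smooth and orthogonal, and they diagonalize the quotient metric
    (∀ (A : AdaptedChart X) (D : Set (ℝ × ℝ)) (θ : ℝ × ℝ → ℝ), A.IsOrbitCoord g D θ →
      IsOpen (A.orbitMap g θ '' D) ∧
      ContDiffOn ℝ ∞ (A.orbitMap g θ) D ∧
      ContDiffOn ℝ ∞ (A.orbitInv g D θ) (A.orbitMap g θ '' D) ∧
      (∀ q ∈ A.chart.source, A.proj q ∈ D →
        g.inner q (grad g (volumeFn g X) q) (grad g (fun q' => θ (A.proj q')) q) = 0 ∧
        gradNorm g (volumeFn g X) q = A.normGradVolume g (A.proj q) ∧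
        gradNorm g (fun q' => θ (A.proj q')) q = A.normGradTheta g θ (A.proj q)) ∧
      ∀ y ∈ D, 0 < A.normGradVolume g y ∧ 0 < A.normGradTheta g θ y ∧
        ∀ w : ℝ × ℝ, A.quotSq g y w =
          (fderiv ℝ (A.volumeB g) y w) ^ 2 / A.normGradVolume g y ^ 2
            + (fderiv ℝ θ y w) ^ 2 / A.normGradTheta g θ y ^ 2) ∧
    -- the surfaces isometric to the given metric `ds² + U(s)² dt²`
    (∀ (J : Set ℝ) (U : ℝ → ℝ), IsOpenInterval J → ContDiffOn ℝ ∞ U J → (∀ s ∈ J, 0 < U s) →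
      -- each of them belongs to the Bour family, for exactly one parameter
      (∀ (T : Set ℝ) (ψ : ℝ × ℝ → N), IsOpenInterval T → IsNaturalSurface g X U J T ψ →
        ∃! m : ℝ, m ≠ 0 ∧ IsBourSurface g X U m J T ψ) ∧
      ∀ m : ℝ, m ≠ 0 → ∀ A : AdaptedChart X,
        -- the surfaces of parameter `m` in the domain of `A` are exactly those given by a profile
        -- curve and the explicit third coordinate
        (∀ (T : Set ℝ) (ψ : ℝ × ℝ → N) (s₀ : ℝ), IsOpenInterval T → s₀ ∈ J →
          ((IsBourSurface g X U m J T ψ ∧ ∀ p ∈ J ×ˢ T, ψ p ∈ A.chart.source) ↔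
            ∃ (σ : ℝ → ℝ × ℝ) (c : ℝ), A.IsProfile g U m J σ ∧ ∀ s ∈ J, ∀ t ∈ T,
              A.thirdCoord g U m σ s₀ c s t ∈ A.fib ∧
              ψ (s, t) = A.pt (σ s) (A.thirdCoord g U m σ s₀ c s t))) ∧
        -- independence of the lift `γ` of the profile curve: with
        -- `v(s,t) = a + t/m - ∫ g(X,γ') / (m² U²) ds` the third coordinate `x₃(s) + v(s,t)` of
        -- `φ_{v(s,t)}(γ(s))` depends on `γ` only through the constant of integration
        (∀ (σ : ℝ → ℝ × ℝ) (γ : ℝ → N) (s₀ : ℝ), s₀ ∈ J → A.IsProfile g U m J σ →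
          ContMDiffOn 𝓘(ℝ, ℝ) (𝓡 3) ∞ γ J →
          (∀ s ∈ J, γ s ∈ A.chart.source ∧ A.proj (γ s) = σ s) →
          ∀ a : ℝ, ∀ s ∈ J, ∀ t : ℝ,
            A.height (γ s) + (a + t / m - ∫ r in s₀..s,
                g.inner (γ r) (X (γ r)) (velocity γ r) / (m ^ 2 * U r ^ 2))
              = A.thirdCoord g U m σ s₀ (a + A.height (γ s₀)) s t ∧
            (A.thirdCoord g U m σ s₀ (a + A.height (γ s₀)) s t ∈ A.fib →
              FlowsTo X A.chart.source (γ s)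
                (a + t / m - ∫ r in s₀..s,
                  g.inner (γ r) (X (γ r)) (velocity γ r) / (m ^ 2 * U r ^ 2))
                (A.pt (σ s) (A.thirdCoord g U m σ s₀ (a + A.height (γ s₀)) s t)))) ∧
        ∀ (D : Set (ℝ × ℝ)) (θ : ℝ × ℝ → ℝ), A.IsOrbitCoord g D θ →
          -- the profile curves in `D` are exactly the curves with `ω(s) = |m| U(s)` whose
          -- coordinate `θ(s)` solves the ordinary differential equation
          (∀ σ : ℝ → ℝ × ℝ, (A.IsProfile g U m J σ ∧ ∀ s ∈ J, σ s ∈ D) ↔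
            ∃ ϑ : ℝ → ℝ, ContDiffOn ℝ ∞ ϑ J ∧ ∀ s ∈ J,
              (∃ ε : ℝ, (ε = 1 ∨ ε = -1) ∧ A.ProfileODE g U m D θ ε ϑ s) ∧
              σ s = A.orbitInv g D θ (|m| * U s, ϑ s)) ∧
          -- where the equation is nondegenerate its sign is constant
          (∀ ϑ : ℝ → ℝ, ContDiffOn ℝ ∞ ϑ J →
            (∀ s ∈ J, A.Nondegenerate g U m D θ ϑ s ∧
              ∃ ε : ℝ, (ε = 1 ∨ ε = -1) ∧ A.ProfileODE g U m D θ ε ϑ s) →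
            ∃ ε : ℝ, (ε = 1 ∨ ε = -1) ∧ ∀ s ∈ J, A.ProfileODE g U m D θ ε ϑ s) ∧
          -- and its initial value problem has a local solution, which is unique
          (∀ (ε s₀ : ℝ) (y₀ : ℝ × ℝ), (ε = 1 ∨ ε = -1) → s₀ ∈ J → y₀ ∈ D →
            A.volumeB g y₀ = |m| * U s₀ →
            m ^ 2 * deriv U s₀ ^ 2 < A.normGradVolume g y₀ ^ 2 →
            (∃ (J' : Set ℝ) (ϑ : ℝ → ℝ), IsOpenInterval J' ∧ J' ⊆ J ∧ s₀ ∈ J' ∧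
              ContDiffOn ℝ ∞ ϑ J' ∧ ϑ s₀ = θ y₀ ∧
              ∀ s ∈ J', A.Nondegenerate g U m D θ ϑ s ∧ A.ProfileODE g U m D θ ε ϑ s) ∧
            ∀ (J' : Set ℝ) (ϑ₁ ϑ₂ : ℝ → ℝ), IsOpenInterval J' → J' ⊆ J → s₀ ∈ J' →
              ContDiffOn ℝ ∞ ϑ₁ J' → ContDiffOn ℝ ∞ ϑ₂ J' → ϑ₁ s₀ = θ y₀ → ϑ₂ s₀ = θ y₀ →
              (∀ s ∈ J', A.Nondegenerate g U m D θ ϑ₁ s ∧ A.ProfileODE g U m D θ ε ϑ₁ s) →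
              (∀ s ∈ J', A.Nondegenerate g U m D θ ϑ₂ s ∧ A.ProfileODE g U m D θ ε ϑ₂ s) →
              EqOn ϑ₁ ϑ₂ J')) := by
  refine ⟨fun p hp => exists_adaptedChart hX.smooth hp, fun A q hq => ?_,
    fun A p hp hd => AdaptedChart.exists_isOrbitCoord hX A hp hd, fun A D θ h => ?_,
    fun J U hJ hUs hU => ?_⟩
  · exact ⟨fun i j => AdaptedChart.coeff_eq_coeffB hX hq i j,
      AdaptedChart.volumeFn_eq_volumeB hX hq,
      AdaptedChart.volumeB_eq g (AdaptedChart.proj_mem hq), AdaptedChart.flowsTo_iff hq,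
      AdaptedChart.quotSq_mfderiv_proj hX hq⟩
  · exact ⟨h.isOpen_image, h.contDiffOn_orbitMap, h.contDiffOn_orbitInv,
      fun q hq hqD => h.grad_properties hX hq hqD, fun y hy =>
        ⟨h.normGradVolume_pos hX hy, h.normGradTheta_pos hX hy, h.quotSq_eq_add hX hy⟩⟩
  refine ⟨fun T ψ hT hψ => hψ.existsUnique_parameter hX hJ hT hU, fun m hm A =>
    ⟨fun T ψ s₀ hT hs₀ => ⟨fun h => h.1.exists_profile hX hJ hT hUs hU hm h.2 hs₀, ?_⟩,
      fun σ γ s₀ hs₀ hσ hγ hlift a s hs t => ?_, fun D θ h => ⟨h.isProfile_iff hX hJ.1 hUs,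
        fun ϑ hϑ hode => h.exists_sign hX hJ hϑ hode, fun ε s₀ y₀ hε hs₀ hy₀ hvol hnd => ⟨?_, ?_⟩⟩⟩⟩
  · rintro ⟨σ, c, hσ, hψ⟩
    exact hσ.isBourSurface hX hJ hT hUs hU hm hs₀ hψ
  · have h := hσ.lift_independence hX hJ hUs hU hm hs₀ hγ hlift a hs t
    refine ⟨h, fun hfib => (AdaptedChart.flowsTo_iff (hlift s hs).1 _ _).2 ?_⟩
    rw [h, (hlift s hs).2]
    exact ⟨hfib, rfl⟩
  · exact h.exists_profile_solution hX hJ.1 hUs hε hs₀ hy₀ hvol hnd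
  · intro J' ϑ₁ ϑ₂ hJ' hsub hs₀' h₁ h₂ h01 h02 ho₁ ho₂
    exact h.profile_solution_unique hX hJ.1 hUs hε hJ' hsub hs₀' h₁ h₂ (h01.trans h02.symm) ho₁ ho₂
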